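/- Let $G$ be a connected Lie group with Lie algebra $\mathfrak g$, $H\subset G$ a closed subgroup with Lie algebra $\mathfrak h$, $M=G/H$ with its smooth structure as a homogeneous manifold, $p:G\to M$ and $q:\mathfrak g\to\mathfrak g/\mathfrak h$ the projections, $\lambda_g:M\to M$ the action of $g\in G$, $c_g(a)=gag^{-1}$, $\bar g=gH$. Let $\pi$ be a $G$-invariant Poisson structure on $M$, with sharp map $\pi_\#:T^*M\to TM$, $\langle\beta,\pi_\#\alpha\rangle=\pi(\alpha,\beta)$, and let $r$ be the bivector on $\mathfrak g/\mathfrak h$ corresponding to $\pi_{\bar e}$ under the isomorphism $\mathfrak g/\mathfrak h\cong T_{\bar e}M$ induced by $T_ep$, with sharp map $r_\#:(\mathfrak g/\mathfrak h)^*\to\mathfrak g/\mathfrak h$. Put $\mathfrak a_r=q^{-1}(\operatorname{Im} r_\#)$ and let $A_r$ be the connected immersed Lie subgroup of $G$ with Lie algebra $\mathfrak a_r$. For $x,y\in\mathfrak a_r$ let $\omega_r(x,y)=r(\eta,\xi)$, where $\eta,\xi\in(\mathfrak g/\mathfrak h)^*$ are any elements with $r_\#\eta=q(x)$, $r_\#\xi=q(y)$.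 Then: 1. $E=\operatorname{Im}\pi_\#$ is a smooth vector subbundle of $TM$, and $[g,u+\mathfrak h]\mapsto T_{\bar e}\lambda_g(T_ep(u))$ is a well-defined isomorphism of homogeneous $G$-vector bundles from $G\times_H(\mathfrak a_r/\mathfrak h)$ (where $H$ acts on $\mathfrak a_r/\mathfrak h$ through $\mathrm{Ad}$) onto $E$. 2. For every $g\in G$ the symplectic leaf $\mathcal F^{\bar g}$ through $\bar g$ (the set of points that can be joined to $\bar g$ by piecewise smooth curves tangent to $E$) is $\{gaH : a\in A_r\}=c_g(A_r)\cdot gH$. 3. There is an $A_r$-invariant symplectic form $\sigma$ on $A_r/(A_r\cap H)$ (which is $A_r/H$ when $H\subset A_r$), given at the base point by $\omega_r$, and $A_r$ acts smoothly on $A_r/(A_r\cap H)$. For every $g\in G$ the map $a(A_r\cap H)\mapsto gaH$ is an injective immersion of $A_r/(A_r\cap H)$ onto $\mathcal F^{\bar g}$, whose tangent spaces are the fibres of $E$; it carries $\sigma$ to the symplectic form $(\pi_\#\alpha,\pi_\#\beta)\mapsto\pi(\alpha,\beta)$ of the leaf, and the action of $a\in A_r$ to the action of $c_g(a)$. Thus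 $\mathcal F^{\bar g}$ is a $c_g(A_r)$-homogeneous symplectic manifold isomorphic to $A_r/(A_r\cap H)$. 4. If $H\subset A_r$, then $gA_r\mapsto\mathcal F^{\bar g}$ is a well-defined homeomorphism from $G/A_r$ onto the leaf space $M/\mathcal F$ (both with the quotient topology). 5. If $\mathfrak g=\mathfrak h\oplus\mathfrak m$ with $\mathrm{Ad}(H)(\mathfrak m)=\mathfrak m$, then, regarding $\operatorname{Im} r_\#$ as a subspace of $\mathfrak m\cong\mathfrak g/\mathfrak h$, $\mathfrak a_r=\mathfrak h\oplus\operatorname{Im} r_\#$ and $\mathrm{Ad}(H)(\operatorname{Im} r_\#)=\operatorname{Im} r_\#$, so that the reductive decomposition of $(G,H)$ induces one of $(A_r,H)$. If moreover $[\mathfrak m,\mathfrak m]\subset\mathfrak h$, then $[\operatorname{Im} r_\#,\operatorname{Im} r_\#]\subset\mathfrak h$, so that the canonical decomposition of a symmetric pair $(G,H)$ induces one of $(A_r,H)$. -/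

import Mathlib

open scoped Manifold ContDiff Topology
open Manifold

noncomputable section

namespace HomPoisson

section Submersions
variable {E F C : Type*} [NormedAddCommGroup E] [NormedSpace ℝ E] [NormedAddCommGroup F]
  [NormedSpace ℝ F] [NormedAddCommGroup C] [NormedSpace ℝ C]
  {M N : Type*} [TopologicalSpace M] [ChartedSpace E M]
  [TopologicalSpace N] [ChartedSpace F N]

theorem chart_mdiff {e : OpenPartialHomeomorph M E}
    (he : e ∈ IsManifold.maximalAtlas 𝓘(ℝ, E) ∞ M) :
    e.MDifferentiable 𝓘(ℝ, E) 𝓘(ℝ, E) :=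
  ⟨(contMDiffOn_of_mem_maximalAtlas he).mdifferentiableOn (by simp),
    (contMDiffOn_symm_of_mem_maximalAtlas he).mdifferentiableOn (by simp)⟩

theorem submersion_deriv {f : M → N} {x : M}
    (h : IsSubmersionAtOfComplement C 𝓘(ℝ, E) 𝓘(ℝ, F) ∞ f x) (u : TangentSpace 𝓘(ℝ, E) x) :
    (mfderiv 𝓘(ℝ, F) 𝓘(ℝ, F) h.codChart (f x) (mfderiv 𝓘(ℝ, E) 𝓘(ℝ, F) f x u) : F) =
      (h.equiv (mfderiv 𝓘(ℝ, E) 𝓘(ℝ, E) h.domChart x u : E)).1 := by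
  have hx := h.mem_domChart_source
  have hf : MDifferentiableAt 𝓘(ℝ, E) 𝓘(ℝ, F) f x := h.contMDiffAt.mdifferentiableAt (by simp)
  have hφ := (chart_mdiff h.domChart_mem_maximalAtlas).mdifferentiableAt hx
  have hψ := (chart_mdiff h.codChart_mem_maximalAtlas).mdifferentiableAt h.mem_codChart_source
  let L : E →L[ℝ] F := (ContinuousLinearMap.fst ℝ F C).comp (h.equiv : E →L[ℝ] F × C)
  have key : (h.codChart ∘ f) =ᶠ[𝓝 x] (L ∘ h.domChart) := by
    filter_upwards [h.domChart.open_source.mem_nhds hx] with y hy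
    have hm : h.domChart y ∈ (h.domChart.extend 𝓘(ℝ, E)).target := by
      simp [h.domChart.map_source hy]
    have := h.writtenInCharts hm
    simpa [h.domChart.left_inv hy, L] using this
  have h1 : HasMFDerivAt 𝓘(ℝ, E) 𝓘(ℝ, F) (h.codChart ∘ f) x _ :=
    hψ.hasMFDerivAt.comp x hf.hasMFDerivAt
  have h2 : HasMFDerivAt 𝓘(ℝ, E) 𝓘(ℝ, F) (L ∘ h.domChart) x _ :=
    (L.hasMFDerivAt (x := h.domChart x)).comp x hφ.hasMFDerivAt
  have h3 := hasMFDerivAt_unique (h1.congr_of_eventuallyEq key.symm) h2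
  exact DFunLike.congr_fun h3 u

theorem submersion_surjective {f : M → N} {x : M}
    (h : IsSubmersionAtOfComplement C 𝓘(ℝ, E) 𝓘(ℝ, F) ∞ f x) :
    Function.Surjective (mfderiv 𝓘(ℝ, E) 𝓘(ℝ, F) f x) := by
  intro w
  have hφ := chart_mdiff h.domChart_mem_maximalAtlas
  have hψ := chart_mdiff h.codChart_mem_maximalAtlas
  obtain ⟨u, hu⟩ := hφ.mfderiv_surjective h.mem_domChart_source
    (h.equiv.symm ((mfderiv 𝓘(ℝ, F) 𝓘(ℝ, F) h.codChart (f x) w : F), (0 : C)) : E)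
  refine ⟨u, hψ.mfderiv_injective h.mem_codChart_source ?_⟩
  refine (submersion_deriv h u).trans ?_
  rw [hu]
  exact congrArg Prod.fst (h.equiv.apply_symm_apply _)

theorem submersion_curve {f : M → N} {x : M}
    (h : IsSubmersionAtOfComplement C 𝓘(ℝ, E) 𝓘(ℝ, F) ∞ f x) (u : TangentSpace 𝓘(ℝ, E) x)
    (hu : mfderiv 𝓘(ℝ, E) 𝓘(ℝ, F) f x u = 0) :
    ∃ γ : ℝ → M, γ 0 = x ∧ ContMDiffAt 𝓘(ℝ, ℝ) 𝓘(ℝ, E) ∞ γ 0 ∧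
      (∀ᶠ t in 𝓝 (0 : ℝ), f (γ t) = f x) ∧ (mfderiv 𝓘(ℝ, ℝ) 𝓘(ℝ, E) γ 0 (1 : ℝ) : E) = u := by
  have hx := h.mem_domChart_source
  have hφ := chart_mdiff h.domChart_mem_maximalAtlas
  set v : E := mfderiv 𝓘(ℝ, E) 𝓘(ℝ, E) h.domChart x u with hv
  have hv0 : (h.equiv v).1 = 0 := by
    rw [hv, ← submersion_deriv h u, hu]
    exact map_zero (mfderiv 𝓘(ℝ, F) 𝓘(ℝ, F) h.codChart (f x))
  set ℓ : ℝ → E := fun t => h.domChart x + t • v with hℓ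
  have hℓs : ContMDiff 𝓘(ℝ, ℝ) 𝓘(ℝ, E) ∞ ℓ := by
    rw [contMDiff_iff_contDiff]; fun_prop
  have hℓ0 : ℓ 0 = h.domChart x := by simp [hℓ]
  have ht : ℓ 0 ∈ h.domChart.target := by rw [hℓ0]; exact h.domChart.map_source hx
  have hsm : ContMDiffAt 𝓘(ℝ, ℝ) 𝓘(ℝ, E) ∞ (h.domChart.symm ∘ ℓ) 0 :=
    (contMDiffAt_symm_of_mem_maximalAtlas h.domChart_mem_maximalAtlas ht).comp _ hℓs.contMDiffAt
  refine ⟨h.domChart.symm ∘ ℓ, by simp [hℓ0, h.domChart.left_inv hx], hsm, ?_, ?_⟩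
  · filter_upwards [hℓs.continuous.continuousAt.preimage_mem_nhds
      (h.domChart.open_target.mem_nhds ht)] with t hmem
    have hmem : ℓ t ∈ h.domChart.target := hmem
    have hm1 : ℓ t ∈ (h.domChart.extend 𝓘(ℝ, E)).target := by simpa using hmem
    have hm2 : h.domChart x ∈ (h.domChart.extend 𝓘(ℝ, E)).target := by
      simp [h.domChart.map_source hx]
    have e1 := h.writtenInCharts hm1
    have e2 := h.writtenInCharts hm2
    have e3 : (h.equiv (ℓ t)).1 = (h.equiv (h.domChart x)).1 := by
      simp [hℓ, hv0]
    have m1 : f (h.domChart.symm (ℓ t)) ∈ h.codChart.source :=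
      h.source_subset_preimage_source (h.domChart.map_target hmem)
    apply h.codChart.injOn m1 h.mem_codChart_source
    simp [h.domChart.left_inv hx] at e1 e2
    simp [e1, e2, e3]
  · have hd : HasMFDerivAt 𝓘(ℝ, ℝ) 𝓘(ℝ, E) ℓ 0 (ContinuousLinearMap.toSpanSingleton ℝ v) := by
      apply HasFDerivAt.hasMFDerivAt
      have := ((hasDerivAt_id (0 : ℝ)).smul_const v).const_add (h.domChart x)
      have h2 := this.hasFDerivAt
      rw [one_smul] at h2
      exact h2
    have hs := (hφ.mdifferentiableAt_symm ht).hasMFDerivAt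
    have hc := hs.comp 0 hd
    rw [hc.mfderiv]
    have hinv := hφ.symm_comp_deriv hx
    have : ∀ y : E, y = h.domChart x →
      (mfderiv 𝓘(ℝ, E) 𝓘(ℝ, E) h.domChart.symm y v : E) = u := by
      rintro y rfl
      exact DFunLike.congr_fun hinv u
    have h1 : ((ContinuousLinearMap.toSpanSingleton ℝ v) (1 : ℝ) : E) = v := by simp
    have := this _ hℓ0
    rw [← h1] at this
    exact this
end Submersions

section Manifolds

variable {F : Type*} [NormedAddCommGroup F] [NormedSpace ℝ F]
  {M : Type*} [TopologicalSpace M] [ChartedSpace F M]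

/-- The differential of a real function at a point, as a covector. -/
def covector (F : Type*) [NormedAddCommGroup F] [NormedSpace ℝ F]
    {M : Type*} [TopologicalSpace M] [ChartedSpace F M] (f : M → ℝ) (x : M) :
    Module.Dual ℝ (TangentSpace 𝓘(ℝ, F) x) :=
  (mfderiv 𝓘(ℝ, F) 𝓘(ℝ, ℝ) f x : TangentSpace 𝓘(ℝ, F) x →L[ℝ] ℝ).toLinearMap

/-- The bracket `{f, g} = π(df, dg) = ⟨dg, (df)^#⟩` of the bivector field with sharp map `P`. -/
def bracketOf (P : ∀ x : M, Module.Dual ℝ (TangentSpace 𝓘(ℝ, F) x) →ₗ[ℝ] TangentSpace 𝓘(ℝ, F) x)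
    (f g : M → ℝ) (x : M) : ℝ :=
  covector F g x (P x (covector F f x))

variable (F M) in
/-- A Poisson structure on a manifold `M`: a smooth skew-symmetric bivector field `π` whose bracket
of functions satisfies the Jacobi identity. The bivector is recorded by its sharp map
`π_# : T*M → TM`, `⟨β, π_# α⟩ = π(α, β)`; smoothness is tested on differentials of smooth
functions. -/
structure PoissonStructure where
  sharp : ∀ x : M, Module.Dual ℝ (TangentSpace 𝓘(ℝ, F) x) →ₗ[ℝ] TangentSpace 𝓘(ℝ, F) x
  skew : ∀ (x : M) (α β : Module.Dual ℝ (TangentSpace 𝓘(ℝ, F) x)),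
    β (sharp x α) = -α (sharp x β)
  smooth : ∀ f g : M → ℝ, ContMDiff 𝓘(ℝ, F) 𝓘(ℝ, ℝ) ∞ f → ContMDiff 𝓘(ℝ, F) 𝓘(ℝ, ℝ) ∞ g →
    ContMDiff 𝓘(ℝ, F) 𝓘(ℝ, ℝ) ∞ (bracketOf sharp f g)
  jacobi : ∀ f g k : M → ℝ, ContMDiff 𝓘(ℝ, F) 𝓘(ℝ, ℝ) ∞ f → ContMDiff 𝓘(ℝ, F) 𝓘(ℝ, ℝ) ∞ g →
    ContMDiff 𝓘(ℝ, F) 𝓘(ℝ, ℝ) ∞ k → ∀ x : M,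
    bracketOf sharp f (bracketOf sharp g k) x + bracketOf sharp g (bracketOf sharp k f) x
      + bracketOf sharp k (bracketOf sharp f g) x = 0

/-- The characteristic distribution `E = Im π_#`. -/
def PoissonStructure.charDist (π : PoissonStructure F M) (x : M) :
    Submodule ℝ (TangentSpace 𝓘(ℝ, F) x) :=
  LinearMap.range (π.sharp x)

/-- Smoothness of a vector field over a set. -/
def SmoothFieldOn [IsManifold 𝓘(ℝ, F) ∞ M] (X : ∀ x : M, TangentSpace 𝓘(ℝ, F) x) (U : Set M) : Prop :=
  ContMDiffOn 𝓘(ℝ, F) 𝓘(ℝ, F).tangent ∞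
    (fun x => (⟨x, X x⟩ : TangentBundle 𝓘(ℝ, F) M)) U

/-- `D` is a smooth vector subbundle of `TM`: it has smooth local frames. -/
def IsSmoothSubbundle [IsManifold 𝓘(ℝ, F) ∞ M]
    (D : ∀ x : M, Submodule ℝ (TangentSpace 𝓘(ℝ, F) x)) : Prop :=
  ∀ x : M, ∃ U : Set M, IsOpen U ∧ x ∈ U ∧
    ∃ (k : ℕ) (X : Fin k → ∀ y : M, TangentSpace 𝓘(ℝ, F) y),
      (∀ i, SmoothFieldOn (X i) U) ∧
      ∀ y ∈ U, LinearIndependent ℝ (fun i => X i y) ∧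
        Submodule.span ℝ (Set.range fun i => X i y) = D y

/-- The total space of a distribution, as a subset of `TM`. -/
def totalSet (D : ∀ x : M, Submodule ℝ (TangentSpace 𝓘(ℝ, F) x)) :
    Set (TangentBundle 𝓘(ℝ, F) M) :=
  {w | w.2 ∈ D w.1}

/-- A smooth curve, everywhere tangent to the characteristic distribution, leads from `x`
to `y`. -/
def LeafStep (π : PoissonStructure F M) (x y : M) : Prop :=
  ∃ γ : ℝ → M, ContMDiff 𝓘(ℝ, ℝ) 𝓘(ℝ, F) ∞ γ ∧ γ 0 = x ∧ γ 1 = y ∧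
    ∀ t : ℝ, mfderiv 𝓘(ℝ, ℝ) 𝓘(ℝ, F) γ t (1 : ℝ) ∈ π.charDist (γ t)

/-- Two points lie on the same symplectic leaf when they are joined by a piecewise smooth curve
tangent to the characteristic distribution. -/
def leafSetoid (π : PoissonStructure F M) : Setoid M := Relation.EqvGen.setoid (LeafStep π)

/-- The symplectic leaf through `x`, as a set. -/
def leaf (π : PoissonStructure F M) (x : M) : Set M := {y | leafSetoid π x y}

/-- The leaf space `M / 𝓕`, with the quotient topology. -/
abbrev LeafSpace (π : PoissonStructure F M) : Type _ := Quotient (leafSetoid π)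

variable {F' : Type*} [NormedAddCommGroup F'] [NormedSpace ℝ F']
  {L : Type*} [TopologicalSpace L] [ChartedSpace F' L]

/-- The manifold `L`, with the map `j`, is the symplectic leaf through `x`, as an immersed
submanifold: a connected integral manifold of `Im π_#` whose image is the leaf. -/
structure IsLeafManifold (π : PoissonStructure F M) (x : M) (j : L → M) : Prop where
  connected : ConnectedSpace L
  smooth : ContMDiff 𝓘(ℝ, F') 𝓘(ℝ, F) ∞ j
  injective : Function.Injective j
  immersion : ∀ l : L, Function.Injective (mfderiv 𝓘(ℝ, F') 𝓘(ℝ, F) j l)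
  integral : ∀ l : L,
    LinearMap.range (mfderiv 𝓘(ℝ, F') 𝓘(ℝ, F) j l).toLinearMap = π.charDist (j l)
  image : Set.range j = leaf π x

variable (F' L) in
/-- A field of bilinear forms on the tangent spaces of `L`. -/
abbrev TwoTensor : Type _ :=
  ∀ l : L, TangentSpace 𝓘(ℝ, F') l →ₗ[ℝ] TangentSpace 𝓘(ℝ, F') l →ₗ[ℝ] ℝ

/-- The term `X(σ(Y, Z)) - σ([X, Y], Z)` of the invariant formula for `dσ`. -/
def dTerm (σ : TwoTensor F' L) (X Y Z : ∀ l : L, TangentSpace 𝓘(ℝ, F') l) (l : L) : ℝ :=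
  covector F' (fun l' => σ l' (Y l') (Z l')) l (X l)
    - σ l (VectorField.mlieBracket 𝓘(ℝ, F') X Y l) (Z l)

/-- A symplectic form: a smooth, closed, nondegenerate 2-form. Closedness is
`dσ(X, Y, Z) = ∑_cyc (X(σ(Y, Z)) - σ([X, Y], Z)) = 0` for all smooth vector fields. -/
structure IsSymplecticForm [IsManifold 𝓘(ℝ, F') ∞ L] (σ : TwoTensor F' L) : Prop where
  alternating : ∀ (l : L) (u : TangentSpace 𝓘(ℝ, F') l), σ l u u = 0
  nondegenerate : ∀ (l : L) (u : TangentSpace 𝓘(ℝ, F') l), (∀ v, σ l u v = 0) → u = 0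
  smooth : ∀ X Y : ∀ l : L, TangentSpace 𝓘(ℝ, F') l,
    SmoothFieldOn X Set.univ → SmoothFieldOn Y Set.univ →
    ContMDiff 𝓘(ℝ, F') 𝓘(ℝ, ℝ) ∞ (fun l => σ l (X l) (Y l))
  closed : ∀ X Y Z : ∀ l : L, TangentSpace 𝓘(ℝ, F') l,
    SmoothFieldOn X Set.univ → SmoothFieldOn Y Set.univ → SmoothFieldOn Z Set.univ →
    ∀ l : L, dTerm σ X Y Z l + dTerm σ Y Z X l + dTerm σ Z X Y l = 0

/-- `σ` is the form of the symplectic leaf `j : L → M`, i.e. `σ(π_# α, π_# β) = π(α, β)`, where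
tangent vectors of `L` are seen in `TM` through `Tj`. -/
def IsLeafForm (π : PoissonStructure F M) (j : L → M) (σ : TwoTensor F' L) : Prop :=
  ∀ (l : L) (u v : TangentSpace 𝓘(ℝ, F') l)
    (α β : Module.Dual ℝ (TangentSpace 𝓘(ℝ, F) (j l))),
    mfderiv 𝓘(ℝ, F') 𝓘(ℝ, F) j l u = π.sharp (j l) α →
    mfderiv 𝓘(ℝ, F') 𝓘(ℝ, F) j l v = π.sharp (j l) β →
    σ l u v = β (π.sharp (j l) α)

/-- `K` acts on `L` preserving the form `σ`. -/
def IsInvariantForm (K : Type*) [Group K] [MulAction K L] (σ : TwoTensor F' L) : Prop :=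
  ∀ (a : K) (l : L) (u v : TangentSpace 𝓘(ℝ, F') l),
    σ (a • l) (mfderiv 𝓘(ℝ, F') 𝓘(ℝ, F') (fun l' => a • l') l u)
      (mfderiv 𝓘(ℝ, F') 𝓘(ℝ, F') (fun l' => a • l') l v) = σ l u v

end Manifolds

section Groups

variable {E : Type*} [NormedAddCommGroup E] [NormedSpace ℝ E]
  {G : Type*} [TopologicalSpace G] [ChartedSpace E G] [Group G]

/-- The projection `p : G → G / H`. -/
def proj (H : Subgroup G) (g : G) : G ⧸ H := QuotientGroup.mk g

variable (E) in
/-- The Lie algebra `𝔥 = T_e H` of a closed subgroup `H`, inside the Lie algebra of `G`: the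
velocities at `e` of the smooth curves in `H`. (For closed `H` these velocities already form a
linear subspace, so that taking the span adds nothing.) -/
def lieSub (H : Subgroup G) : Submodule ℝ (GroupLieAlgebra 𝓘(ℝ, E) G) :=
  Submodule.span ℝ {u | ∃ γ : ℝ → G, γ 0 = 1 ∧ ContMDiffAt 𝓘(ℝ, ℝ) 𝓘(ℝ, E) ∞ γ 0 ∧
    (∀ᶠ t in 𝓝 (0 : ℝ), γ t ∈ H) ∧ (mfderiv 𝓘(ℝ, ℝ) 𝓘(ℝ, E) γ 0 (1 : ℝ) : E) = u}

variable (E) in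
/-- `Ad_b = T_e c_b`, with `c_b(x) = b x b⁻¹`. -/
def Ad (b : G) : GroupLieAlgebra 𝓘(ℝ, E) G →ₗ[ℝ] GroupLieAlgebra 𝓘(ℝ, E) G :=
  (mfderiv 𝓘(ℝ, E) 𝓘(ℝ, E) (fun x : G => b * x * b⁻¹) 1 :
    GroupLieAlgebra 𝓘(ℝ, E) G →L[ℝ] GroupLieAlgebra 𝓘(ℝ, E) G).toLinearMap

/-- `𝔞 = 𝔥 ⊕ 𝔪` is a reductive decomposition with respect to `H`, where `𝔞 ⊆ 𝔤` is a subspace: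
`Ad(H)(𝔪) = 𝔪`. -/
structure IsReductiveDecomp (H : Subgroup G)
    (a m : Submodule ℝ (GroupLieAlgebra 𝓘(ℝ, E) G)) : Prop where
  inf_eq : lieSub E H ⊓ m = ⊥
  sup_eq : lieSub E H ⊔ m = a
  ad_eq : ∀ b ∈ H, m.map (Ad E b) = m

/-- A canonical symmetric decomposition: reductive, with `[𝔪, 𝔪] ⊆ 𝔥`. -/
structure IsSymmetricDecomp (H : Subgroup G)
    (a m : Submodule ℝ (GroupLieAlgebra 𝓘(ℝ, E) G)) : Prop extends
    IsReductiveDecomp H a m where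
  bracket_mem : ∀ u ∈ m, ∀ v ∈ m, ⁅u, v⁆ ∈ lieSub E H

/-- The typical fibre `𝔞 / 𝔥`. -/
abbrev Fibre (H : Subgroup G) (a : Submodule ℝ (GroupLieAlgebra 𝓘(ℝ, E) G)) : Type _ :=
  ↥a ⧸ (lieSub E H).submoduleOf a

/-- The right action of `H` on `G × 𝔞/𝔥`, `(g, u + 𝔥) · b = (g b, Ad_{b⁻¹} u + 𝔥)`, as a relation
(for an `Ad(H)`-stable `𝔞` containing `𝔥`). -/
def AssocRel (H : Subgroup G) (a : Submodule ℝ (GroupLieAlgebra 𝓘(ℝ, E) G))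
    (x y : G × Fibre H a) : Prop :=
  ∃ b ∈ H, ∃ u u' : a, (u' : GroupLieAlgebra 𝓘(ℝ, E) G) = Ad E b⁻¹ u ∧
    x.2 = Submodule.Quotient.mk u ∧ y = (x.1 * b, Submodule.Quotient.mk u')

/-- The total space of the homogeneous bundle `G ×_H (𝔞/𝔥)`. -/
def AssocBundle (H : Subgroup G) (a : Submodule ℝ (GroupLieAlgebra 𝓘(ℝ, E) G)) : Type _ :=
  Quot (AssocRel H a)

/-- The class `[g, v]` in `G ×_H (𝔞/𝔥)`. -/
def AssocBundle.mk {H : Subgroup G} {a : Submodule ℝ (GroupLieAlgebra 𝓘(ℝ, E) G)}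
    (g : G) (v : Fibre H a) : AssocBundle H a :=
  Quot.mk _ (g, v)

/-- The action `g' · [g, v] = [g' g, v]` of `G` on `G ×_H (𝔞/𝔥)`. -/
def AssocBundle.act {H : Subgroup G} {a : Submodule ℝ (GroupLieAlgebra 𝓘(ℝ, E) G)}
    (g' : G) : AssocBundle H a → AssocBundle H a :=
  Quot.map (fun x => (g' * x.1, x.2)) (by
    rintro x y ⟨b, hb, u, u', hu, hx, rfl⟩
    exact ⟨b, hb, u, u', hu, hx, by simp [mul_assoc]⟩)

variable {F : Type*} [NormedAddCommGroup F] [NormedSpace ℝ F]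

/-- `Ψ : G ×_H (𝔞/𝔥) → T(G/H)` is an isomorphism of homogeneous `G`-vector bundles over `G/H` onto
the subbundle `D ⊆ T(G/H)`. The smooth structure of `G ×_H (𝔞/𝔥)` is the quotient one: a map out of
it is smooth when its lift to `G × 𝔞/𝔥` is, and a map into it is smooth when it lifts locally to a
smooth map into `G × 𝔞/𝔥`; the vector space `𝔞/𝔥` carries its standard smooth structure, given by
the linear coordinates. A map on `D` is smooth when it extends locally to a smooth map on `TM`. -/
structure IsHomogeneousBundleIso {H : Subgroup G} [ChartedSpace F (G ⧸ H)]
    [IsManifold 𝓘(ℝ, F) ∞ (G ⧸ H)]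
    {a : Submodule ℝ (GroupLieAlgebra 𝓘(ℝ, E) G)}
    (D : ∀ x : G ⧸ H, Submodule ℝ (TangentSpace 𝓘(ℝ, F) x))
    (Ψ : AssocBundle H a → TangentBundle 𝓘(ℝ, F) (G ⧸ H)) : Prop where
  injective : Function.Injective Ψ
  range_eq : Set.range Ψ = totalSet D
  fibre_linear : ∀ g : G, ∃ T : Fibre H a →ₗ[ℝ] TangentSpace 𝓘(ℝ, F) (proj H g),
    ∀ v, Ψ (AssocBundle.mk g v) = ⟨proj H g, T v⟩
  equivariant : ∀ (g : G) (w : AssocBundle H a),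
    Ψ (AssocBundle.act g w) = tangentMap 𝓘(ℝ, F) 𝓘(ℝ, F) (fun x : G ⧸ H => g • x) (Ψ w)
  smooth : ∀ (k : ℕ) (c : (Fin k → ℝ) ≃ₗ[ℝ] Fibre H a),
    ContMDiff (𝓘(ℝ, E).prod 𝓘(ℝ, Fin k → ℝ)) 𝓘(ℝ, F).tangent ∞
      (fun z : G × (Fin k → ℝ) => Ψ (AssocBundle.mk z.1 (c z.2)))
  smooth_inv : ∀ (k : ℕ) (c : (Fin k → ℝ) ≃ₗ[ℝ] Fibre H a), ∀ w ∈ totalSet D,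
    ∃ U : Set (TangentBundle 𝓘(ℝ, F) (G ⧸ H)), IsOpen U ∧ w ∈ U ∧
      ∃ s : TangentBundle 𝓘(ℝ, F) (G ⧸ H) → G × (Fin k → ℝ),
        ContMDiffOn 𝓘(ℝ, F).tangent (𝓘(ℝ, E).prod 𝓘(ℝ, Fin k → ℝ)) ∞ s U ∧
        ∀ w' ∈ U ∩ totalSet D, Ψ (AssocBundle.mk (s w').1 (c (s w').2)) = w'

/-- A Poisson structure on `G/H` is `G`-invariant:
`π_{#, g x} = T_x λ_g ∘ π_{#, x} ∘ (T_x λ_g)^*`. -/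
def IsInvariant {H : Subgroup G} [ChartedSpace F (G ⧸ H)] (π : PoissonStructure F (G ⧸ H)) :
    Prop :=
  ∀ (g : G) (x : G ⧸ H) (α : Module.Dual ℝ (TangentSpace 𝓘(ℝ, F) (g • x))),
    π.sharp (g • x) α =
      mfderiv 𝓘(ℝ, F) 𝓘(ℝ, F) (fun y : G ⧸ H => g • y) x
        (π.sharp x (α ∘ₗ (mfderiv 𝓘(ℝ, F) 𝓘(ℝ, F) (fun y : G ⧸ H => g • y) x).toLinearMap))

/-- `T_e p : 𝔤 → T_ē (G/H)`. -/
def Tp (E F : Type*) [NormedAddCommGroup E] [NormedSpace ℝ E] [NormedAddCommGroup F]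
    [NormedSpace ℝ F] {G : Type*} [TopologicalSpace G] [ChartedSpace E G] [Group G]
    (H : Subgroup G) [ChartedSpace F (G ⧸ H)] :
    GroupLieAlgebra 𝓘(ℝ, E) G →ₗ[ℝ] TangentSpace 𝓘(ℝ, F) (proj H 1) :=
  (mfderiv 𝓘(ℝ, E) 𝓘(ℝ, F) (proj H) 1).toLinearMap

section Sharp

variable {H : Subgroup G} [ChartedSpace F (G ⧸ H)]

theorem lieSub_le_ker (hp : IsSubmersion 𝓘(ℝ, E) 𝓘(ℝ, F) ∞ (proj H)) :
    lieSub E H ≤ LinearMap.ker (Tp E F H) := by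
  refine Submodule.span_le.2 ?_
  rintro u ⟨γ, h0, hγ, hH, rfl⟩
  obtain ⟨C, _, _, hC⟩ := hp
  have hd : HasMFDerivAt 𝓘(ℝ, ℝ) 𝓘(ℝ, E) γ 0 _ :=
    (hγ.mdifferentiableAt (by simp)).hasMFDerivAt
  have hq : HasMFDerivAt 𝓘(ℝ, E) 𝓘(ℝ, F) (proj H) (γ 0) _ :=
    ((hC (γ 0)).contMDiffAt.mdifferentiableAt (by simp)).hasMFDerivAt
  have hc := hq.comp 0 hd
  have hconst : (fun _ : ℝ => proj H 1) =ᶠ[𝓝 0] (proj H ∘ γ) := by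
    filter_upwards [hH] with t ht
    exact QuotientGroup.eq.2 (by simpa using ht)
  have h0' : HasMFDerivAt 𝓘(ℝ, ℝ) 𝓘(ℝ, F) (proj H ∘ γ) 0
      (0 : TangentSpace 𝓘(ℝ, ℝ) (0 : ℝ) →L[ℝ] TangentSpace 𝓘(ℝ, F) (proj H 1)) :=
    (hasMFDerivAt_const (I := 𝓘(ℝ, ℝ)) (I' := 𝓘(ℝ, F)) (proj H 1)
      (0 : ℝ)).congr_of_eventuallyEq hconst.symm
  have e := DFunLike.congr_fun (hasMFDerivAt_unique hc h0') (1 : ℝ)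
  have key : ∀ y : G, y = 1 → ∀ w : E,
      (mfderiv 𝓘(ℝ, E) 𝓘(ℝ, F) (proj H) y w : F) = 0 →
      (mfderiv 𝓘(ℝ, E) 𝓘(ℝ, F) (proj H) 1 w : F) = 0 := by
    rintro y rfl w hw
    exact hw
  exact key _ h0 _ e

/-- `Φ_e : 𝔤/𝔥 → T_ē (G/H)`, `u + 𝔥 ↦ T_e p(u)`. -/
def Phi (hp : IsSubmersion 𝓘(ℝ, E) 𝓘(ℝ, F) ∞ (proj H)) :
    (GroupLieAlgebra 𝓘(ℝ, E) G ⧸ lieSub E H) →ₗ[ℝ] TangentSpace 𝓘(ℝ, F) (proj H 1) :=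
  (lieSub E H).liftQ (Tp E F H) (lieSub_le_ker hp)

theorem Phi_bijective (hp : IsSubmersion 𝓘(ℝ, E) 𝓘(ℝ, F) ∞ (proj H)) :
    Function.Bijective (Phi hp) := by
  obtain ⟨C, _, _, hC⟩ := id hp
  constructor
  · rw [← LinearMap.ker_eq_bot]
    refine Submodule.ker_liftQ_eq_bot _ _ _ ?_
    intro u hu
    obtain ⟨γ, h0, hs, hf, hv⟩ := submersion_curve (hC 1) u hu
    refine Submodule.subset_span ⟨γ, h0, hs, ?_, hv⟩
    filter_upwards [hf] with t ht
    simpa using QuotientGroup.eq.1 ht.symm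
  · intro w
    obtain ⟨u, hu⟩ := submersion_surjective (hC 1) w
    exact ⟨Submodule.Quotient.mk u, hu⟩

/-- `Φ_e` as a linear isomorphism `𝔤/𝔥 ≃ T_ē (G/H)`. -/
def PhiEquiv (hp : IsSubmersion 𝓘(ℝ, E) 𝓘(ℝ, F) ∞ (proj H)) :
    (GroupLieAlgebra 𝓘(ℝ, E) G ⧸ lieSub E H) ≃ₗ[ℝ] TangentSpace 𝓘(ℝ, F) (proj H 1) :=
  LinearEquiv.ofBijective (Phi hp) (Phi_bijective hp)

/-- The bivector `r` on `𝔤/𝔥` associated with `π`, recorded by its sharp map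
`r_# = Φ_e⁻¹ ∘ π_{#, ē} ∘ (Φ_e⁻¹)^* : (𝔤/𝔥)^* → 𝔤/𝔥`; thus `r(η, ξ) = ξ(r_# η)`. -/
def rSharp (hp : IsSubmersion 𝓘(ℝ, E) 𝓘(ℝ, F) ∞ (proj H)) (π : PoissonStructure F (G ⧸ H)) :
    Module.Dual ℝ (GroupLieAlgebra 𝓘(ℝ, E) G ⧸ lieSub E H) →ₗ[ℝ]
      (GroupLieAlgebra 𝓘(ℝ, E) G ⧸ lieSub E H) where
  toFun η := (PhiEquiv hp).symm (π.sharp (proj H 1) (η ∘ₗ (PhiEquiv hp).symm.toLinearMap))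
  map_add' η ξ := by rw [LinearMap.add_comp, map_add, map_add]
  map_smul' c η := by rw [LinearMap.smul_comp, map_smul, map_smul, RingHom.id_apply]

/-- `𝔞_r = q⁻¹(Im r_#)`. -/
def aLie (hp : IsSubmersion 𝓘(ℝ, E) 𝓘(ℝ, F) ∞ (proj H)) (π : PoissonStructure F (G ⧸ H)) :
    Submodule ℝ (GroupLieAlgebra 𝓘(ℝ, E) G) :=
  (LinearMap.range (rSharp hp π)).comap (lieSub E H).mkQ

/-- `Im r_#` as a subspace of a complement `𝔪` of `𝔥`, under `𝔪 ≅ 𝔤/𝔥`. -/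
def imSharp (hp : IsSubmersion 𝓘(ℝ, E) 𝓘(ℝ, F) ∞ (proj H)) (π : PoissonStructure F (G ⧸ H))
    (m : Submodule ℝ (GroupLieAlgebra 𝓘(ℝ, E) G)) :
    Submodule ℝ (GroupLieAlgebra 𝓘(ℝ, E) G) :=
  m ⊓ (LinearMap.range (rSharp hp π)).comap (lieSub E H).mkQ

end Sharp

section Subgroups

variable {E' : Type*} [NormedAddCommGroup E'] [NormedSpace ℝ E']
  {A : Type*} [TopologicalSpace A] [ChartedSpace E' A] [Group A]

/-- `T_e ι : Lie(A) → Lie(G)`. -/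
def lieMap (E' E : Type*) [NormedAddCommGroup E'] [NormedSpace ℝ E'] [NormedAddCommGroup E]
    [NormedSpace ℝ E] {A : Type*} [TopologicalSpace A] [ChartedSpace E' A] [Group A]
    {G : Type*} [TopologicalSpace G] [ChartedSpace E G] [Group G] (ι : A →* G) :
    GroupLieAlgebra 𝓘(ℝ, E') A →ₗ[ℝ] GroupLieAlgebra 𝓘(ℝ, E) G :=
  (mfderiv 𝓘(ℝ, E') 𝓘(ℝ, E) ι 1 :
    GroupLieAlgebra 𝓘(ℝ, E') A →L[ℝ] GroupLieAlgebra 𝓘(ℝ, E) G).toLinearMap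

/-- `ι : A → G` is the connected immersed Lie subgroup of `G` with Lie algebra `𝔞` (which is
determined by `𝔞` up to isomorphism). -/
structure IsIntegralSubgroup (ι : A →* G) (a : Submodule ℝ (GroupLieAlgebra 𝓘(ℝ, E) G)) :
    Prop where
  connected : ConnectedSpace A
  smooth : ContMDiff 𝓘(ℝ, E') 𝓘(ℝ, E) ∞ ι
  injective : Function.Injective ι
  immersion : ∀ x : A, Function.Injective (mfderiv 𝓘(ℝ, E') 𝓘(ℝ, E) ι x)
  range_eq : LinearMap.range (lieMap E' E ι) = a

/-- The map `A / (A ∩ H) → G / H`, `a (A ∩ H) ↦ g a H`. -/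
def leafMap {A G : Type*} [Group A] [Group G] (H : Subgroup G) (ι : A →* G) (g : G) :
    A ⧸ H.comap ι → G ⧸ H :=
  Quotient.map' (fun a => g * ι a) (by
    intro a b hab
    rw [QuotientGroup.leftRel_apply] at hab ⊢
    simpa [mul_assoc] using hab)

/-- The form `σ` on `A/(A ∩ H)` is given at the base point by `ω_r`:
`σ(T_e p u, T_e p v) = ω_r(u, v) = r(η, ξ)` for any `η, ξ` with `r_# η = q(u)`, `r_# ξ = q(v)`,
where `Lie(A)` is identified with `𝔞_r`. -/
def IsInducedByOmega {H : Subgroup G} [ChartedSpace F (G ⧸ H)]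
    (hp : IsSubmersion 𝓘(ℝ, E) 𝓘(ℝ, F) ∞ (proj H)) (π : PoissonStructure F (G ⧸ H))
    (ι : A →* G) {F' : Type*} [NormedAddCommGroup F'] [NormedSpace ℝ F']
    [ChartedSpace F' (A ⧸ H.comap ι)] (σ : TwoTensor F' (A ⧸ H.comap ι)) : Prop :=
  ∀ (u v : GroupLieAlgebra 𝓘(ℝ, E') A)
    (η ξ : Module.Dual ℝ (GroupLieAlgebra 𝓘(ℝ, E) G ⧸ lieSub E H)),
    rSharp hp π η = (lieSub E H).mkQ (lieMap E' E ι u) →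
    rSharp hp π ξ = (lieSub E H).mkQ (lieMap E' E ι v) →
    σ (proj (H.comap ι) 1) (Tp E' F' (H.comap ι) u) (Tp E' F' (H.comap ι) v)
      = ξ (rSharp hp π η)

end Subgroups

end Groups

end HomPoisson

/-! Invariance reduces every statement to the base point, and left translation turns it into linear
algebra in 𝔤. Write D_g u = Tp(TL_g u) (`dproj`). Its kernel is 𝔥 for every g, and invariance of π
makes D_g u lie in the fibre of E at gH exactly when u ∈ 𝔞_r (`dproj_mem_charDist`). With D_g ∘ Ad_b
= D_{gb} for b ∈ H (`dproj_Ad`) this yields the Ad(H)-stability of 𝔞_r and the isomorphism from G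
×_H (𝔞_r/𝔥). Translations are isomorphisms between the fibres of E, so E has constant rank, and
Hamiltonian fields independent at a point remain a frame nearby (`exists_hamiltonian_frame`).

The leaves come from uniqueness for ordinary differential equations, with no appeal to Frobenius. A
curve c in G with c⁻¹c' in Lie(A) stays, locally, in one coset c(t₀)A: the same equation can be
solved inside A, and the two solutions agree in G (`eventually_mem_coset_of_leftLog_mem`). Lifting
an E-tangent curve through local sections of p therefore keeps it in gAH; conversely A is connected,
so its points are joined by chains of smooth curves, whose images are tangent to E. The same lemma
shows that H normalises A (`conj_mem_range_of_Ad`), which makes the set gAH depend on gH only.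

The leaf form is determined pointwise by σ(π_# α, π_# β) = π(α, β). Uniqueness yields its
A-invariance at once, and invariance of π lets the form built for g = 1 serve for every g.
Smoothness and closedness are checked in a local Hamiltonian frame f_i: vector fields on the leaf
have smooth coordinates there because the matrix {f_a, f_b} is invertible, and in dσ the terms that
differentiate coordinates telescope while the remaining ones cancel by the Jacobi identity
(`IsLeafForm.dTerm_eq`).

The leaf map is an immersion because an integral curve in A of a vector mapped into 𝔥 projects to a
constant in G/H (`mem_lieSub_comap`). If H ⊆ A, then G/A and the leaf space are quotients of G by
the same relation. The reductive statement is the modular law. -/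

namespace HomPoisson

/-! ### Submersions, smooth paths and smoothness into the tangent bundle -/

section General
variable {E : Type*} [NormedAddCommGroup E] [NormedSpace ℝ E]
  {F : Type*} [NormedAddCommGroup F] [NormedSpace ℝ F]
  {M : Type*} [TopologicalSpace M] [ChartedSpace E M]
  {N : Type*} [TopologicalSpace N] [ChartedSpace F N]

/-- In adapted charts f is the projection F × C → F; the section freezes the C-coordinate at its
value at x. -/
theorem exists_local_section {f : M → N} (hf : IsSubmersion 𝓘(ℝ, E) 𝓘(ℝ, F) ∞ f) (x : M) :
    ∃ (V : Set N) (s : N → M), IsOpen V ∧ f x ∈ V ∧ ContMDiffOn 𝓘(ℝ, F) 𝓘(ℝ, E) ∞ s V ∧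
      s (f x) = x ∧ ∀ y ∈ V, f (s y) = y := by
  obtain ⟨C, _, _, hC⟩ := hf
  have h := hC x
  have hx := h.mem_domChart_source
  set c : C := (h.equiv (h.domChart x)).2 with hc
  set k : F → E := fun w => h.equiv.symm (w, c) with hk
  have hks : ContMDiff 𝓘(ℝ, F) 𝓘(ℝ, E) ∞ k := by
    rw [contMDiff_iff_contDiff]; fun_prop
  have hm2 : h.domChart x ∈ (h.domChart.extend 𝓘(ℝ, E)).target := by
    simp [h.domChart.map_source hx]
  have e2 := h.writtenInCharts hm2
  simp [h.domChart.left_inv hx] at e2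
  have hkx : k (h.codChart (f x)) = h.domChart x := by
    rw [e2, hk, hc]; simp
  set V : Set N := h.codChart.source ∩ (h.codChart ⁻¹' (k ⁻¹' h.domChart.target)) with hV
  have hVo : IsOpen V := h.codChart.isOpen_inter_preimage
    (h.domChart.open_target.preimage hks.continuous)
  refine ⟨V, h.domChart.symm ∘ k ∘ h.codChart, hVo, ?_, ?_, ?_, ?_⟩
  · refine ⟨h.mem_codChart_source, ?_⟩
    simp only [Set.mem_preimage, hkx]
    exact h.domChart.map_source hx
  · refine (contMDiffOn_symm_of_mem_maximalAtlas h.domChart_mem_maximalAtlas).comp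
      (hks.comp_contMDiffOn
        ((contMDiffOn_of_mem_maximalAtlas h.codChart_mem_maximalAtlas).mono
          Set.inter_subset_left)) ?_
    rintro y ⟨_, hy⟩
    exact hy
  · simp [hkx, h.domChart.left_inv hx]
  · rintro y ⟨hy1, hy2⟩
    have hy2 : k (h.codChart y) ∈ h.domChart.target := hy2
    have hm1 : k (h.codChart y) ∈ (h.domChart.extend 𝓘(ℝ, E)).target := by simpa using hy2
    have e1 := h.writtenInCharts hm1
    have m1 : f (h.domChart.symm (k (h.codChart y))) ∈ h.codChart.source :=
      h.source_subset_preimage_source (h.domChart.map_target hy2)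
    apply h.codChart.injOn m1 hy1
    simp at e1
    refine e1.trans ?_
    simp [hk]

/-- A map out of the target of a surjective submersion is smooth when its pullback is. -/
theorem contMDiff_of_comp_submersion {P : Type*} [NormedAddCommGroup P] [NormedSpace ℝ P]
    {Q : Type*} [TopologicalSpace Q] [ChartedSpace P Q]
    {f : M → N} (hf : IsSubmersion 𝓘(ℝ, E) 𝓘(ℝ, F) ∞ f) (hs : Function.Surjective f)
    {k : N → Q} (hk : ContMDiff 𝓘(ℝ, E) 𝓘(ℝ, P) ∞ (k ∘ f)) :
    ContMDiff 𝓘(ℝ, F) 𝓘(ℝ, P) ∞ k := by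
  intro y
  obtain ⟨x, rfl⟩ := hs y
  obtain ⟨V, s, hV, hx, hsm, _, hsec⟩ := exists_local_section hf x
  have h1 : ContMDiffAt 𝓘(ℝ, F) 𝓘(ℝ, P) ∞ ((k ∘ f) ∘ s) (f x) :=
    hk.contMDiffAt.comp _ (hsm.contMDiffAt (hV.mem_nhds hx))
  refine h1.congr_of_eventuallyEq ?_
  filter_upwards [hV.mem_nhds hx] with z hz
  simp [hsec z hz]

/-- This turns connectedness into chains of smooth curves. The segment in a chart is run through by
`Real.smoothTransition`, whose values stay in [0, 1], so that the curve is defined and smooth on all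
of ℝ without leaving the chart. -/
theorem exists_smooth_path [IsManifold 𝓘(ℝ, E) ∞ M] (x : M) :
    ∀ᶠ y in 𝓝 x, ∃ γ : ℝ → M, ContMDiff 𝓘(ℝ, ℝ) 𝓘(ℝ, E) ∞ γ ∧ γ 0 = x ∧ γ 1 = y := by
  set e := chartAt E x with he
  have hx : x ∈ e.source := mem_chart_source E x
  obtain ⟨r, hr, hb⟩ := Metric.isOpen_iff.1 e.open_target _ (e.map_source hx)
  have hn : e.source ∩ e ⁻¹' Metric.ball (e x) r ∈ 𝓝 x :=
    (e.isOpen_inter_preimage Metric.isOpen_ball).mem_nhds ⟨hx, Metric.mem_ball_self hr⟩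
  filter_upwards [hn] with y hy
  set ℓ : ℝ → E := fun t => e x + Real.smoothTransition t • (e y - e x) with hℓ
  have hℓs : ContMDiff 𝓘(ℝ, ℝ) 𝓘(ℝ, E) ∞ ℓ := by
    rw [contMDiff_iff_contDiff]
    exact contDiff_const.add (Real.smoothTransition.contDiff.smul contDiff_const)
  have hmem : ∀ t, ℓ t ∈ e.target := by
    intro t
    apply hb
    have hy2 := mem_ball_iff_norm.1 hy.2
    rw [mem_ball_iff_norm]
    simp only [hℓ, add_sub_cancel_left, norm_smul, Real.norm_eq_abs,
      abs_of_nonneg (Real.smoothTransition.nonneg t)]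
    exact lt_of_le_of_lt (mul_le_of_le_one_left (norm_nonneg _)
      (Real.smoothTransition.le_one t)) hy2
  refine ⟨e.symm ∘ ℓ, ?_, ?_, ?_⟩
  · exact (contMDiffOn_chart_symm (I := 𝓘(ℝ, E)) (n := ∞) (x := x)).comp_contMDiff hℓs hmem
  · simp [hℓ, e.left_inv hx]
  · simp [hℓ, e.left_inv hy.1]

/-- Both γ and the constant curve are integral curves of the zero field, so uniqueness applies. -/
theorem eventually_const_of_mfderiv_zero [IsManifold 𝓘(ℝ, E) ∞ M] {γ : ℝ → M} {t₀ : ℝ}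
    (h : ∀ᶠ t in 𝓝 t₀, HasMFDerivAt 𝓘(ℝ, ℝ) 𝓘(ℝ, E) γ t
      (0 : TangentSpace 𝓘(ℝ, ℝ) t →L[ℝ] TangentSpace 𝓘(ℝ, E) (γ t))) :
    ∀ᶠ t in 𝓝 t₀, γ t = γ t₀ := by
  have hz : ∀ x : M, ContMDiffAt 𝓘(ℝ, E) 𝓘(ℝ, E).tangent 1
      (fun x => (⟨x, 0⟩ : TangentBundle 𝓘(ℝ, E) M)) x := fun x =>
    (Bundle.contMDiff_zeroSection (IB := 𝓘(ℝ, E)) (n := 1) ℝ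
      (TangentSpace 𝓘(ℝ, E) : M → Type _) (F := E)).contMDiffAt
  have e0 : ∀ x : M, (ContinuousLinearMap.smulRight (1 : ℝ →L[ℝ] ℝ) (0 : E)) = 0 := by
    intro x; ext; simp
  refine isMIntegralCurveAt_eventuallyEq_of_contMDiffAt_boundaryless (I := 𝓘(ℝ, E))
    (v := fun _ => 0) (γ := γ) (γ' := fun _ => γ t₀) (t₀ := t₀) (hz _) ?_ ?_ rfl
  · filter_upwards [h] with t ht
    exact (e0 (γ t)).symm ▸ ht
  · refine Filter.Eventually.of_forall fun t => ?_
    exact (e0 (γ t₀)).symm ▸ hasMFDerivAt_const (I := 𝓘(ℝ, ℝ)) (I' := 𝓘(ℝ, E)) (γ t₀) t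

/-- Smoothness of a section of the tangent bundle is tested in a trivialization; this identifies its
fibre coordinate with the derivative of the chart. -/
theorem trivializationAt_snd [IsManifold 𝓘(ℝ, E) ∞ M] {x₀ y : M}
    (hy : y ∈ (chartAt E x₀).source) (v : TangentSpace 𝓘(ℝ, E) y) :
    (trivializationAt E (TangentSpace 𝓘(ℝ, E)) x₀
      (⟨y, v⟩ : TangentBundle 𝓘(ℝ, E) M)).2 =
      mfderiv 𝓘(ℝ, E) 𝓘(ℝ, E) (extChartAt 𝓘(ℝ, E) x₀) y v := by
  have h1 := DFunLike.congr_fun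
    (TangentBundle.continuousLinearMapAt_trivializationAt (I := 𝓘(ℝ, E)) hy) v
  refine Eq.trans ?_ h1
  have hb : y ∈ (trivializationAt E (TangentSpace 𝓘(ℝ, E)) x₀).baseSet := by simpa using hy
  exact (congrFun (Bundle.Trivialization.coe_linearMapAt_of_mem (R := ℝ)
    (trivializationAt E (TangentSpace 𝓘(ℝ, E)) x₀) hb) v).symm

theorem trivializationAt_fst_snd [IsManifold 𝓘(ℝ, E) ∞ M] (z : M) (v : TangentSpace 𝓘(ℝ, E) z) :
    (trivializationAt E (TangentSpace 𝓘(ℝ, E)) z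
      (⟨z, v⟩ : TangentBundle 𝓘(ℝ, E) M)).2 = v := by
  rw [trivializationAt_snd (mem_chart_source E z), mfderiv_extChartAt_self]
  rfl

variable {X : Type*} [NormedAddCommGroup X] [NormedSpace ℝ X]
  {HX : Type*} [TopologicalSpace HX] {IX : ModelWithCorners ℝ X HX}
  {Q : Type*} [TopologicalSpace Q] [ChartedSpace HX Q]

theorem contMDiffAt_snd_of_fst_const [IsManifold 𝓘(ℝ, E) ∞ M] {z : M} {φ : Q → E} {n : ℕ∞ω} {q : Q}
    (h : ContMDiffAt IX 𝓘(ℝ, E).tangent n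
      (fun q => (⟨z, φ q⟩ : TangentBundle 𝓘(ℝ, E) M)) q) :
    ContMDiffAt IX 𝓘(ℝ, E) n φ q := by
  have := (Bundle.contMDiffAt_totalSpace.1 h).2
  refine this.congr_of_eventuallyEq (Filter.Eventually.of_forall fun q => ?_)
  exact (trivializationAt_fst_snd z (φ q)).symm

theorem contMDiff_fibre_inclusion [IsManifold 𝓘(ℝ, E) ∞ M] {z : M} {φ : Q → E} {n : ℕ∞ω}
    (h : ContMDiff IX 𝓘(ℝ, E) n φ) :
    ContMDiff IX 𝓘(ℝ, E).tangent n (fun q => (⟨z, φ q⟩ : TangentBundle 𝓘(ℝ, E) M)) := by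
  intro q
  refine Bundle.contMDiffAt_totalSpace.2 ⟨contMDiffAt_const, ?_⟩
  refine (h q).congr_of_eventuallyEq (Filter.Eventually.of_forall fun q => ?_)
  exact trivializationAt_fst_snd z (φ q)

/-- The tangent map of `f : N × M → Q` in the second variable is smooth. -/
theorem contMDiff_partial_tangentMap [IsManifold 𝓘(ℝ, E) ∞ M] [IsManifold 𝓘(ℝ, F) ∞ N]
    [IsManifold IX ∞ Q] {f : N × M → Q}
    (hf : ContMDiff (𝓘(ℝ, F).prod 𝓘(ℝ, E)) IX ∞ f) :
    ContMDiff (𝓘(ℝ, F).prod 𝓘(ℝ, E).tangent) IX.tangent ∞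
      (fun z : N × TangentBundle 𝓘(ℝ, E) M =>
        (⟨f (z.1, z.2.1), mfderiv 𝓘(ℝ, E) IX (fun y => f (z.1, y)) z.2.1 z.2.2⟩ :
          TangentBundle IX Q)) := by
  -- The partial tangent map is the full tangent map of f fed with the zero vector of N.
  have h0 : ContMDiff 𝓘(ℝ, F) 𝓘(ℝ, F).tangent ∞
      (fun x => (⟨x, 0⟩ : TangentBundle 𝓘(ℝ, F) N)) :=
    Bundle.contMDiff_zeroSection (IB := 𝓘(ℝ, F)) (n := ∞) ℝ
      (TangentSpace 𝓘(ℝ, F) : N → Type _) (F := F)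
  have h1 : ContMDiff (𝓘(ℝ, F).prod 𝓘(ℝ, E).tangent) (𝓘(ℝ, F).tangent.prod 𝓘(ℝ, E).tangent) ∞
      (fun z : N × TangentBundle 𝓘(ℝ, E) M => ((⟨z.1, 0⟩ : TangentBundle 𝓘(ℝ, F) N), z.2)) :=
    (h0.comp contMDiff_fst).prodMk contMDiff_snd
  have h2 := (contMDiff_equivTangentBundleProd_symm (n := ∞) (I := 𝓘(ℝ, F)) (M := N)
    (I' := 𝓘(ℝ, E)) (M' := M)).comp h1
  have h3 := (hf.contMDiff_tangentMap (m := ∞) le_rfl).comp h2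
  refine h3.congr fun z => ?_
  refine Bundle.TotalSpace.ext rfl (heq_of_eq ?_)
  have hd := mfderiv_prod_eq_add_apply (I := 𝓘(ℝ, F)) (I' := 𝓘(ℝ, E)) (I'' := IX) (f := f)
    (p := (z.1, z.2.1)) (v := ((0 : F), z.2.2)) (hf.contMDiffAt.mdifferentiableAt (by simp))
  refine Eq.trans ?_ hd.symm
  have : mfderiv 𝓘(ℝ, F) IX (fun w => f (w, z.2.1)) z.1 (0 : F) = 0 := map_zero _
  refine Eq.trans ?_ (congrArg (· + _) this.symm)
  exact (zero_add _).symm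

end General

/-! ### Global test functions -/

section TestFunctions
variable {E : Type*} [NormedAddCommGroup E] [NormedSpace ℝ E]
  {M : Type*} [TopologicalSpace M] [ChartedSpace E M]

theorem covector_congr {f g : M → ℝ} {x : M} (h : f =ᶠ[𝓝 x] g) :
    covector E f x = covector E g x := by
  unfold covector
  rw [h.mfderiv_eq]

variable [IsManifold 𝓘(ℝ, E) ∞ M]

theorem contMDiffOn_covector_apply {X : ∀ x : M, TangentSpace 𝓘(ℝ, E) x} {U : Set M}
    (hX : SmoothFieldOn X U) {f : M → ℝ} (hf : ContMDiff 𝓘(ℝ, E) 𝓘(ℝ, ℝ) ∞ f) :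
    ContMDiffOn 𝓘(ℝ, E) 𝓘(ℝ, ℝ) ∞ (fun x => covector E f x (X x)) U :=
  ((contMDiff_snd_tangentBundle_modelSpace ℝ 𝓘(ℝ, ℝ)).comp
    (hf.contMDiff_tangentMap (m := ∞) le_rfl)).comp_contMDiffOn hX

theorem contMDiff_covector_apply {X : ∀ x : M, TangentSpace 𝓘(ℝ, E) x}
    (hX : SmoothFieldOn X Set.univ) {f : M → ℝ} (hf : ContMDiff 𝓘(ℝ, E) 𝓘(ℝ, ℝ) ∞ f) :
    ContMDiff 𝓘(ℝ, E) 𝓘(ℝ, ℝ) ∞ (fun x => covector E f x (X x)) :=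
  contMDiffOn_univ.1 (contMDiffOn_covector_apply hX hf)

variable [FiniteDimensional ℝ E] [T2Space M]

/-- Linear functionals of a chart extend from a neighbourhood to global smooth functions. -/
theorem exists_coordinate_functions (x₀ : M) :
    ∃ g : (E →L[ℝ] ℝ) → M → ℝ, (∀ ℓ, ContMDiff 𝓘(ℝ, E) 𝓘(ℝ, ℝ) ∞ (g ℓ)) ∧
      ∀ᶠ y in 𝓝 x₀, y ∈ (chartAt E x₀).source ∧ ∀ ℓ (v : TangentSpace 𝓘(ℝ, E) y),
        covector E (g ℓ) y v = ℓ (mfderiv 𝓘(ℝ, E) 𝓘(ℝ, E) (extChartAt 𝓘(ℝ, E) x₀) y v) := by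
  obtain ⟨b⟩ : Nonempty (SmoothBumpFunction 𝓘(ℝ, E) x₀) := inferInstance
  -- Cutting off by a bump function that is 1 near x₀ makes the coordinate global without changing
  -- its differential there.
  refine ⟨fun ℓ x => b x • ℓ (extChartAt 𝓘(ℝ, E) x₀ x), fun ℓ => b.contMDiff_smul ?_, ?_⟩
  · exact ℓ.contDiff.contMDiff.comp_contMDiffOn contMDiffOn_extChartAt
  · filter_upwards [b.eventuallyEq_one.eventuallyEq_nhds,
      (chartAt E x₀).open_source.mem_nhds (mem_chart_source E x₀)] with y hy hys
    refine ⟨hys, fun ℓ v => ?_⟩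
    have e1 : (fun x => b x • ℓ (extChartAt 𝓘(ℝ, E) x₀ x)) =ᶠ[𝓝 y]
        (ℓ ∘ extChartAt 𝓘(ℝ, E) x₀) := by
      filter_upwards [hy] with z hz
      simp [hz]
    rw [covector_congr e1]
    have hd : HasMFDerivAt 𝓘(ℝ, E) 𝓘(ℝ, E) (extChartAt 𝓘(ℝ, E) x₀) y _ :=
      (mdifferentiableAt_extChartAt hys).hasMFDerivAt
    have := (ℓ.hasMFDerivAt (x := extChartAt 𝓘(ℝ, E) x₀ y)).comp y hd
    exact DFunLike.congr_fun this.mfderiv v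

/-- The axioms of a Poisson structure speak only of globally defined smooth functions; this gives
access to arbitrary covectors. -/
theorem exists_function_covector_eq (x₀ : M) (α : Module.Dual ℝ (TangentSpace 𝓘(ℝ, E) x₀)) :
    ∃ f : M → ℝ, ContMDiff 𝓘(ℝ, E) 𝓘(ℝ, ℝ) ∞ f ∧ covector E f x₀ = α := by
  obtain ⟨g, hg, h⟩ := exists_coordinate_functions (E := E) x₀
  let α' : E →ₗ[ℝ] ℝ := α
  refine ⟨g (LinearMap.toContinuousLinearMap α'), hg _, ?_⟩
  ext v
  rw [h.self_of_nhds.2, mfderiv_extChartAt_self]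
  rfl

/-- Near x₀ the chart coordinates of X are its derivatives of finitely many extended coordinate
functions. -/
theorem contMDiffAt_field_of_covector {X : ∀ x : M, TangentSpace 𝓘(ℝ, E) x} {x₀ : M}
    (h : ∀ g : M → ℝ, ContMDiff 𝓘(ℝ, E) 𝓘(ℝ, ℝ) ∞ g →
      ContMDiffAt 𝓘(ℝ, E) 𝓘(ℝ, ℝ) ∞ (fun x => covector E g x (X x)) x₀) :
    ContMDiffAt 𝓘(ℝ, E) 𝓘(ℝ, E).tangent ∞
      (fun x => (⟨x, X x⟩ : TangentBundle 𝓘(ℝ, E) M)) x₀ := by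
  obtain ⟨g, hg, hev⟩ := exists_coordinate_functions (E := E) x₀
  refine Bundle.contMDiffAt_section _ |>.2 ?_
  let b := Module.finBasis ℝ E
  let ℓ : Fin (Module.finrank ℝ E) → E →L[ℝ] ℝ := fun i =>
    LinearMap.toContinuousLinearMap (b.coord i)
  have hsum : ContMDiffAt 𝓘(ℝ, E) 𝓘(ℝ, E) ∞
      (fun x => ∑ i, covector E (g (ℓ i)) x (X x) • b i) x₀ := by
    refine ContMDiffAt.sum fun i _ => ?_
    exact (h _ (hg _)).smul contMDiffAt_const
  refine hsum.congr_of_eventuallyEq ?_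
  filter_upwards [hev] with y hy
  rw [trivializationAt_snd hy.1]
  simp_rw [hy.2]
  exact (b.sum_repr _).symm

end TestFunctions

/-! ### The Lie bracket of vector fields as a commutator of derivations -/

section Bracket
variable {E : Type*} [NormedAddCommGroup E] [NormedSpace ℝ E] [CompleteSpace E]
  {M : Type*} [TopologicalSpace M] [ChartedSpace E M] [IsManifold 𝓘(ℝ, E) ∞ M]

omit [CompleteSpace E] in
-- The second-order terms cancel by symmetry of the second derivative.
theorem fderiv_lieBracket {f : E → ℝ} {V W : E → E} {x : E} (hf : ContDiffAt ℝ ∞ f x)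
    (hV : DifferentiableAt ℝ V x) (hW : DifferentiableAt ℝ W x) :
    fderiv ℝ f x (VectorField.lieBracket ℝ V W x) =
      fderiv ℝ (fun y => fderiv ℝ f y (W y)) x (V x) -
      fderiv ℝ (fun y => fderiv ℝ f y (V y)) x (W x) := by
  have hd : DifferentiableAt ℝ (fderiv ℝ f) x :=
    (hf.fderiv_right (m := 1) (by norm_cast)).differentiableAt (by simp)
  have hs : IsSymmSndFDerivAt ℝ f x := hf.isSymmSndFDerivAt (by
    simpa using WithTop.coe_le_coe.2 (le_top : (2 : ℕ∞) ≤ ⊤))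
  rw [fderiv_clm_apply hd hW, fderiv_clm_apply hd hV, VectorField.lieBracket]
  simp [hs.eq (V x) (W x)]

omit [CompleteSpace E] in
theorem fderiv_chart_mpullback (X : ∀ x : M, TangentSpace 𝓘(ℝ, E) x) {f : M → ℝ}
    (hf : ContMDiff 𝓘(ℝ, E) 𝓘(ℝ, ℝ) ∞ f) (x : M) {y : E}
    (hy : y ∈ (extChartAt 𝓘(ℝ, E) x).target) :
    fderiv ℝ (f ∘ (extChartAt 𝓘(ℝ, E) x).symm) y
      (VectorField.mpullbackWithin 𝓘(ℝ, E) 𝓘(ℝ, E) (extChartAt 𝓘(ℝ, E) x).symm X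
        (Set.range 𝓘(ℝ, E)) y) =
      covector E f ((extChartAt 𝓘(ℝ, E) x).symm y) (X ((extChartAt 𝓘(ℝ, E) x).symm y)) := by
  have hinv := isInvertible_mfderivWithin_extChartAt_symm (I := 𝓘(ℝ, E)) hy
  have hd : HasMFDerivWithinAt 𝓘(ℝ, E) 𝓘(ℝ, E) (extChartAt 𝓘(ℝ, E) x).symm
      (Set.range 𝓘(ℝ, E)) y _ :=
    (mdifferentiableWithinAt_extChartAt_symm hy).hasMFDerivWithinAt
  have hfd : HasMFDerivAt 𝓘(ℝ, E) 𝓘(ℝ, ℝ) f ((extChartAt 𝓘(ℝ, E) x).symm y) _ :=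
    (hf.contMDiffAt.mdifferentiableAt (by simp)).hasMFDerivAt
  have hc := hfd.comp_hasMFDerivWithinAt y hd
  have hu : Set.range 𝓘(ℝ, E) = Set.univ := by simp
  let D₁ : E →L[ℝ] ℝ := mfderiv 𝓘(ℝ, E) 𝓘(ℝ, ℝ) f ((extChartAt 𝓘(ℝ, E) x).symm y)
  let D₂ : E →L[ℝ] E := mfderivWithin 𝓘(ℝ, E) 𝓘(ℝ, E) (extChartAt 𝓘(ℝ, E) x).symm
    (Set.range 𝓘(ℝ, E)) y
  have hc' : HasFDerivAt (f ∘ (extChartAt 𝓘(ℝ, E) x).symm) (D₁.comp D₂) y :=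
    (HasMFDerivWithinAt.hasFDerivWithinAt hc).hasFDerivAt (by rw [hu]; exact Filter.univ_mem)
  refine (congrArg (fun L : E →L[ℝ] ℝ => L (VectorField.mpullbackWithin 𝓘(ℝ, E) 𝓘(ℝ, E)
    (extChartAt 𝓘(ℝ, E) x).symm X (Set.range 𝓘(ℝ, E)) y)) hc'.fderiv).trans ?_
  obtain ⟨e, he⟩ := hinv
  have h2 : ∀ w, mfderivWithin 𝓘(ℝ, E) 𝓘(ℝ, E) (extChartAt 𝓘(ℝ, E) x).symm
      (Set.range 𝓘(ℝ, E)) y ((mfderivWithin 𝓘(ℝ, E) 𝓘(ℝ, E) (extChartAt 𝓘(ℝ, E) x).symm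
      (Set.range 𝓘(ℝ, E)) y).inverse w) = w := by
    intro w
    rw [← he, ContinuousLinearMap.inverse_equiv]
    exact e.apply_symm_apply w
  exact congrArg (mfderiv 𝓘(ℝ, E) 𝓘(ℝ, ℝ) f ((extChartAt 𝓘(ℝ, E) x).symm y)) (h2 _)

/-- `mlieBracket` is computed by pulling back to the chart at x, so the identity reduces to the
vector space case; the derivative of that chart at x is the identity, so nothing has to be
transported back. -/
theorem covector_mlieBracket {X Y : ∀ x : M, TangentSpace 𝓘(ℝ, E) x}
    (hX : SmoothFieldOn X Set.univ) (hY : SmoothFieldOn Y Set.univ) {f : M → ℝ}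
    (hf : ContMDiff 𝓘(ℝ, E) 𝓘(ℝ, ℝ) ∞ f) (x : M) :
    covector E f x (VectorField.mlieBracket 𝓘(ℝ, E) X Y x) =
      covector E (fun y => covector E f y (Y y)) x (X x) -
      covector E (fun y => covector E f y (X y)) x (Y x) := by
  set φ := extChartAt 𝓘(ℝ, E) x with hφ
  set V := VectorField.mpullbackWithin 𝓘(ℝ, E) 𝓘(ℝ, E) φ.symm X (Set.range 𝓘(ℝ, E)) with hV
  set W := VectorField.mpullbackWithin 𝓘(ℝ, E) 𝓘(ℝ, E) φ.symm Y (Set.range 𝓘(ℝ, E)) with hW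
  have hu : φ.symm ⁻¹' Set.univ ∩ Set.range 𝓘(ℝ, E) = Set.univ := by simp
  have hxt : φ x ∈ φ.target := mem_extChartAt_target x
  have hdiff : ∀ Z : ∀ x : M, TangentSpace 𝓘(ℝ, E) x, SmoothFieldOn Z Set.univ →
      DifferentiableAt ℝ (VectorField.mpullbackWithin 𝓘(ℝ, E) 𝓘(ℝ, E) φ.symm Z
        (Set.range 𝓘(ℝ, E))) (φ x) := by
    intro Z hZ
    have h1 : MDifferentiableWithinAt 𝓘(ℝ, E) 𝓘(ℝ, E).tangent
        (fun x => (⟨x, Z x⟩ : TangentBundle 𝓘(ℝ, E) M)) Set.univ x :=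
      (hZ x (Set.mem_univ x)).mdifferentiableWithinAt (by simp)
    have h2 := h1.differentiableWithinAt_mpullbackWithin_vectorField
    rw [hu] at h2
    exact differentiableWithinAt_univ.1 h2
  have hsm : ContDiffAt ℝ ∞ (f ∘ φ.symm) (φ x) := by
    rw [← contMDiffAt_iff_contDiffAt]
    refine ContMDiffAt.comp _ hf.contMDiffAt ?_
    exact (contMDiffOn_extChartAt_symm x).contMDiffAt ((isOpen_extChartAt_target x).mem_nhds hxt)
  have hkey := fderiv_lieBracket hsm (hdiff X hX) (hdiff Y hY)
  have hpt : φ.symm (φ x) = x := extChartAt_to_inv x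
  have hswap : ∀ Z Z' : ∀ x : M, TangentSpace 𝓘(ℝ, E) x, SmoothFieldOn Z' Set.univ →
      fderiv ℝ (fun y => fderiv ℝ (f ∘ φ.symm) y
        (VectorField.mpullbackWithin 𝓘(ℝ, E) 𝓘(ℝ, E) φ.symm Z' (Set.range 𝓘(ℝ, E)) y)) (φ x)
        (VectorField.mpullbackWithin 𝓘(ℝ, E) 𝓘(ℝ, E) φ.symm Z (Set.range 𝓘(ℝ, E)) (φ x)) =
      covector E (fun y => covector E f y (Z' y)) x (Z x) := by
    intro Z Z' hZ'
    have h1 := fderiv_chart_mpullback Z (contMDiff_covector_apply hZ' hf) x hxt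
    have h2 : (fun y => fderiv ℝ (f ∘ φ.symm) y
        (VectorField.mpullbackWithin 𝓘(ℝ, E) 𝓘(ℝ, E) φ.symm Z' (Set.range 𝓘(ℝ, E)) y))
        =ᶠ[𝓝 (φ x)] ((fun y => covector E f y (Z' y)) ∘ φ.symm) := by
      filter_upwards [(isOpen_extChartAt_target x).mem_nhds hxt] with y hy
      exact fderiv_chart_mpullback Z' hf x hy
    rw [h2.fderiv_eq]
    refine h1.trans ?_
    rw [← hφ, hpt]
  refine Eq.trans ?_ (hkey.trans (congrArg₂ (· - ·) (hswap X Y hY) (hswap Y X hX)))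
  have hb : VectorField.mlieBracket 𝓘(ℝ, E) X Y x =
      VectorField.lieBracket ℝ V W (φ x) := by
    have h1 := VectorField.mlieBracketWithin_apply (I := 𝓘(ℝ, E)) (s := Set.univ) (x₀ := x)
      (V := X) (W := Y)
    rw [VectorField.mlieBracketWithin_univ, ← hφ, hu] at h1
    have e1 : (mfderiv 𝓘(ℝ, E) 𝓘(ℝ, E) φ x).inverse =
        ContinuousLinearMap.id ℝ (TangentSpace 𝓘(ℝ, E) x) := by
      rw [hφ, mfderiv_extChartAt_self]
      exact ContinuousLinearMap.inverse_id
    refine h1.trans ((DFunLike.congr_fun e1 _).trans ?_)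
    exact congrFun (VectorField.lieBracketWithin_univ (𝕜 := ℝ) (V := (V : E → E))
      (W := (W : E → E))) (φ x)
  rw [hb]
  have hfx : fderiv ℝ (f ∘ φ.symm) (φ x) = mfderiv 𝓘(ℝ, E) 𝓘(ℝ, ℝ) f x := by
    have h3 := (hf.contMDiffAt (x := x)).mdifferentiableAt (by simp)
    rw [h3.mfderiv, ← fderivWithin_univ]
    simp only [writtenInExtChartAt, hφ, Function.comp_def, modelWithCornersSelf_coe, Set.range_id]
    rfl
  rw [hfx]
  rfl

end Bracket

/-! ### Left-invariant fields and the left logarithmic derivative -/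

section LieGroups
variable {E : Type*} [NormedAddCommGroup E] [NormedSpace ℝ E]
  {G : Type*} [TopologicalSpace G] [ChartedSpace E G] [Group G]
  {F : Type*} [NormedAddCommGroup F] [NormedSpace ℝ F]
  {N : Type*} [TopologicalSpace N] [ChartedSpace F N]

/-- Tangent spaces at all points are definitionally the model space; reading both sides there
permits a change of base point along an equality without casts. -/
theorem mfderiv_point_congr {M : Type*} [TopologicalSpace M] [ChartedSpace E M] (f : M → N)
    {x y : M} (h : x = y) (v : E) :
    (mfderiv 𝓘(ℝ, E) 𝓘(ℝ, F) f x v : F) = mfderiv 𝓘(ℝ, E) 𝓘(ℝ, F) f y v := by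
  subst h; rfl

theorem mfderiv_fun_congr {M : Type*} [TopologicalSpace M] [ChartedSpace E M] {f g : M → N}
    (h : f = g) (x : M) (v : E) :
    (mfderiv 𝓘(ℝ, E) 𝓘(ℝ, F) f x v : F) = mfderiv 𝓘(ℝ, E) 𝓘(ℝ, F) g x v := by
  subst h; rfl

variable [LieGroup 𝓘(ℝ, E) ∞ G]

theorem mdifferentiableAt_mul_left (g h : G) :
    MDifferentiableAt 𝓘(ℝ, E) 𝓘(ℝ, E) (fun x => g * x) h :=
  (contMDiff_mul_left (I := 𝓘(ℝ, E)) (n := ∞)).contMDiffAt.mdifferentiableAt (by simp)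

theorem mfderiv_mulInvariantVectorField {f : G → N} {g : G}
    (hf : MDifferentiableAt 𝓘(ℝ, E) 𝓘(ℝ, F) f g) (u : GroupLieAlgebra 𝓘(ℝ, E) G) :
    (mfderiv 𝓘(ℝ, E) 𝓘(ℝ, F) f g (mulInvariantVectorField u g) : F) =
      mfderiv 𝓘(ℝ, E) 𝓘(ℝ, F) (fun x => f (g * x)) 1 u := by
  have hf' : MDifferentiableAt 𝓘(ℝ, E) 𝓘(ℝ, F) f (g * 1) := by rwa [mul_one]
  have h := mfderiv_comp (I' := 𝓘(ℝ, E)) (1 : G) hf' (mdifferentiableAt_mul_left g 1)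
  have h1 := DFunLike.congr_fun h u
  refine Eq.trans ?_ h1.symm
  exact mfderiv_point_congr f (mul_one g).symm _

theorem mulInvariantVectorField_mul (g h : G) (u : GroupLieAlgebra 𝓘(ℝ, E) G) :
    (mfderiv 𝓘(ℝ, E) 𝓘(ℝ, E) (fun x => g * x) h (mulInvariantVectorField u h) : E) =
      mulInvariantVectorField u (g * h) := by
  rw [mfderiv_mulInvariantVectorField (mdifferentiableAt_mul_left g h)]
  exact mfderiv_fun_congr (E := E) (by ext x; simp [mul_assoc]) (1 : G) u

omit [LieGroup 𝓘(ℝ, E) ∞ G] in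
theorem mulInvariantVectorField_one (u : GroupLieAlgebra 𝓘(ℝ, E) G) :
    mulInvariantVectorField u (1 : G) = u := by
  have : (fun x : G => 1 * x) = id := by ext; simp
  refine (mfderiv_fun_congr (E := E) this (1 : G) u).trans ?_
  rw [mfderiv_id]
  rfl

/-- Left translation of a tangent vector back to the identity. -/
def leftLog (g : G) (v : TangentSpace 𝓘(ℝ, E) g) : GroupLieAlgebra 𝓘(ℝ, E) G :=
  (mfderiv 𝓘(ℝ, E) 𝓘(ℝ, E) (fun x : G => g⁻¹ * x) g v : E)

theorem leftLog_mulInvariantVectorField (g : G) (u : GroupLieAlgebra 𝓘(ℝ, E) G) :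
    leftLog g (mulInvariantVectorField u g) = u := by
  refine (mulInvariantVectorField_mul g⁻¹ g u).trans ?_
  rw [inv_mul_cancel]
  exact mulInvariantVectorField_one u

theorem mulInvariantVectorField_leftLog (g : G) (v : TangentSpace 𝓘(ℝ, E) g) :
    mulInvariantVectorField (leftLog g v) g = v := by
  have h := mfderiv_comp (I' := 𝓘(ℝ, E)) g (mdifferentiableAt_mul_left (E := E) g (g⁻¹ * g))
    (mdifferentiableAt_mul_left (E := E) g⁻¹ g)
  have hid : (fun x : G => g * x) ∘ (fun x => g⁻¹ * x) = id := by ext; simp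
  rw [hid, mfderiv_id] at h
  refine Eq.trans ?_ (DFunLike.congr_fun h v).symm
  exact mfderiv_point_congr (fun x : G => g * x) (inv_mul_cancel g).symm _

/-- This is the partial tangent map of multiplication at vectors over 1. Joint smoothness in u is
what time-dependent left-invariant fields require. -/
theorem contMDiff_mulInvariantVectorField_uncurried :
    ContMDiff (𝓘(ℝ, E).prod 𝓘(ℝ, E)) 𝓘(ℝ, E).tangent ∞
      (fun z : G × E => (⟨z.1, mulInvariantVectorField (z.2 : GroupLieAlgebra 𝓘(ℝ, E) G) z.1⟩ :
        TangentBundle 𝓘(ℝ, E) G)) := by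
  have h1 := contMDiff_partial_tangentMap (contMDiff_mul 𝓘(ℝ, E) ∞ (G := G))
  have h2 : ContMDiff (𝓘(ℝ, E).prod 𝓘(ℝ, E)) 𝓘(ℝ, E).tangent ∞
      (fun z : G × E => (⟨1, z.2⟩ : TangentBundle 𝓘(ℝ, E) G)) :=
    contMDiff_fibre_inclusion contMDiff_snd
  refine (h1.comp ((contMDiff_fst (I := 𝓘(ℝ, E)) (J := 𝓘(ℝ, E)) (M := G) (N := E)).prodMk
    h2)).congr fun z => ?_
  exact Bundle.TotalSpace.ext (mul_one z.1).symm (heq_of_eq rfl)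

/-- The partial tangent map of (g, h) ↦ g⁻¹h, with g the base point of the vector, lands in the
single fibre over 1, where smoothness is that of an E-valued map. -/
theorem contMDiffAt_leftLog {X : Type*} [NormedAddCommGroup X] [NormedSpace ℝ X]
    {HX : Type*} [TopologicalSpace HX] {IX : ModelWithCorners ℝ X HX}
    {Q : Type*} [TopologicalSpace Q] [ChartedSpace HX Q] {φ : Q → TangentBundle 𝓘(ℝ, E) G}
    {q : Q} (h : ContMDiffAt IX 𝓘(ℝ, E).tangent ∞ φ q) :
    ContMDiffAt (M' := E) IX 𝓘(ℝ, E) ∞ (fun q => leftLog (φ q).1 (φ q).2) q := by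
  have h0 : ContMDiff (𝓘(ℝ, E).prod 𝓘(ℝ, E)) 𝓘(ℝ, E) ∞ (fun p : G × G => p.1⁻¹ * p.2) :=
    (contMDiff_fst.inv).mul contMDiff_snd
  have h1 := contMDiff_partial_tangentMap h0
  have h2 : ContMDiffAt IX 𝓘(ℝ, E) ∞ (fun q => (φ q).1) q :=
    (Bundle.contMDiffAt_totalSpace.1 h).1
  have h3 := (h1.contMDiffAt (x := ((φ q).1, φ q))).comp q (h2.prodMk h)
  refine contMDiffAt_snd_of_fst_const (M := G) (z := 1) ?_
  refine h3.congr_of_eventuallyEq (Filter.Eventually.of_forall fun q => ?_)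
  exact Bundle.TotalSpace.ext (inv_mul_cancel (φ q).1).symm (heq_of_eq rfl)

end LieGroups

/-! ### Curves with logarithmic derivative in a Lie subalgebra -/

section Homs
variable {E : Type*} [NormedAddCommGroup E] [NormedSpace ℝ E]
  {G : Type*} [TopologicalSpace G] [ChartedSpace E G] [Group G] [LieGroup 𝓘(ℝ, E) ∞ G]
  {E' : Type*} [NormedAddCommGroup E'] [NormedSpace ℝ E']
  {A : Type*} [TopologicalSpace A] [ChartedSpace E' A] [Group A] [LieGroup 𝓘(ℝ, E') ∞ A]

/-- A homomorphism followed by a left translation carries left-invariant fields to left-invariant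
fields. -/
theorem mfderiv_translate_hom {ι : A →* G} (hι : ContMDiff 𝓘(ℝ, E') 𝓘(ℝ, E) ∞ ι) (g : G) (a : A)
    (u : GroupLieAlgebra 𝓘(ℝ, E') A) :
    (mfderiv 𝓘(ℝ, E') 𝓘(ℝ, E) (fun x => g * ι x) a (mulInvariantVectorField u a) : E) =
      mulInvariantVectorField (lieMap E' E ι u) (g * ι a) := by
  have hd : ∀ x, MDifferentiableAt 𝓘(ℝ, E') 𝓘(ℝ, E) ι x := fun x =>
    hι.contMDiffAt.mdifferentiableAt (by simp)
  have h1 : MDifferentiableAt 𝓘(ℝ, E') 𝓘(ℝ, E) (fun x => g * ι x) a :=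
    (mdifferentiableAt_mul_left g (ι a)).comp a (hd a)
  rw [mfderiv_mulInvariantVectorField h1]
  have h2 : (fun x => g * ι (a * x)) = (fun y => (g * ι a) * y) ∘ ι := by
    ext x; simp [mul_assoc]
  rw [h2, mfderiv_comp (I' := 𝓘(ℝ, E)) (1 : A) (mdifferentiableAt_mul_left _ _) (hd 1)]
  exact mfderiv_point_congr (fun y => (g * ι a) * y) (map_one ι) _

/-- The suspension of the time-dependent left-invariant vector field given by `u`. -/
def suspendedField (u : ℝ → E) (z : G × ℝ) :
    TangentSpace (𝓘(ℝ, E).prod 𝓘(ℝ, ℝ)) z :=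
  (mulInvariantVectorField (I := 𝓘(ℝ, E)) (u z.2) z.1, (1 : ℝ))

theorem contMDiffAt_suspendedField {u : ℝ → E} {z : G × ℝ}
    (hu : ContMDiffAt 𝓘(ℝ, ℝ) 𝓘(ℝ, E) ∞ u z.2) :
    ContMDiffAt (𝓘(ℝ, E).prod 𝓘(ℝ, ℝ)) (𝓘(ℝ, E).prod 𝓘(ℝ, ℝ)).tangent 1
      (fun z => (⟨z, suspendedField (E := E) u z⟩ :
        TangentBundle (𝓘(ℝ, E).prod 𝓘(ℝ, ℝ)) (G × ℝ))) z := by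
  have h1 : ContMDiffAt (𝓘(ℝ, E).prod 𝓘(ℝ, ℝ)) 𝓘(ℝ, E).tangent ∞ (fun z : G × ℝ =>
      (⟨z.1, mulInvariantVectorField (u z.2 : GroupLieAlgebra 𝓘(ℝ, E) G) z.1⟩ :
        TangentBundle 𝓘(ℝ, E) G)) z := by
    have hz : ContMDiffAt (𝓘(ℝ, E).prod 𝓘(ℝ, ℝ)) (𝓘(ℝ, E).prod 𝓘(ℝ, E)) ∞
        (fun z : G × ℝ => (z.1, u z.2)) z :=
      contMDiffAt_fst.prodMk (hu.comp z contMDiffAt_snd)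
    exact (contMDiff_mulInvariantVectorField_uncurried.contMDiffAt
      (x := ((z.1, u z.2) : G × E))).comp z hz
  have h2 : ContMDiff 𝓘(ℝ, ℝ) 𝓘(ℝ, ℝ).tangent ∞
      (fun t : ℝ => (⟨t, (1 : ℝ)⟩ : TangentBundle 𝓘(ℝ, ℝ) ℝ)) := by
    exact contMDiff_vectorSpace_iff_contDiff.2 contDiff_const
  have h3 := (contMDiff_equivTangentBundleProd_symm (n := ∞) (I := 𝓘(ℝ, E)) (M := G)
    (I' := 𝓘(ℝ, ℝ)) (M' := ℝ)).contMDiffAt.comp z (h1.prodMk (h2.contMDiffAt.comp z contMDiffAt_snd))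
  exact h3.of_le (WithTop.coe_le_coe.2 (le_top : (1 : ℕ∞) ≤ ⊤))

/-- Lift w = c⁻¹c' to a curve u in Lie(A) and solve z' = z·u in A with z(t₀) = 1. Then c(t₀)ι(z) and
c solve the same equation in G with the same initial value. Adding time as a coordinate makes the
equation autonomous, so that uniqueness of integral curves applies. -/
theorem eventually_mem_coset_of_leftLog_mem [FiniteDimensional ℝ E] [FiniteDimensional ℝ E']
    {ι : A →* G}
    (hι : ContMDiff 𝓘(ℝ, E') 𝓘(ℝ, E) ∞ ι)
    (hinj : Function.Injective (lieMap E' E ι)) {c : ℝ → G} {J : Set ℝ} (hJ : IsOpen J)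
    (hc : ContMDiffOn 𝓘(ℝ, ℝ) 𝓘(ℝ, E) ∞ c J)
    (hlog : ∀ t ∈ J, leftLog (c t) (mfderiv 𝓘(ℝ, ℝ) 𝓘(ℝ, E) c t (1 : ℝ)) ∈
      LinearMap.range (lieMap E' E ι)) {t₀ : ℝ} (ht₀ : t₀ ∈ J) :
    ∀ᶠ t in 𝓝 t₀, ∃ a : A, c t = c t₀ * ι a := by
  let w : ℝ → E := fun t => leftLog (c t) (mfderiv 𝓘(ℝ, ℝ) 𝓘(ℝ, E) c t (1 : ℝ))
  have hφ : ContMDiffAt 𝓘(ℝ, ℝ) 𝓘(ℝ, E).tangent ∞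
      (fun t => (⟨c t, mfderiv 𝓘(ℝ, ℝ) 𝓘(ℝ, E) c t (1 : ℝ)⟩ : TangentBundle 𝓘(ℝ, E) G)) t₀ := by
    have h1 : ContMDiffAt 𝓘(ℝ, ℝ).tangent 𝓘(ℝ, E).tangent ∞
        (tangentMapWithin 𝓘(ℝ, ℝ) 𝓘(ℝ, E) c J)
        (⟨t₀, (1 : ℝ)⟩ : TangentBundle 𝓘(ℝ, ℝ) ℝ) :=
      (hc.contMDiffOn_tangentMapWithin (m := ∞) le_rfl hJ.uniqueMDiffOn).contMDiffAt
        ((hJ.preimage (FiberBundle.continuous_proj ℝ (TangentSpace 𝓘(ℝ, ℝ)))).mem_nhds ht₀)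
    have h2 : ContMDiff 𝓘(ℝ, ℝ) 𝓘(ℝ, ℝ).tangent ∞
        (fun t : ℝ => (⟨t, (1 : ℝ)⟩ : TangentBundle 𝓘(ℝ, ℝ) ℝ)) :=
      contMDiff_vectorSpace_iff_contDiff.2 contDiff_const
    refine (h1.comp t₀ h2.contMDiffAt).congr_of_eventuallyEq ?_
    filter_upwards [hJ.mem_nhds ht₀] with t ht
    simp only [tangentMapWithin, Function.comp_def]
    rw [mfderivWithin_of_isOpen hJ ht]
  have hw : ContMDiffAt 𝓘(ℝ, ℝ) 𝓘(ℝ, E) ∞ w t₀ := contMDiffAt_leftLog hφ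
  -- A linear left inverse of Lie(A) → 𝔤 makes the lift u smooth; on J, where w lies in the range,
  -- it is a true lift.
  obtain ⟨S, hS⟩ := LinearMap.exists_leftInverse_of_injective (lieMap E' E ι)
    (LinearMap.ker_eq_bot.2 hinj)
  let S' : E →ₗ[ℝ] E' := S
  let u : ℝ → E' := fun t => S' (w t)
  have hu : ContMDiffAt 𝓘(ℝ, ℝ) 𝓘(ℝ, E') ∞ u t₀ :=
    (LinearMap.toContinuousLinearMap S').contMDiff.contMDiffAt.comp t₀ hw
  have hlift : ∀ t ∈ J, lieMap E' E ι (u t) = w t := by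
    intro t ht
    obtain ⟨v, hv⟩ := hlog t ht
    have h1 : u t = v := (congrArg S hv.symm).trans (DFunLike.congr_fun hS v)
    rw [h1]; exact hv
  obtain ⟨z, hz0, hz⟩ := exists_isMIntegralCurveAt_of_contMDiffAt_boundaryless
    (I := 𝓘(ℝ, E').prod 𝓘(ℝ, ℝ)) t₀ (v := suspendedField (G := A) u) (x₀ := ((1 : A), t₀))
    (contMDiffAt_suspendedField hu)
  -- The time component of z need not be identified with t: both suspended curves start at (c t₀,
  -- t₀) and uniqueness compares them whole. It only has to stay in J, where u lifts w.
  have hJz : ∀ᶠ t in 𝓝 t₀, (z t).2 ∈ J := by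
    have : ContinuousAt (fun t => (z t).2) t₀ := continuous_snd.continuousAt.comp hz.continuousAt
    exact this.preimage_mem_nhds (hJ.mem_nhds (by rw [hz0]; exact ht₀))
  have hz' : IsMIntegralCurveAt (I := 𝓘(ℝ, E).prod 𝓘(ℝ, ℝ))
      (fun t => ((c t₀ * ι (z t).1, (z t).2) : G × ℝ)) (suspendedField (G := G) w) t₀ := by
    filter_upwards [hz, hJz] with t ht hJt
    have hm : HasMFDerivAt 𝓘(ℝ, E') 𝓘(ℝ, E) (fun x : A => c t₀ * ι x) (z t).1 _ :=
      ((mdifferentiableAt_mul_left (E := E) (c t₀) (ι (z t).1)).comp (z t).1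
        (hι.contMDiffAt.mdifferentiableAt (by simp))).hasMFDerivAt
    have hΦ : HasMFDerivAt (𝓘(ℝ, E').prod 𝓘(ℝ, ℝ)) (𝓘(ℝ, E).prod 𝓘(ℝ, ℝ))
        (Prod.map (fun x : A => c t₀ * ι x) (id : ℝ → ℝ)) (z t) _ :=
      hm.prodMap (hasMFDerivAt_id (I := 𝓘(ℝ, ℝ)) (z t).2)
    refine (hΦ.comp t ht).congr_mfderiv ?_
    refine ContinuousLinearMap.ext_ring ?_
    have e : ∀ v : E' × ℝ, (ContinuousLinearMap.smulRight (1 : ℝ →L[ℝ] ℝ) v) 1 = v := by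
      intro v; simp
    have e' : ∀ v : E × ℝ, (ContinuousLinearMap.smulRight (1 : ℝ →L[ℝ] ℝ) v) 1 = v := by
      intro v; simp
    refine Eq.trans ?_ (e' _).symm
    refine Eq.trans (b := (((mfderiv 𝓘(ℝ, E') 𝓘(ℝ, E) (fun x : A => c t₀ * ι x) (z t).1
      (mulInvariantVectorField (I := 𝓘(ℝ, E')) (u (z t).2) (z t).1) : E), (1 : ℝ)) : E × ℝ)) ?_ ?_
    · refine Prod.ext ?_ ?_
      · exact congrArg (fun v : E' × ℝ => (mfderiv 𝓘(ℝ, E') 𝓘(ℝ, E) (fun x : A => c t₀ * ι x)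
          (z t).1 v.1 : E)) (e (suspendedField (G := A) u (z t)))
      · refine (congrArg (fun v : E' × ℝ => (mfderiv 𝓘(ℝ, ℝ) 𝓘(ℝ, ℝ) (id : ℝ → ℝ)
          (z t).2 v.2 : ℝ)) (e (suspendedField (G := A) u (z t)))).trans ?_
        simp only [mfderiv_id]
        rfl
    · refine Prod.ext ?_ rfl
      refine (mfderiv_translate_hom hι _ _ _).trans ?_
      rw [hlift _ hJt]
      rfl
  have hc' : IsMIntegralCurveAt (I := 𝓘(ℝ, E).prod 𝓘(ℝ, ℝ))
      (fun t => ((c t, t) : G × ℝ)) (suspendedField (G := G) w) t₀ := by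
    filter_upwards [hJ.mem_nhds ht₀] with t ht
    have h1 : HasMFDerivAt 𝓘(ℝ, ℝ) 𝓘(ℝ, E) c t _ :=
      ((hc.contMDiffAt (hJ.mem_nhds ht)).mdifferentiableAt (by simp)).hasMFDerivAt
    refine (h1.prodMk (hasMFDerivAt_id (I := 𝓘(ℝ, ℝ)) t)).congr_mfderiv ?_
    refine ContinuousLinearMap.ext_ring ?_
    have e' : ∀ v : E × ℝ, (ContinuousLinearMap.smulRight (1 : ℝ →L[ℝ] ℝ) v) 1 = v := by
      intro v; simp
    refine Eq.trans ?_ (e' _).symm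
    exact Prod.ext (mulInvariantVectorField_leftLog (c t) _).symm rfl
  have hw' := contMDiffAt_suspendedField (z := (c t₀, t₀)) hw
  have heq := isMIntegralCurveAt_eventuallyEq_of_contMDiffAt_boundaryless
    (I := 𝓘(ℝ, E).prod 𝓘(ℝ, ℝ)) (γ := fun t => (c t, t)) hw' hc' hz' (by simp [hz0])
  filter_upwards [heq] with t ht
  exact ⟨(z t).1, congrArg Prod.fst ht⟩

end Homs

/-! ### Calculus on a homogeneous space -/

section Homogeneous
variable {E : Type*} [NormedAddCommGroup E] [NormedSpace ℝ E]
  {G : Type*} [TopologicalSpace G] [ChartedSpace E G] [Group G]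
  {F : Type*} [NormedAddCommGroup F] [NormedSpace ℝ F]
  {H : Subgroup G} [ChartedSpace F (G ⧸ H)]

omit [TopologicalSpace G] in
theorem proj_surjective : Function.Surjective (proj H) := QuotientGroup.mk_surjective

theorem contMDiff_proj (hp : IsSubmersion 𝓘(ℝ, E) 𝓘(ℝ, F) ∞ (proj H)) :
    ContMDiff 𝓘(ℝ, E) 𝓘(ℝ, F) ∞ (proj H) := by
  obtain ⟨C, _, _, hC⟩ := hp
  exact fun x => (hC x).contMDiffAt

theorem mdifferentiableAt_proj (hp : IsSubmersion 𝓘(ℝ, E) 𝓘(ℝ, F) ∞ (proj H)) (g : G) :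
    MDifferentiableAt 𝓘(ℝ, E) 𝓘(ℝ, F) (proj H) g :=
  (contMDiff_proj hp).contMDiffAt.mdifferentiableAt (by simp)

variable [LieGroup 𝓘(ℝ, E) ∞ G]

/-- Locally g • x = p(g s(x)) with s a local section of p. The lemma also serves for A acting on
A/(A ∩ H). -/
theorem contMDiff_homogeneous_smul (hp : IsSubmersion 𝓘(ℝ, E) 𝓘(ℝ, F) ∞ (proj H)) :
    ContMDiff (𝓘(ℝ, E).prod 𝓘(ℝ, F)) 𝓘(ℝ, F) ∞ (fun z : G × (G ⧸ H) => z.1 • z.2) := by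
  rintro ⟨g, x⟩
  obtain ⟨y, rfl⟩ := proj_surjective x
  obtain ⟨V, s, hV, hy, hs, -, hsec⟩ := exists_local_section hp y
  have h1 : ContMDiffAt (𝓘(ℝ, E).prod 𝓘(ℝ, F)) 𝓘(ℝ, E) ∞
      (fun z : G × (G ⧸ H) => z.1 * s z.2) (g, proj H y) :=
    contMDiffAt_fst.mul (ContMDiffAt.comp _ (hs.contMDiffAt (hV.mem_nhds hy)) contMDiffAt_snd)
  have h2 := (contMDiff_proj hp).contMDiffAt.comp (g, proj H y) h1
  refine h2.congr_of_eventuallyEq ?_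
  filter_upwards [(hV.preimage continuous_snd).mem_nhds
    (show (g, proj H y) ∈ Prod.snd ⁻¹' V from hy)] with z hz
  have hz : z.2 ∈ V := hz
  conv_lhs => rw [← hsec _ hz]
  rfl

theorem contMDiff_const_smul_homogeneous (hp : IsSubmersion 𝓘(ℝ, E) 𝓘(ℝ, F) ∞ (proj H)) (g : G) :
    ContMDiff 𝓘(ℝ, F) 𝓘(ℝ, F) ∞ (fun x : G ⧸ H => g • x) :=
  (contMDiff_homogeneous_smul hp).comp (contMDiff_const.prodMk contMDiff_id)

theorem mdifferentiableAt_smul (hp : IsSubmersion 𝓘(ℝ, E) 𝓘(ℝ, F) ∞ (proj H)) (g : G)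
    (x : G ⧸ H) : MDifferentiableAt 𝓘(ℝ, F) 𝓘(ℝ, F) (fun x : G ⧸ H => g • x) x :=
  (contMDiff_const_smul_homogeneous hp g).contMDiffAt.mdifferentiableAt (by simp)

theorem mfderiv_smul_smul (hp : IsSubmersion 𝓘(ℝ, E) 𝓘(ℝ, F) ∞ (proj H)) (g g' : G)
    (x : G ⧸ H) (v : TangentSpace 𝓘(ℝ, F) x) :
    (mfderiv 𝓘(ℝ, F) 𝓘(ℝ, F) (fun y : G ⧸ H => g • y) (g' • x)
      (mfderiv 𝓘(ℝ, F) 𝓘(ℝ, F) (fun y : G ⧸ H => g' • y) x v) : F) =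
    mfderiv 𝓘(ℝ, F) 𝓘(ℝ, F) (fun y : G ⧸ H => (g * g') • y) x v := by
  have h := mfderiv_comp (I' := 𝓘(ℝ, F)) x (mdifferentiableAt_smul hp g (g' • x))
    (mdifferentiableAt_smul hp g' x)
  refine (DFunLike.congr_fun h v).symm.trans ?_
  exact mfderiv_fun_congr (E := F) (by ext y; simp [mul_smul]) x v

theorem mfderiv_one_smul (x : G ⧸ H) (v : TangentSpace 𝓘(ℝ, F) x) :
    (mfderiv 𝓘(ℝ, F) 𝓘(ℝ, F) (fun y : G ⧸ H => (1 : G) • y) x v : F) = v := by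
  have h : (fun y : G ⧸ H => (1 : G) • y) = id := by ext y; simp
  refine (mfderiv_fun_congr (E := F) h x v).trans ?_
  rw [mfderiv_id]; rfl

theorem mfderiv_inv_smul_smul (hp : IsSubmersion 𝓘(ℝ, E) 𝓘(ℝ, F) ∞ (proj H)) (g : G)
    (x : G ⧸ H) (v : TangentSpace 𝓘(ℝ, F) x) :
    (mfderiv 𝓘(ℝ, F) 𝓘(ℝ, F) (fun y : G ⧸ H => g⁻¹ • y) (g • x)
      (mfderiv 𝓘(ℝ, F) 𝓘(ℝ, F) (fun y : G ⧸ H => g • y) x v) : F) = v := by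
  refine (mfderiv_smul_smul hp g⁻¹ g x v).trans ?_
  have h : (fun y : G ⧸ H => (g⁻¹ * g) • y) = (fun y => (1 : G) • y) := by simp
  exact (mfderiv_fun_congr (E := F) h x v).trans (mfderiv_one_smul x v)

theorem mfderiv_smul_inv_smul (hp : IsSubmersion 𝓘(ℝ, E) 𝓘(ℝ, F) ∞ (proj H)) (g : G)
    (x : G ⧸ H) (v : TangentSpace 𝓘(ℝ, F) (g • x)) :
    (mfderiv 𝓘(ℝ, F) 𝓘(ℝ, F) (fun y : G ⧸ H => g • y) x
      (mfderiv 𝓘(ℝ, F) 𝓘(ℝ, F) (fun y : G ⧸ H => g⁻¹ • y) (g • x) v : F) : F) = v := by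
  have h := mfderiv_inv_smul_smul hp g⁻¹ (g • x) v
  rw [inv_inv] at h
  exact (mfderiv_point_congr (E := F) (fun y : G ⧸ H => g • y) (inv_smul_smul g x).symm _).trans h

theorem mfderiv_smul_injective (hp : IsSubmersion 𝓘(ℝ, E) 𝓘(ℝ, F) ∞ (proj H)) (g : G)
    (x : G ⧸ H) :
    Function.Injective (mfderiv 𝓘(ℝ, F) 𝓘(ℝ, F) (fun y : G ⧸ H => g • y) x) := by
  intro v w h
  have h1 := mfderiv_inv_smul_smul hp g x v
  have h2 := mfderiv_inv_smul_smul hp g x w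
  rw [h] at h1
  exact h1.symm.trans h2

variable (F H) in
/-- `u ↦ T p (T L_g u)`, the differential at `e` of `x ↦ g x H`. -/
def dproj (g : G) : GroupLieAlgebra 𝓘(ℝ, E) G →ₗ[ℝ] TangentSpace 𝓘(ℝ, F) (proj H g) where
  toFun u := mfderiv 𝓘(ℝ, E) 𝓘(ℝ, F) (proj H) g (mulInvariantVectorField u g)
  map_add' u v := by
    rw [mulInvariantVectorField_add]
    exact map_add (mfderiv 𝓘(ℝ, E) 𝓘(ℝ, F) (proj H) g) _ _
  map_smul' c u := by
    rw [mulInvariantVectorField_smul]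
    exact map_smul (mfderiv 𝓘(ℝ, E) 𝓘(ℝ, F) (proj H) g) _ _

theorem dproj_leftLog (g : G) (v : TangentSpace 𝓘(ℝ, E) g) :
    dproj F H g (leftLog g v) = mfderiv 𝓘(ℝ, E) 𝓘(ℝ, F) (proj H) g v :=
  congrArg (mfderiv 𝓘(ℝ, E) 𝓘(ℝ, F) (proj H) g) (mulInvariantVectorField_leftLog g v)

theorem dproj_eq (hp : IsSubmersion 𝓘(ℝ, E) 𝓘(ℝ, F) ∞ (proj H)) (g : G)
    (u : GroupLieAlgebra 𝓘(ℝ, E) G) :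
    (dproj F H g u : F) = mfderiv 𝓘(ℝ, E) 𝓘(ℝ, F) (fun x => proj H (g * x)) 1 u :=
  mfderiv_mulInvariantVectorField (mdifferentiableAt_proj hp g) u

theorem dproj_mul (hp : IsSubmersion 𝓘(ℝ, E) 𝓘(ℝ, F) ∞ (proj H)) (g g' : G)
    (u : GroupLieAlgebra 𝓘(ℝ, E) G) :
    (mfderiv 𝓘(ℝ, F) 𝓘(ℝ, F) (fun y : G ⧸ H => g • y) (proj H g') (dproj F H g' u) : F) =
      dproj F H (g * g') u := by
  have h1 := mfderiv_comp (I' := 𝓘(ℝ, F)) g' (mdifferentiableAt_smul hp g (proj H g'))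
    (mdifferentiableAt_proj hp g')
  refine (DFunLike.congr_fun h1 _).symm.trans ?_
  have hd : MDifferentiableAt 𝓘(ℝ, E) 𝓘(ℝ, F) ((fun y : G ⧸ H => g • y) ∘ proj H) g' :=
    (mdifferentiableAt_smul hp g (proj H g')).comp g' (mdifferentiableAt_proj hp g')
  refine (mfderiv_mulInvariantVectorField hd u).trans ?_
  rw [dproj_eq hp]
  exact mfderiv_fun_congr (E := E) (by ext x; simp [proj, mul_assoc]) 1 u

omit [LieGroup 𝓘(ℝ, E) ∞ G] in
theorem Tp_eq_dproj (u : GroupLieAlgebra 𝓘(ℝ, E) G) : Tp E F H u = dproj F H 1 u :=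
  (congrArg (mfderiv 𝓘(ℝ, E) 𝓘(ℝ, F) (proj H) 1) (mulInvariantVectorField_one u)).symm

theorem mfderiv_smul_Tp (hp : IsSubmersion 𝓘(ℝ, E) 𝓘(ℝ, F) ∞ (proj H)) (g : G)
    (u : GroupLieAlgebra 𝓘(ℝ, E) G) :
    (mfderiv 𝓘(ℝ, F) 𝓘(ℝ, F) (fun y : G ⧸ H => g • y) (proj H 1) (Tp E F H u) : F) =
      dproj F H g u := by
  rw [Tp_eq_dproj]
  refine (dproj_mul hp g 1 u).trans ?_
  rw [mul_one]

omit [LieGroup 𝓘(ℝ, E) ∞ G] in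
theorem ker_Tp (hp : IsSubmersion 𝓘(ℝ, E) 𝓘(ℝ, F) ∞ (proj H)) :
    LinearMap.ker (Tp E F H) = lieSub E H := by
  refine le_antisymm (fun u hu => ?_) (lieSub_le_ker hp)
  have h : Phi hp (Submodule.Quotient.mk u) = Phi hp 0 := by
    rw [map_zero]; exact hu
  exact (Submodule.Quotient.mk_eq_zero _).1 ((Phi_bijective hp).1 h)

/-- At the identity this is the injectivity of 𝔤/𝔥 → T(G/H); translations, being injective on
tangent vectors, carry it to g. -/
theorem dproj_eq_zero_iff (hp : IsSubmersion 𝓘(ℝ, E) 𝓘(ℝ, F) ∞ (proj H)) (g : G)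
    (u : GroupLieAlgebra 𝓘(ℝ, E) G) : dproj F H g u = 0 ↔ u ∈ lieSub E H := by
  rw [← ker_Tp hp, LinearMap.mem_ker]
  have h := mfderiv_smul_Tp hp g u
  constructor
  · intro h0
    refine mfderiv_smul_injective hp g (proj H 1) ?_
    rw [map_zero]
    exact h.trans h0
  · intro h0
    refine Eq.trans (h.symm) ?_
    rw [h0]
    exact map_zero (mfderiv 𝓘(ℝ, F) 𝓘(ℝ, F) (fun y : G ⧸ H => g • y) (proj H 1))

theorem dproj_surjective (hp : IsSubmersion 𝓘(ℝ, E) 𝓘(ℝ, F) ∞ (proj H)) (g : G) :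
    Function.Surjective (dproj F H (E := E) g) := by
  obtain ⟨C, _, _, hC⟩ := hp
  intro v
  obtain ⟨w, hw⟩ := submersion_surjective (hC g) v
  exact ⟨leftLog g w, (dproj_leftLog g w).trans hw⟩

/-- Differentiate g(bxb⁻¹)H = gbxH at x = e. This identity matches the equivalence relation of G ×_H
(𝔞/𝔥) with the fibres of T(G/H). -/
theorem dproj_Ad (hp : IsSubmersion 𝓘(ℝ, E) 𝓘(ℝ, F) ∞ (proj H)) (g : G) {b : G} (hb : b ∈ H)
    (u : GroupLieAlgebra 𝓘(ℝ, E) G) :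
    (dproj F H g (Ad E b u) : F) = dproj F H (g * b) u := by
  rw [dproj_eq hp, dproj_eq hp]
  have hc : MDifferentiableAt 𝓘(ℝ, E) 𝓘(ℝ, E) (fun x : G => b * x * b⁻¹) 1 :=
    (((contMDiff_mul_left (I := 𝓘(ℝ, E)) (n := ∞) (a := b)).mul
      contMDiff_const).contMDiffAt).mdifferentiableAt (by simp)
  have hd : ∀ y, MDifferentiableAt 𝓘(ℝ, E) 𝓘(ℝ, F) (fun x => proj H (g * x)) y := fun y =>
    (mdifferentiableAt_proj hp (g * y)).comp y (mdifferentiableAt_mul_left g y)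
  have h1 := mfderiv_comp (I' := 𝓘(ℝ, E)) (1 : G) (hd (b * 1 * b⁻¹)) hc
  have h2 := DFunLike.congr_fun h1 u
  refine Eq.trans ?_ (h2.symm.trans ?_)
  · exact mfderiv_point_congr (fun x => proj H (g * x)) (by simp) _
  · refine mfderiv_fun_congr (E := E) ?_ 1 u
    ext x
    exact QuotientGroup.eq.2 (by simp [mul_assoc, hb])

theorem Ad_mul (b c : G) (u : GroupLieAlgebra 𝓘(ℝ, E) G) :
    Ad E b (Ad E c u) = Ad E (b * c) u := by
  have hc : ∀ b y : G, MDifferentiableAt 𝓘(ℝ, E) 𝓘(ℝ, E) (fun x : G => b * x * b⁻¹) y :=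
    fun b y => (((contMDiff_mul_left (I := 𝓘(ℝ, E)) (n := ∞) (a := b)).mul
      contMDiff_const).contMDiffAt).mdifferentiableAt (by simp)
  have h1 := mfderiv_comp (I' := 𝓘(ℝ, E)) (1 : G) (hc b (c * 1 * c⁻¹)) (hc c 1)
  have h2 := DFunLike.congr_fun h1 u
  refine Eq.trans ?_ (h2.symm.trans ?_)
  · exact mfderiv_point_congr (E := E) (fun x : G => b * x * b⁻¹) (by simp) _
  · exact mfderiv_fun_congr (E := E) (by ext x; simp [mul_assoc]) 1 u

omit [LieGroup 𝓘(ℝ, E) ∞ G] in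
theorem Ad_one (u : GroupLieAlgebra 𝓘(ℝ, E) G) : Ad E (1 : G) u = u := by
  have h : (fun x : G => 1 * x * 1⁻¹) = id := by ext x; simp
  refine (mfderiv_fun_congr (E := E) h 1 u).trans ?_
  rw [mfderiv_id]; rfl

theorem Ad_inv_Ad (b : G) (u : GroupLieAlgebra 𝓘(ℝ, E) G) : Ad E b⁻¹ (Ad E b u) = u := by
  rw [Ad_mul, inv_mul_cancel, Ad_one]

theorem Ad_Ad_inv (b : G) (u : GroupLieAlgebra 𝓘(ℝ, E) G) : Ad E b (Ad E b⁻¹ u) = u := by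
  rw [Ad_mul, mul_inv_cancel, Ad_one]

end Homogeneous

/-! ### Consequences of the invariance of the Poisson structure -/

section Invariant
variable {E : Type*} [NormedAddCommGroup E] [NormedSpace ℝ E]
  {G : Type*} [TopologicalSpace G] [ChartedSpace E G] [Group G] [LieGroup 𝓘(ℝ, E) ∞ G]
  {F : Type*} [NormedAddCommGroup F] [NormedSpace ℝ F]
  {H : Subgroup G} [ChartedSpace F (G ⧸ H)] {π : PoissonStructure F (G ⧸ H)}

omit [LieGroup 𝓘(ℝ, E) ∞ G] in
theorem charDist_congr {x y : G ⧸ H} (h : x = y) {v : TangentSpace 𝓘(ℝ, F) x}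
    {w : TangentSpace 𝓘(ℝ, F) y} (hvw : (v : F) = w) :
    v ∈ π.charDist x ↔ w ∈ π.charDist y := by
  subst h
  have hvw : v = w := hvw
  rw [hvw]

theorem mfderiv_smul_mem_charDist (hp : IsSubmersion 𝓘(ℝ, E) 𝓘(ℝ, F) ∞ (proj H))
    (hπ : IsInvariant π) (g : G) (x : G ⧸ H) (v : TangentSpace 𝓘(ℝ, F) x) :
    mfderiv 𝓘(ℝ, F) 𝓘(ℝ, F) (fun y : G ⧸ H => g • y) x v ∈ π.charDist (g • x) ↔
      v ∈ π.charDist x := by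
  constructor
  · rintro ⟨α, hα⟩
    rw [hπ g x α] at hα
    exact ⟨_, mfderiv_smul_injective hp g x hα⟩
  · rintro ⟨α, rfl⟩
    -- The inverse of Tλ_g at x, retyped so as to end at x instead of g⁻¹ • g • x; pulling α back
    -- along it undoes the pullback in the invariance formula.
    let D : TangentSpace 𝓘(ℝ, F) (g • x) →ₗ[ℝ] TangentSpace 𝓘(ℝ, F) x :=
      { toFun := fun v => (mfderiv 𝓘(ℝ, F) 𝓘(ℝ, F) (fun y : G ⧸ H => g⁻¹ • y) (g • x) v : F)
        map_add' := map_add (mfderiv 𝓘(ℝ, F) 𝓘(ℝ, F) (fun y : G ⧸ H => g⁻¹ • y) (g • x))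
        map_smul' := map_smul (mfderiv 𝓘(ℝ, F) 𝓘(ℝ, F) (fun y : G ⧸ H => g⁻¹ • y) (g • x)) }
    refine ⟨α ∘ₗ D, ?_⟩
    rw [hπ g x]
    congr 2
    ext v
    exact congrArg α (mfderiv_inv_smul_smul hp g x v)

omit [LieGroup 𝓘(ℝ, E) ∞ G] in
theorem lieSub_le_aLie (hp : IsSubmersion 𝓘(ℝ, E) 𝓘(ℝ, F) ∞ (proj H)) :
    lieSub E H ≤ aLie hp π := by
  intro u hu
  rw [aLie, Submodule.mem_comap]
  have : (lieSub E H).mkQ u = 0 := (Submodule.Quotient.mk_eq_zero _).2 hu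
  rw [this]
  exact zero_mem _

omit [LieGroup 𝓘(ℝ, E) ∞ G] in
theorem Phi_rSharp (hp : IsSubmersion 𝓘(ℝ, E) 𝓘(ℝ, F) ∞ (proj H))
    (η : Module.Dual ℝ (GroupLieAlgebra 𝓘(ℝ, E) G ⧸ lieSub E H)) :
    PhiEquiv hp (rSharp hp π η) = π.sharp (proj H 1) (η ∘ₗ (PhiEquiv hp).symm.toLinearMap) :=
  (PhiEquiv hp).apply_symm_apply _

omit [LieGroup 𝓘(ℝ, E) ∞ G] in
theorem PhiEquiv_mk (hp : IsSubmersion 𝓘(ℝ, E) 𝓘(ℝ, F) ∞ (proj H))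
    (u : GroupLieAlgebra 𝓘(ℝ, E) G) :
    PhiEquiv hp ((lieSub E H).mkQ u) = Tp E F H u := rfl

omit [LieGroup 𝓘(ℝ, E) ∞ G] in
theorem mem_aLie_iff (hp : IsSubmersion 𝓘(ℝ, E) 𝓘(ℝ, F) ∞ (proj H))
    (u : GroupLieAlgebra 𝓘(ℝ, E) G) :
    u ∈ aLie hp π ↔ Tp E F H u ∈ π.charDist (proj H 1) := by
  rw [aLie, Submodule.mem_comap]
  constructor
  · rintro ⟨η, hη⟩
    refine ⟨η ∘ₗ (PhiEquiv hp).symm.toLinearMap, ?_⟩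
    rw [← Phi_rSharp, hη, PhiEquiv_mk]
  · rintro ⟨α, hα⟩
    refine ⟨α ∘ₗ (PhiEquiv hp).toLinearMap, ?_⟩
    apply (PhiEquiv hp).injective
    rw [Phi_rSharp, PhiEquiv_mk, ← hα]
    congr 1
    ext v
    simp

/-- At the identity this is the definition of 𝔞_r read through 𝔤/𝔥 ≅ T_ē(G/H); invariance moves it
to g. It converts tangency to E into a condition in 𝔤. -/
theorem dproj_mem_charDist (hp : IsSubmersion 𝓘(ℝ, E) 𝓘(ℝ, F) ∞ (proj H))
    (hπ : IsInvariant π) (g : G) (u : GroupLieAlgebra 𝓘(ℝ, E) G) :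
    dproj F H g u ∈ π.charDist (proj H g) ↔ u ∈ aLie hp π := by
  rw [mem_aLie_iff, ← mfderiv_smul_mem_charDist hp hπ g (proj H 1) (Tp E F H u)]
  have h : g • proj H 1 = proj H g := congrArg (proj H) (mul_one g)
  exact charDist_congr h.symm (mfderiv_smul_Tp hp g u).symm

theorem map_dproj_aLie (hp : IsSubmersion 𝓘(ℝ, E) 𝓘(ℝ, F) ∞ (proj H))
    (hπ : IsInvariant π) (g : G) :
    (aLie hp π).map (dproj F H g) = π.charDist (proj H g) := by
  ext v
  constructor
  · rintro ⟨u, hu, rfl⟩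
    exact (dproj_mem_charDist hp hπ g u).2 hu
  · intro hv
    obtain ⟨u, rfl⟩ := dproj_surjective hp g v
    exact ⟨u, (dproj_mem_charDist hp hπ g u).1 hv, rfl⟩

/-- Since bH = H, the vector Ad_b u at e and the vector u at b have the same image in T_ē(G/H), and
membership in 𝔞_r can be tested at either point. -/
theorem Ad_mem_aLie (hp : IsSubmersion 𝓘(ℝ, E) 𝓘(ℝ, F) ∞ (proj H))
    (hπ : IsInvariant π) {b : G} (hb : b ∈ H) {u : GroupLieAlgebra 𝓘(ℝ, E) G}
    (hu : u ∈ aLie hp π) : Ad E b u ∈ aLie hp π := by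
  rw [← dproj_mem_charDist hp hπ 1]
  have h1 := dproj_Ad hp 1 hb u
  have h2 := (dproj_mem_charDist hp hπ (1 * b) u).2 hu
  have h3 : proj H (1 * b) = proj H 1 := QuotientGroup.eq.2 (by simpa using H.inv_mem hb)
  exact (charDist_congr h3 h1.symm).1 h2

theorem map_Ad_aLie (hp : IsSubmersion 𝓘(ℝ, E) 𝓘(ℝ, F) ∞ (proj H))
    (hπ : IsInvariant π) {b : G} (hb : b ∈ H) :
    (aLie hp π).map (Ad E b) = aLie hp π := by
  ext u
  constructor
  · rintro ⟨v, hv, rfl⟩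
    exact Ad_mem_aLie hp hπ hb hv
  · intro hu
    exact ⟨Ad E b⁻¹ u, Ad_mem_aLie hp hπ (H.inv_mem hb) hu, Ad_Ad_inv b u⟩

end Invariant

/-! ### Hamiltonian frames of the characteristic distribution -/

section Frames
variable {F : Type*} [NormedAddCommGroup F] [NormedSpace ℝ F] [FiniteDimensional ℝ F]
  {M : Type*} [TopologicalSpace M] [ChartedSpace F M] [IsManifold 𝓘(ℝ, F) ∞ M] [T2Space M]
  (π : PoissonStructure F M)

/-- The derivative of g along the Hamiltonian field of f is {f, g}, which is smooth by assumption.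
-/
theorem contMDiffAt_hamiltonian {f : M → ℝ} (hf : ContMDiff 𝓘(ℝ, F) 𝓘(ℝ, ℝ) ∞ f) (x : M) :
    ContMDiffAt 𝓘(ℝ, F) 𝓘(ℝ, F).tangent ∞
      (fun y => (⟨y, π.sharp y (covector F f y)⟩ : TangentBundle 𝓘(ℝ, F) M)) x :=
  contMDiffAt_field_of_covector fun g hg => (π.smooth f g hf hg).contMDiffAt

/-- Where the rank of a Poisson structure is constant, Hamiltonian vector fields of global functions
form local frames of the characteristic distribution. -/
theorem exists_hamiltonian_frame {k : ℕ} (hk : ∀ x, Module.finrank ℝ (π.charDist x) = k) (x₀ : M) :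
    ∃ f : Fin k → M → ℝ, (∀ i, ContMDiff 𝓘(ℝ, F) 𝓘(ℝ, ℝ) ∞ (f i)) ∧
      ∀ᶠ y in 𝓝 x₀, LinearIndependent ℝ (fun i => π.sharp y (covector F (f i) y)) ∧
        Submodule.span ℝ (Set.range fun i => π.sharp y (covector F (f i) y)) = π.charDist y := by
  have : ∀ x : M, FiniteDimensional ℝ (TangentSpace 𝓘(ℝ, F) x) := fun x =>
    inferInstanceAs (FiniteDimensional ℝ F)
  let b := Module.finBasisOfFinrankEq ℝ (π.charDist x₀) (hk x₀)
  have hb : ∀ i, ∃ α, π.sharp x₀ α = b i := fun i => (b i).2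
  choose α hα using hb
  choose f hf hfα using fun i => exists_function_covector_eq x₀ (α i)
  refine ⟨f, hf, ?_⟩
  let Y : M → Fin k → F := fun y i => (trivializationAt F (TangentSpace 𝓘(ℝ, F)) x₀
    (⟨y, π.sharp y (covector F (f i) y)⟩ : TangentBundle 𝓘(ℝ, F) M)).2
  have hY : ContinuousAt Y x₀ := by
    refine continuousAt_pi.2 fun i => ?_
    exact ((Bundle.contMDiffAt_section _).1 (contMDiffAt_hamiltonian π (hf i) x₀)).continuousAt
  have hY0 : LinearIndependent ℝ (Y x₀) := by
    have h1 : Y x₀ = fun i => ((b i : TangentSpace 𝓘(ℝ, F) x₀) : F) := by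
      funext i
      exact (trivializationAt_fst_snd x₀ _).trans (by rw [hfα, hα])
    rw [h1]
    exact b.linearIndependent.map' (π.charDist x₀).subtype (Submodule.ker_subtype _)
  -- Linear independence is an open condition; constant rank then upgrades independence to spanning
  -- by a dimension count.
  have hind : ∀ᶠ y in 𝓝 x₀, LinearIndependent ℝ (Y y) :=
    hY.preimage_mem_nhds (isOpen_setOfPred_linearIndependent.mem_nhds hY0)
  filter_upwards [hind, (chartAt F x₀).open_source.mem_nhds (mem_chart_source F x₀)] with y hy hys
  have hli : LinearIndependent ℝ (fun i => π.sharp y (covector F (f i) y)) := by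
    let D : TangentSpace 𝓘(ℝ, F) y →ₗ[ℝ] F :=
      (mfderiv 𝓘(ℝ, F) 𝓘(ℝ, F) (extChartAt 𝓘(ℝ, F) x₀) y).toLinearMap
    refine LinearIndependent.of_comp D ?_
    have h2 : D ∘ (fun i => π.sharp y (covector F (f i) y)) = Y y := by
      funext i
      exact (trivializationAt_snd hys _).symm
    rw [h2]
    exact hy
  refine ⟨hli, ?_⟩
  refine Submodule.eq_of_le_of_finrank_eq ?_ ?_
  · rw [Submodule.span_le]
    rintro _ ⟨i, rfl⟩
    exact ⟨_, rfl⟩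
  · rw [finrank_span_eq_card hli, hk, Fintype.card_fin]

theorem isSmoothSubbundle_of_finrank_eq {k : ℕ} (hk : ∀ x, Module.finrank ℝ (π.charDist x) = k) :
    IsSmoothSubbundle π.charDist := by
  intro x
  obtain ⟨f, hf, hev⟩ := exists_hamiltonian_frame π hk x
  obtain ⟨U, hU, hUo, hx⟩ := eventually_nhds_iff.1 hev
  exact ⟨U, hUo, hx, k, fun i y => π.sharp y (covector F (f i) y),
    fun i y _ => (contMDiffAt_hamiltonian π (hf i) y).contMDiffWithinAt, fun y hy => hU y hy⟩

end Frames

/-! ### The isomorphism from the associated bundle onto E -/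

section Bundle
variable {E : Type*} [NormedAddCommGroup E] [NormedSpace ℝ E]
  {G : Type*} [TopologicalSpace G] [ChartedSpace E G] [Group G] [LieGroup 𝓘(ℝ, E) ∞ G]
  {F : Type*} [NormedAddCommGroup F] [NormedSpace ℝ F]
  {H : Subgroup G} [ChartedSpace F (G ⧸ H)] {π : PoissonStructure F (G ⧸ H)}

theorem finrank_charDist (hp : IsSubmersion 𝓘(ℝ, E) 𝓘(ℝ, F) ∞ (proj H))
    (hπ : IsInvariant π) (x : G ⧸ H) :
    Module.finrank ℝ (π.charDist x) = Module.finrank ℝ (π.charDist (proj H 1)) := by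
  obtain ⟨g, rfl⟩ := proj_surjective x
  let D : TangentSpace 𝓘(ℝ, F) (proj H 1) →ₗ[ℝ] TangentSpace 𝓘(ℝ, F) (g • proj H 1) :=
    (mfderiv 𝓘(ℝ, F) 𝓘(ℝ, F) (fun y : G ⧸ H => g • y) (proj H 1)).toLinearMap
  have hD : Function.Injective D := mfderiv_smul_injective hp g (proj H 1)
  have h1 : (π.charDist (proj H 1)).map D = π.charDist (g • proj H 1) := by
    ext v
    constructor
    · rintro ⟨w, hw, rfl⟩
      exact (mfderiv_smul_mem_charDist hp hπ g _ w).2 hw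
    · intro hv
      have h2 : D (mfderiv 𝓘(ℝ, F) 𝓘(ℝ, F) (fun y : G ⧸ H => g⁻¹ • y) (g • proj H 1) v : F) = v :=
        mfderiv_smul_inv_smul hp g (proj H 1) v
      rw [← h2] at hv
      exact ⟨_, (mfderiv_smul_mem_charDist hp hπ g (proj H 1) _).1 hv, h2⟩
  have h2 : g • proj H 1 = proj H g := congrArg (proj H) (mul_one g)
  rw [← h2, ← h1]
  exact (Submodule.equivMapOfInjective D hD _).finrank_eq.symm

omit [LieGroup 𝓘(ℝ, E) ∞ G] [Group G] [ChartedSpace E G] [TopologicalSpace G] in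
theorem tangentBundle_ext {M : Type*} [TopologicalSpace M] [ChartedSpace F M] {x y : M}
    (h : x = y) {v : TangentSpace 𝓘(ℝ, F) x} {w : TangentSpace 𝓘(ℝ, F) y} (hvw : (v : F) = w) :
    (⟨x, v⟩ : TangentBundle 𝓘(ℝ, F) M) = ⟨y, w⟩ := by
  subst h
  have hvw : v = w := hvw
  rw [hvw]

/-- The fibre map `𝔞/𝔥 → T(G/H)` at `gH`, `u + 𝔥 ↦ T p (T L_g u)`. -/
def fibreMap (hp : IsSubmersion 𝓘(ℝ, E) 𝓘(ℝ, F) ∞ (proj H))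
    (a : Submodule ℝ (GroupLieAlgebra 𝓘(ℝ, E) G)) (g : G) :
    Fibre H a →ₗ[ℝ] TangentSpace 𝓘(ℝ, F) (proj H g) :=
  ((lieSub E H).submoduleOf a).liftQ (dproj F H g ∘ₗ a.subtype) (fun _ hu =>
    (dproj_eq_zero_iff hp g _).2 hu)

/-- The map `[g, u + 𝔥] ↦ T λ_g (T_e p u)` on `G ×_H (𝔞_r/𝔥)`. -/
def bundleMap (hp : IsSubmersion 𝓘(ℝ, E) 𝓘(ℝ, F) ∞ (proj H))
    (a : Submodule ℝ (GroupLieAlgebra 𝓘(ℝ, E) G)) :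
    AssocBundle H a → TangentBundle 𝓘(ℝ, F) (G ⧸ H) :=
  Quot.lift (fun x => ⟨proj H x.1, fibreMap hp a x.1 x.2⟩) (by
    rintro ⟨g, v⟩ y ⟨b, hb, u, u', hu, hx, rfl⟩
    have hx : v = Submodule.Quotient.mk u := hx
    subst hx
    refine tangentBundle_ext (QuotientGroup.eq.2 (by simpa using hb)) ?_
    -- Well-definedness: D_{gb}(Ad_{b⁻¹} u) = D_g u.
    refine Eq.symm ((congrArg (dproj F H (g * b)) hu).trans ?_)
    refine (dproj_Ad hp (g * b) (H.inv_mem hb) u).trans ?_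
    rw [mul_inv_cancel_right]
    rfl)

theorem bundleMap_mk (hp : IsSubmersion 𝓘(ℝ, E) 𝓘(ℝ, F) ∞ (proj H))
    (a : Submodule ℝ (GroupLieAlgebra 𝓘(ℝ, E) G)) (g : G) (u : a) :
    bundleMap hp a (AssocBundle.mk g (Submodule.Quotient.mk u)) =
      ⟨proj H g, dproj F H g (u : GroupLieAlgebra 𝓘(ℝ, E) G)⟩ := rfl

omit [LieGroup 𝓘(ℝ, E) ∞ G] in
theorem AssocBundle.ind {a : Submodule ℝ (GroupLieAlgebra 𝓘(ℝ, E) G)}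
    {P : AssocBundle H a → Prop} (h : ∀ g (u : a), P (AssocBundle.mk g (Submodule.Quotient.mk u)))
    (w : AssocBundle H a) : P w := by
  obtain ⟨⟨g, v⟩, rfl⟩ := Quot.exists_rep w
  obtain ⟨u, rfl⟩ := Submodule.Quotient.mk_surjective _ v
  exact h g u

theorem bundleMap_injective (hp : IsSubmersion 𝓘(ℝ, E) 𝓘(ℝ, F) ∞ (proj H))
    (hπ : IsInvariant π) : Function.Injective (bundleMap hp (aLie hp π)) := by
  intro w w'
  induction w using AssocBundle.ind with | _ g u
  induction w' using AssocBundle.ind with | _ g' u'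
  intro h
  rw [bundleMap_mk, bundleMap_mk] at h
  have h1 : proj H g = proj H g' := congrArg Bundle.TotalSpace.proj h
  have h2 : (dproj F H g (u : GroupLieAlgebra 𝓘(ℝ, E) G) : F) =
      dproj F H g' (u' : GroupLieAlgebra 𝓘(ℝ, E) G) :=
    congrArg (fun w : TangentBundle 𝓘(ℝ, F) (G ⧸ H) => (show F from w.2)) h
  have hb : g⁻¹ * g' ∈ H := QuotientGroup.eq.1 h1
  -- Take b = g⁻¹g'. The class of u is represented by Ad_b u' instead of u, which is legitimate
  -- because D_g sends both to the same vector and so they differ by an element of 𝔥.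
  refine Quot.sound ⟨g⁻¹ * g', hb, ⟨_, Ad_mem_aLie hp hπ hb u'.2⟩, u', ?_, ?_, ?_⟩
  · exact (Ad_inv_Ad _ _).symm
  · refine (Submodule.Quotient.eq _).2 ?_
    refine (dproj_eq_zero_iff hp g _).1 ?_
    have h3 : (dproj F H g (Ad E (g⁻¹ * g') (u' : GroupLieAlgebra 𝓘(ℝ, E) G)) : F) =
        dproj F H g' (u' : GroupLieAlgebra 𝓘(ℝ, E) G) := by
      refine (dproj_Ad hp g hb u').trans ?_
      rw [mul_inv_cancel_left]
    refine (map_sub (dproj F H g) (u : GroupLieAlgebra 𝓘(ℝ, E) G) _).trans ?_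
    rw [sub_eq_zero]
    exact h2.trans h3.symm
  · simp

theorem range_bundleMap (hp : IsSubmersion 𝓘(ℝ, E) 𝓘(ℝ, F) ∞ (proj H))
    (hπ : IsInvariant π) : Set.range (bundleMap hp (aLie hp π)) = totalSet π.charDist := by
  ext w
  constructor
  · rintro ⟨w, rfl⟩
    induction w using AssocBundle.ind with | _ g u
    exact (dproj_mem_charDist hp hπ g u).2 u.2
  · obtain ⟨x, v⟩ := w
    intro hv
    obtain ⟨g, rfl⟩ := proj_surjective x
    have hv : v ∈ π.charDist (proj H g) := hv
    rw [← map_dproj_aLie hp hπ] at hv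
    obtain ⟨u, hu, rfl⟩ := hv
    exact ⟨AssocBundle.mk g (Submodule.Quotient.mk ⟨u, hu⟩), rfl⟩

variable [FiniteDimensional ℝ F] [IsManifold 𝓘(ℝ, F) ∞ (G ⧸ H)]

omit [FiniteDimensional ℝ F] in
-- A linear section of 𝔞 → 𝔞/𝔥 lifts the fibre coordinate to 𝔤, after which the map is Tp applied to
-- left-invariant vectors.
theorem contMDiff_bundleMap (hp : IsSubmersion 𝓘(ℝ, E) 𝓘(ℝ, F) ∞ (proj H))
    (a : Submodule ℝ (GroupLieAlgebra 𝓘(ℝ, E) G)) {k : ℕ} (c : (Fin k → ℝ) ≃ₗ[ℝ] Fibre H a) :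
    ContMDiff (𝓘(ℝ, E).prod 𝓘(ℝ, Fin k → ℝ)) 𝓘(ℝ, F).tangent ∞
      (fun z : G × (Fin k → ℝ) => bundleMap hp a (AssocBundle.mk z.1 (c z.2))) := by
  obtain ⟨S, hS⟩ := ((lieSub E H).submoduleOf a).mkQ.exists_rightInverse_of_surjective
    (LinearMap.range_eq_top.2 (Submodule.mkQ_surjective _))
  let L : (Fin k → ℝ) →ₗ[ℝ] E := a.subtype ∘ₗ S ∘ₗ c.toLinearMap
  have hL : ContMDiff 𝓘(ℝ, Fin k → ℝ) 𝓘(ℝ, E) ∞ L :=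
    (LinearMap.toContinuousLinearMap L).contMDiff
  have h1 : ContMDiff (𝓘(ℝ, E).prod 𝓘(ℝ, Fin k → ℝ)) (𝓘(ℝ, E).prod 𝓘(ℝ, E)) ∞
      (fun z : G × (Fin k → ℝ) => (z.1, L z.2)) :=
    contMDiff_fst.prodMk (hL.comp contMDiff_snd)
  refine (((contMDiff_proj hp).contMDiff_tangentMap (m := ∞) le_rfl).comp
    (contMDiff_mulInvariantVectorField_uncurried.comp h1)).congr fun z => ?_
  have h2 : c z.2 = Submodule.Quotient.mk (S (c z.2)) := (DFunLike.congr_fun hS (c z.2)).symm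
  rw [h2, bundleMap_mk]
  rfl

/-- With σ a local section of p, translate a vector at x back to the base point by σ(x)⁻¹ and read
its coordinates there. -/
theorem bundleMap_smooth_inv (hp : IsSubmersion 𝓘(ℝ, E) 𝓘(ℝ, F) ∞ (proj H))
    (hπ : IsInvariant π) {k : ℕ} (c : (Fin k → ℝ) ≃ₗ[ℝ] Fibre H (aLie hp π))
    (w : TangentBundle 𝓘(ℝ, F) (G ⧸ H)) :
    ∃ U : Set (TangentBundle 𝓘(ℝ, F) (G ⧸ H)), IsOpen U ∧ w ∈ U ∧
      ∃ s : TangentBundle 𝓘(ℝ, F) (G ⧸ H) → G × (Fin k → ℝ),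
        ContMDiffOn 𝓘(ℝ, F).tangent (𝓘(ℝ, E).prod 𝓘(ℝ, Fin k → ℝ)) ∞ s U ∧
        ∀ w' ∈ U ∩ totalSet π.charDist,
          bundleMap hp (aLie hp π) (AssocBundle.mk (s w').1 (c (s w').2)) = w' := by
  obtain ⟨g, hg⟩ := proj_surjective w.1
  obtain ⟨V, σ, hV, hgV, hσ, -, hsec⟩ := exists_local_section hp g
  let T : (Fin k → ℝ) →ₗ[ℝ] F := (fibreMap hp (aLie hp π) 1) ∘ₗ c.toLinearMap
  have hT : Function.Injective T := by
    have h1 : Function.Injective (fibreMap hp (aLie hp π) 1) :=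
      LinearMap.ker_eq_bot.1 (Submodule.ker_liftQ_eq_bot _ _ _ fun u hu =>
        (dproj_eq_zero_iff hp 1 _).1 hu)
    exact h1.comp c.injective
  -- The left inverse R is defined on all of T_ē(G/H), which provides the smooth extension of the
  -- inverse off E.
  obtain ⟨R, hR⟩ := LinearMap.exists_leftInverse_of_injective T (LinearMap.ker_eq_bot.2 hT)
  let K : TangentBundle 𝓘(ℝ, F) (G ⧸ H) → F := fun w' =>
    mfderiv 𝓘(ℝ, F) 𝓘(ℝ, F) (fun y : G ⧸ H => (σ w'.1)⁻¹ • y) w'.1 w'.2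
  let U : Set (TangentBundle 𝓘(ℝ, F) (G ⧸ H)) := Bundle.TotalSpace.proj ⁻¹' V
  have hU : IsOpen U := hV.preimage (FiberBundle.continuous_proj F (TangentSpace 𝓘(ℝ, F)))
  have hbase : ∀ x ∈ V, (σ x)⁻¹ • x = proj H 1 := by
    intro x hx
    exact (congrArg ((σ x)⁻¹ • ·) (hsec x hx)).symm.trans
      (congrArg (proj H) (inv_mul_cancel (σ x)))
  have hσU : ContMDiffOn 𝓘(ℝ, F).tangent 𝓘(ℝ, E) ∞
      (fun w' : TangentBundle 𝓘(ℝ, F) (G ⧸ H) => σ w'.1) U :=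
    hσ.comp (Bundle.contMDiff_proj (IB := 𝓘(ℝ, F)) (n := ∞)
      (TangentSpace 𝓘(ℝ, F) : G ⧸ H → Type _)).contMDiffOn fun _ h => h
  have hf : ContMDiff (𝓘(ℝ, E).prod 𝓘(ℝ, F)) 𝓘(ℝ, F) ∞
      (fun z : G × (G ⧸ H) => z.1⁻¹ • z.2) :=
    (contMDiff_homogeneous_smul hp).comp (contMDiff_fst.inv.prodMk contMDiff_snd)
  have hK : ContMDiffOn 𝓘(ℝ, F).tangent 𝓘(ℝ, F) ∞ K U := by
    intro w' hw'
    refine ContMDiffAt.contMDiffWithinAt ?_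
    refine contMDiffAt_snd_of_fst_const (M := G ⧸ H) (z := proj H 1) ?_
    have h1 := (contMDiff_partial_tangentMap hf).contMDiffAt.comp w'
      ((hσU.contMDiffAt (hU.mem_nhds hw')).prodMk (contMDiffAt_id (x := w')))
    refine h1.congr_of_eventuallyEq ?_
    filter_upwards [hU.mem_nhds hw'] with w'' hw''
    exact tangentBundle_ext (hbase w''.1 hw'').symm rfl
  refine ⟨U, hU, ?_, fun w' => (σ w'.1, R (K w')), ?_, ?_⟩
  · show w.1 ∈ V
    rw [← hg]; exact hgV
  · exact hσU.prodMk ((LinearMap.toContinuousLinearMap R).contMDiff.comp_contMDiffOn hK)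
  · rintro ⟨x, v⟩ ⟨hx, hv⟩
    have hx : x ∈ V := hx
    have hv : v ∈ π.charDist x := hv
    have key : ∀ g' : G, proj H g' = x → bundleMap hp (aLie hp π) (AssocBundle.mk g'
        (c (R (mfderiv 𝓘(ℝ, F) 𝓘(ℝ, F) (fun y : G ⧸ H => g'⁻¹ • y) x v : F)))) = ⟨x, v⟩ := by
      rintro g' rfl
      rw [← map_dproj_aLie hp hπ] at hv
      obtain ⟨u, hu, rfl⟩ := hv
      have h1 : (mfderiv 𝓘(ℝ, F) 𝓘(ℝ, F) (fun y : G ⧸ H => g'⁻¹ • y) (proj H g')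
          (dproj F H g' u) : F) = T (c.symm (Submodule.Quotient.mk ⟨u, hu⟩)) := by
        refine (dproj_mul hp g'⁻¹ g' u).trans ?_
        rw [inv_mul_cancel]
        exact (congrArg (fibreMap hp (aLie hp π) 1)
          (c.apply_symm_apply (Submodule.Quotient.mk ⟨u, hu⟩))).symm
      have h2 : R (mfderiv 𝓘(ℝ, F) 𝓘(ℝ, F) (fun y : G ⧸ H => g'⁻¹ • y) (proj H g')
          (dproj F H g' u) : F) = c.symm (Submodule.Quotient.mk ⟨u, hu⟩) :=
        (congrArg R h1).trans (DFunLike.congr_fun hR _)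
      rw [h2, c.apply_symm_apply, bundleMap_mk]
    exact key (σ x) (hsec x hx)

theorem isHomogeneousBundleIso_bundleMap (hp : IsSubmersion 𝓘(ℝ, E) 𝓘(ℝ, F) ∞ (proj H))
    (hπ : IsInvariant π) :
    IsHomogeneousBundleIso π.charDist (bundleMap hp (aLie hp π)) where
  injective := bundleMap_injective hp hπ
  range_eq := range_bundleMap hp hπ
  fibre_linear g := ⟨fibreMap hp (aLie hp π) g, fun _ => rfl⟩
  equivariant g w := by
    induction w using AssocBundle.ind with | _ g' u
    exact (tangentBundle_ext rfl (dproj_mul hp g g' _)).symm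
  smooth k c := contMDiff_bundleMap hp _ c
  smooth_inv k c w _ := bundleMap_smooth_inv hp hπ c w

omit [FiniteDimensional ℝ F] [IsManifold 𝓘(ℝ, F) ∞ (G ⧸ H)] in
theorem bundleMap_eq (hp : IsSubmersion 𝓘(ℝ, E) 𝓘(ℝ, F) ∞ (proj H))
    (a : Submodule ℝ (GroupLieAlgebra 𝓘(ℝ, E) G)) (g : G) (u : a) :
    bundleMap hp a (AssocBundle.mk g (Submodule.Quotient.mk u)) =
      ⟨g • proj H 1, mfderiv 𝓘(ℝ, F) 𝓘(ℝ, F) (fun x : G ⧸ H => g • x) (proj H 1)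
        (Tp E F H u)⟩ :=
  tangentBundle_ext (congrArg (proj H) (mul_one g)).symm (mfderiv_smul_Tp hp g _).symm

end Bundle

/-! ### Conjugation of the immersed subgroup -/

section Curves
variable {E : Type*} [NormedAddCommGroup E] [NormedSpace ℝ E]
  {G : Type*} [TopologicalSpace G] [ChartedSpace E G] [Group G] [LieGroup 𝓘(ℝ, E) ∞ G]
  {E' : Type*} [NormedAddCommGroup E'] [NormedSpace ℝ E']
  {A : Type*} [TopologicalSpace A] [ChartedSpace E' A] [Group A] [LieGroup 𝓘(ℝ, E') ∞ A]

theorem leftLog_hom_comp {f : A →* G} (hf : ContMDiff 𝓘(ℝ, E') 𝓘(ℝ, E) ∞ f) {γ : ℝ → A} {t : ℝ}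
    (hγ : MDifferentiableAt 𝓘(ℝ, ℝ) 𝓘(ℝ, E') γ t) :
    leftLog (f (γ t)) (mfderiv 𝓘(ℝ, ℝ) 𝓘(ℝ, E) (f ∘ γ) t (1 : ℝ)) =
      lieMap E' E f (leftLog (γ t) (mfderiv 𝓘(ℝ, ℝ) 𝓘(ℝ, E') γ t (1 : ℝ))) := by
  set v := mfderiv 𝓘(ℝ, ℝ) 𝓘(ℝ, E') γ t (1 : ℝ) with hv
  have h1 := mfderiv_comp (I' := 𝓘(ℝ, E')) t (hf.contMDiffAt.mdifferentiableAt (by simp)) hγ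
  have h2 : mfderiv 𝓘(ℝ, ℝ) 𝓘(ℝ, E) (f ∘ γ) t (1 : ℝ) =
      mfderiv 𝓘(ℝ, E') 𝓘(ℝ, E) f (γ t) v := DFunLike.congr_fun h1 (1 : ℝ)
  have h3 := mfderiv_translate_hom hf 1 (γ t) (leftLog (γ t) v)
  rw [mulInvariantVectorField_leftLog, one_mul] at h3
  have h4 : (mfderiv 𝓘(ℝ, E') 𝓘(ℝ, E) f (γ t) v : E) =
      mulInvariantVectorField (lieMap E' E f (leftLog (γ t) v)) (f (γ t)) :=
    (mfderiv_fun_congr (E := E') (show (f : A → G) = fun x => 1 * f x by ext x; simp)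
      (γ t) v).trans h3
  have h5 : mfderiv 𝓘(ℝ, ℝ) 𝓘(ℝ, E) (f ∘ γ) t (1 : ℝ) =
      mulInvariantVectorField (lieMap E' E f (leftLog (γ t) v)) (f (γ t)) := h2.trans h4
  refine (congrArg (leftLog (E := E) (f (γ t))) h5).trans ?_
  exact leftLog_mulInvariantVectorField _ _

theorem contMDiff_conj (h : G) :
    ContMDiff 𝓘(ℝ, E) 𝓘(ℝ, E) ∞ (fun x : G => h * x * h⁻¹) :=
  (contMDiff_mul_left (I := 𝓘(ℝ, E)) (n := ∞) (a := h)).mul contMDiff_const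

omit [LieGroup 𝓘(ℝ, E') ∞ A] in
theorem lieMap_conj_comp {ι : A →* G} (hι : ContMDiff 𝓘(ℝ, E') 𝓘(ℝ, E) ∞ ι) (h : G)
    (u : GroupLieAlgebra 𝓘(ℝ, E') A) :
    lieMap E' E ((MulAut.conj h).toMonoidHom.comp ι) u = Ad E h (lieMap E' E ι u) := by
  have h1 := mfderiv_comp (I' := 𝓘(ℝ, E)) (1 : A)
    ((contMDiff_conj (E := E) h).contMDiffAt.mdifferentiableAt (x := ι 1) (by simp))
    (hι.contMDiffAt.mdifferentiableAt (by simp))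
  refine (DFunLike.congr_fun h1 u).trans ?_
  exact mfderiv_point_congr (E := E) (fun x : G => h * x * h⁻¹) (map_one ι) _

/-- Conjugation by an element whose adjoint action preserves the Lie algebra of a connected
immersed subgroup preserves the subgroup. -/
theorem conj_mem_range_of_Ad [FiniteDimensional ℝ E] [FiniteDimensional ℝ E']
    {ι : A →* G} {a : Submodule ℝ (GroupLieAlgebra 𝓘(ℝ, E) G)}
    (hι : IsIntegralSubgroup (E := E) (E' := E') ι a) {h : G}
    (hh : ∀ u ∈ a, Ad E h u ∈ a) (x : A) : h * ι x * h⁻¹ ∈ ι.range := by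
  have := hι.connected
  have hinj : Function.Injective (lieMap E' E ι) := hι.immersion 1
  let f : A →* G := (MulAut.conj h).toMonoidHom.comp ι
  have hf : ContMDiff 𝓘(ℝ, E') 𝓘(ℝ, E) ∞ f := (contMDiff_conj h).comp hι.smooth
  have htr : ∀ {x y z : G}, x⁻¹ * y ∈ ι.range → y⁻¹ * z ∈ ι.range → x⁻¹ * z ∈ ι.range := by
    intro x y z hx hy
    have := ι.range.mul_mem hx hy
    rwa [mul_assoc, mul_inv_cancel_left] at this
  have hsy : ∀ {x y : G}, x⁻¹ * y ∈ ι.range → y⁻¹ * x ∈ ι.range := by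
    intro x y hx
    simpa using ι.range.inv_mem hx
  have key : ∀ x y : A, (f x)⁻¹ * f y ∈ ι.range := by
    have : Std.Symm (fun x y => (f x)⁻¹ * f y ∈ ι.range) := ⟨fun _ _ h₁ => hsy h₁⟩
    -- Lying in the same left coset of ι(A) is an equivalence relation, so local validity suffices:
    -- first on the connected space A, where nearby points are joined by a smooth curve, then along
    -- that curve, where the logarithmic derivative of its conjugate is Ad_h of an element of 𝔞.
    refine PreconnectedSpace.induction₂ (fun x y => (f x)⁻¹ * f y ∈ ι.range) (fun x => ?_)
      ⟨fun _ _ _ h₁ h₂ => htr h₁ h₂⟩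
    filter_upwards [exists_smooth_path (E := E') x] with y hy
    obtain ⟨γ, hγ, rfl, rfl⟩ := hy
    have : Std.Symm (fun s t : ℝ => (f (γ s))⁻¹ * f (γ t) ∈ ι.range) := ⟨fun _ _ h₁ => hsy h₁⟩
    refine PreconnectedSpace.induction₂ (fun s t : ℝ => (f (γ s))⁻¹ * f (γ t) ∈ ι.range)
      (fun s => ?_) ⟨fun _ _ _ h₁ h₂ => htr h₁ h₂⟩ 0 1
    have := eventually_mem_coset_of_leftLog_mem hι.smooth hinj (c := f ∘ γ) isOpen_univ
      (hf.comp hγ).contMDiffOn (fun t _ => ?_) (Set.mem_univ s)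
    · filter_upwards [this] with t ht
      obtain ⟨b, hb⟩ := ht
      exact ⟨b, by rw [← inv_mul_eq_iff_eq_mul.2 hb]; rfl⟩
    · refine (congrArg (· ∈ LinearMap.range (lieMap E' E ι))
        (leftLog_hom_comp hf (hγ.contMDiffAt.mdifferentiableAt (by simp)))).mpr ?_
      rw [hι.range_eq, lieMap_conj_comp hι.smooth]
      refine hh _ ?_
      rw [← hι.range_eq]
      exact ⟨_, rfl⟩
  simpa [f] using key 1 x

end Curves

/-! ### The leaves as sets -/

section Leaves
variable {E : Type*} [NormedAddCommGroup E] [NormedSpace ℝ E] [FiniteDimensional ℝ E]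
  {G : Type*} [TopologicalSpace G] [ChartedSpace E G] [Group G] [LieGroup 𝓘(ℝ, E) ∞ G]
  {F : Type*} [NormedAddCommGroup F] [NormedSpace ℝ F]
  {H : Subgroup G} [ChartedSpace F (G ⧸ H)] {π : PoissonStructure F (G ⧸ H)}
  {E' : Type*} [NormedAddCommGroup E'] [NormedSpace ℝ E'] [FiniteDimensional ℝ E']
  {A : Type*} [TopologicalSpace A] [ChartedSpace E' A] [Group A] [LieGroup 𝓘(ℝ, E') ∞ A]
  {ι : A →* G}

omit [FiniteDimensional ℝ E] [FiniteDimensional ℝ E'] [LieGroup 𝓘(ℝ, E') ∞ A] in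
theorem contMDiff_orbit (hp : IsSubmersion 𝓘(ℝ, E) 𝓘(ℝ, F) ∞ (proj H))
    (hι : ContMDiff 𝓘(ℝ, E') 𝓘(ℝ, E) ∞ ι) (g : G) :
    ContMDiff 𝓘(ℝ, E') 𝓘(ℝ, F) ∞ (fun a => proj H (g * ι a)) :=
  (contMDiff_proj hp).comp ((contMDiff_mul_left (I := 𝓘(ℝ, E)) (n := ∞)).comp hι)

omit [FiniteDimensional ℝ E] [FiniteDimensional ℝ E'] in
theorem mfderiv_orbit (hp : IsSubmersion 𝓘(ℝ, E) 𝓘(ℝ, F) ∞ (proj H))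
    (hι : ContMDiff 𝓘(ℝ, E') 𝓘(ℝ, E) ∞ ι) (g : G) (a : A)
    (u : GroupLieAlgebra 𝓘(ℝ, E') A) :
    mfderiv 𝓘(ℝ, E') 𝓘(ℝ, F) (fun a => proj H (g * ι a)) a (mulInvariantVectorField u a) =
      dproj F H (g * ι a) (lieMap E' E ι u) := by
  have h1 := mfderiv_comp (I' := 𝓘(ℝ, E)) a (mdifferentiableAt_proj hp (g * ι a))
    (((contMDiff_mul_left (I := 𝓘(ℝ, E)) (n := ∞) (a := g)).comp hι).contMDiffAt.mdifferentiableAt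
      (by simp))
  refine (DFunLike.congr_fun h1 _).trans ?_
  exact congrArg (mfderiv 𝓘(ℝ, E) 𝓘(ℝ, F) (proj H) (g * ι a)) (mfderiv_translate_hom hι g a u)

omit [FiniteDimensional ℝ E] [FiniteDimensional ℝ E'] in
theorem range_mfderiv_orbit (hp : IsSubmersion 𝓘(ℝ, E) 𝓘(ℝ, F) ∞ (proj H)) (hπ : IsInvariant π)
    (hι : IsIntegralSubgroup (E := E) (E' := E') ι (aLie hp π)) (g : G) (a : A) :
    LinearMap.range (mfderiv 𝓘(ℝ, E') 𝓘(ℝ, F) (fun a => proj H (g * ι a)) a).toLinearMap =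
      π.charDist (proj H (g * ι a)) := by
  rw [← map_dproj_aLie hp hπ, ← hι.range_eq]
  ext v
  constructor
  · rintro ⟨w, rfl⟩
    refine ⟨_, ⟨leftLog a w, rfl⟩, ?_⟩
    have h := mfderiv_orbit hp hι.smooth g a (leftLog a w)
    rw [mulInvariantVectorField_leftLog] at h
    exact h.symm
  · rintro ⟨_, ⟨u, rfl⟩, rfl⟩
    exact ⟨mulInvariantVectorField u a, mfderiv_orbit hp hι.smooth g a u⟩

omit [FiniteDimensional ℝ E] [FiniteDimensional ℝ E'] in
-- The orbit map sends every tangent vector of A into E, so it carries smooth curves in A to curves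
-- tangent to E; connectedness of A supplies chains of such curves.
theorem leafSetoid_orbit (hp : IsSubmersion 𝓘(ℝ, E) 𝓘(ℝ, F) ∞ (proj H)) (hπ : IsInvariant π)
    (hι : IsIntegralSubgroup (E := E) (E' := E') ι (aLie hp π)) (g : G) (a b : A) :
    leafSetoid π (proj H (g * ι a)) (proj H (g * ι b)) := by
  have := hι.connected
  have : Std.Symm (fun a b => leafSetoid π (proj H (g * ι a)) (proj H (g * ι b))) :=
    ⟨fun _ _ h₁ => (leafSetoid π).symm h₁⟩
  refine PreconnectedSpace.induction₂
    (fun a b => leafSetoid π (proj H (g * ι a)) (proj H (g * ι b))) (fun a => ?_)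
    ⟨fun _ _ _ h₁ h₂ => (leafSetoid π).trans h₁ h₂⟩ a b
  filter_upwards [exists_smooth_path (E := E') a] with b hb
  obtain ⟨γ, hγ, rfl, rfl⟩ := hb
  refine Relation.EqvGen.rel _ _ ⟨fun t => proj H (g * ι (γ t)),
    (contMDiff_orbit hp hι.smooth g).comp hγ, rfl, rfl, fun t => ?_⟩
  have h1 := mfderiv_comp (I' := 𝓘(ℝ, E')) t
    ((contMDiff_orbit hp hι.smooth g).contMDiffAt.mdifferentiableAt (x := γ t) (by simp))
    (hγ.contMDiffAt.mdifferentiableAt (by simp))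
  have h2 := DFunLike.congr_fun h1 (1 : ℝ)
  refine (charDist_congr rfl h2).2 ?_
  have h3 := range_mfderiv_orbit hp hπ hι g (γ t)
  exact h3.le ⟨_, rfl⟩

/-- Writing g' = gb with b ∈ H gives g'ι(a)H = g(bι(a)b⁻¹)H, and H normalises A because Ad(H)
preserves 𝔞_r. -/
theorem proj_mul_conj (hp : IsSubmersion 𝓘(ℝ, E) 𝓘(ℝ, F) ∞ (proj H)) (hπ : IsInvariant π)
    (hι : IsIntegralSubgroup (E := E) (E' := E') ι (aLie hp π)) {g g' : G}
    (h : proj H g = proj H g') (a : A) : ∃ b : A, proj H (g' * ι a) = proj H (g * ι b) := by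
  have hb : g⁻¹ * g' ∈ H := QuotientGroup.eq.1 h
  obtain ⟨b, hb'⟩ := conj_mem_range_of_Ad hι (fun u hu => Ad_mem_aLie hp hπ hb hu) a
  refine ⟨b, ?_⟩
  rw [hb']
  refine QuotientGroup.eq.2 ?_
  have : (g' * ι a)⁻¹ * (g * (g⁻¹ * g' * ι a * (g⁻¹ * g')⁻¹)) = (g⁻¹ * g')⁻¹ := by group
  rw [this]
  exact H.inv_mem hb

/-- For the inclusion of the leaf in gAH, lift an E-tangent curve by a local section of p: its
logarithmic derivative is in 𝔞_r, so the lift stays locally in a coset of A. -/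
theorem leafSetoid_iff (hp : IsSubmersion 𝓘(ℝ, E) 𝓘(ℝ, F) ∞ (proj H)) (hπ : IsInvariant π)
    (hι : IsIntegralSubgroup (E := E) (E' := E') ι (aLie hp π)) (g : G) (y : G ⧸ H) :
    leafSetoid π (proj H g) y ↔ ∃ a : A, proj H (g * ι a) = y := by
  constructor
  swap
  · rintro ⟨a, rfl⟩
    have := leafSetoid_orbit hp hπ hι g 1 a
    rwa [map_one, mul_one] at this
  -- Quantifying over all representatives makes R transitive by multiplication in A; that a single
  -- representative suffices is the normalisation of A by H.
  let R : G ⧸ H → G ⧸ H → Prop := fun x y => ∀ g, proj H g = x → ∃ a : A, proj H (g * ι a) = y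
  have hR : ∀ {g y}, (∃ a : A, proj H (g * ι a) = y) → R (proj H g) y := by
    rintro g _ ⟨a, rfl⟩ g' hg'
    obtain ⟨b, hb⟩ := proj_mul_conj hp hπ hι hg' a
    exact ⟨b, hb.symm⟩
  have htr : ∀ {x y z}, R x y → R y z → R x z := by
    rintro x y z h1 h2 g hg
    obtain ⟨a, ha⟩ := h1 g hg
    obtain ⟨b, hb⟩ := h2 _ ha
    exact ⟨a * b, by rw [map_mul, ← mul_assoc]; exact hb⟩
  have hsy : ∀ {x y}, R x y → R y x := by
    rintro x y h1
    obtain ⟨g, rfl⟩ := proj_surjective x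
    obtain ⟨a, rfl⟩ := h1 g rfl
    exact hR ⟨a⁻¹, by simp⟩
  have hstep : ∀ {x y}, LeafStep π x y → R x y := by
    rintro x y ⟨γ, hγ, rfl, rfl, htan⟩
    have : Std.Symm (fun s t : ℝ => R (γ s) (γ t)) := ⟨fun _ _ h₁ => hsy h₁⟩
    refine PreconnectedSpace.induction₂ (fun s t : ℝ => R (γ s) (γ t)) (fun s => ?_)
      ⟨fun _ _ _ h₁ h₂ => htr h₁ h₂⟩ 0 1
    obtain ⟨g, hg⟩ := proj_surjective (γ s)
    obtain ⟨V, σ, hV, hgV, hσ, -, hsec⟩ := exists_local_section hp g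
    have hJ : IsOpen (γ ⁻¹' V) := hV.preimage hγ.continuous
    have hs : s ∈ γ ⁻¹' V := by
      show γ s ∈ V
      rw [← hg]; exact hgV
    have hc : ContMDiffOn 𝓘(ℝ, ℝ) 𝓘(ℝ, E) ∞ (σ ∘ γ) (γ ⁻¹' V) :=
      hσ.comp hγ.contMDiffOn fun _ h => h
    have hev := eventually_mem_coset_of_leftLog_mem hι.smooth (hι.immersion 1) hJ hc
      (fun t ht => ?_) hs
    · filter_upwards [hev, hJ.mem_nhds hs] with t ht htV
      obtain ⟨a, ha⟩ := ht
      rw [← hsec _ hs]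
      refine hR ⟨a, ?_⟩
      rw [← hsec _ htV]
      exact congrArg (proj H) ha.symm
    · rw [hι.range_eq, ← dproj_mem_charDist hp hπ ((σ ∘ γ) t)]
      have hd : MDifferentiableAt 𝓘(ℝ, ℝ) 𝓘(ℝ, E) (σ ∘ γ) t :=
        (hc.contMDiffAt (hJ.mem_nhds ht)).mdifferentiableAt (by simp)
      have h1 := mfderiv_comp (I' := 𝓘(ℝ, E)) t (mdifferentiableAt_proj hp ((σ ∘ γ) t)) hd
      have h2 : (proj H ∘ (σ ∘ γ)) =ᶠ[𝓝 t] γ := by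
        filter_upwards [hJ.mem_nhds ht] with t' ht'
        exact hsec _ ht'
      refine (charDist_congr (hsec _ ht) ?_).2 (htan t)
      refine (dproj_leftLog _ _).trans ?_
      refine (DFunLike.congr_fun h1 (1 : ℝ)).symm.trans ?_
      refine DFunLike.congr_fun (?_ : (mfderiv 𝓘(ℝ, ℝ) 𝓘(ℝ, F) (proj H ∘ (σ ∘ γ)) t : ℝ →L[ℝ] F) =
        mfderiv 𝓘(ℝ, ℝ) 𝓘(ℝ, F) γ t) (1 : ℝ)
      have h3 := ((hγ.contMDiffAt (x := t)).mdifferentiableAt (by simp)).hasMFDerivAt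
      exact (h3.congr_of_eventuallyEq h2).mfderiv
  intro h
  have hgen : ∀ {x y}, Relation.EqvGen (LeafStep π) x y → R x y := by
    intro x y hxy
    induction hxy with
    | rel _ _ h => exact hstep h
    | refl x =>
      obtain ⟨g, rfl⟩ := proj_surjective x
      exact hR ⟨1, by simp⟩
    | symm _ _ _ ih => exact hsy ih
    | trans _ _ _ _ _ ih₁ ih₂ => exact htr ih₁ ih₂
  exact hgen h g rfl

end Leaves

/-! ### Smooth inverse matrices and the Leibniz rule -/

section Matrices
variable {E : Type*} [NormedAddCommGroup E] [NormedSpace ℝ E]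
  {M : Type*} [TopologicalSpace M] [ChartedSpace E M] {n : Type*} [Fintype n] [DecidableEq n]

theorem contMDiffAt_det {B : M → Matrix n n ℝ} {x : M}
    (h : ∀ i j, ContMDiffAt 𝓘(ℝ, E) 𝓘(ℝ, ℝ) ∞ (fun y => B y i j) x) :
    ContMDiffAt 𝓘(ℝ, E) 𝓘(ℝ, ℝ) ∞ (fun y => (B y).det) x := by
  simp_rw [Matrix.det_apply']
  exact contMDiffAt_finsetSum fun σ _ => contMDiffAt_const.mul
    (contMDiffAt_finsetProd fun i _ => h _ _)

/-- Cramer's rule: each adjugate entry is the determinant of the matrix with one row made constant.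
-/
theorem contMDiffAt_inv_apply {B : M → Matrix n n ℝ} {x : M}
    (h : ∀ i j, ContMDiffAt 𝓘(ℝ, E) 𝓘(ℝ, ℝ) ∞ (fun y => B y i j) x) (hx : (B x).det ≠ 0)
    (i j : n) : ContMDiffAt 𝓘(ℝ, E) 𝓘(ℝ, ℝ) ∞ (fun y => (B y)⁻¹ i j) x := by
  simp_rw [Matrix.inv_def, Ring.inverse_eq_inv', Matrix.smul_apply, Matrix.adjugate_apply,
    smul_eq_mul]
  refine ((contMDiffAt_det h).inv₀ hx).mul (contMDiffAt_det fun k l => ?_)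
  by_cases hk : k = j
  · subst hk
    simp only [Matrix.updateRow_self]
    exact contMDiffAt_const
  · simp only [Matrix.updateRow_ne hk]
    exact h k l

theorem covector_sum_mul {ι : Type} (s : Finset ι) {p q : ι → M → ℝ} {x : M}
    (hp : ∀ i, MDifferentiableAt 𝓘(ℝ, E) 𝓘(ℝ, ℝ) (p i) x)
    (hq : ∀ i, MDifferentiableAt 𝓘(ℝ, E) 𝓘(ℝ, ℝ) (q i) x) (v : TangentSpace 𝓘(ℝ, E) x) :
    covector E (fun y => ∑ i ∈ s, p i y * q i y) x v =
      ∑ i ∈ s, (covector E (p i) x v * q i x + p i x * covector E (q i) x v) := by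
  let p' : ι → TangentSpace 𝓘(ℝ, E) x →L[ℝ] ℝ := fun i => mfderiv 𝓘(ℝ, E) 𝓘(ℝ, ℝ) (p i) x
  let q' : ι → TangentSpace 𝓘(ℝ, E) x →L[ℝ] ℝ := fun i => mfderiv 𝓘(ℝ, E) 𝓘(ℝ, ℝ) (q i) x
  have h : HasMFDerivAt 𝓘(ℝ, E) 𝓘(ℝ, ℝ) (∑ i ∈ s, p i * q i) x
      (∑ i ∈ s, (p i x • q' i + q i x • p' i)) :=
    HasMFDerivAt.sum fun i _ => HasMFDerivAt.mul (p' := p' i) (q' := q' i)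
      (hp i).hasMFDerivAt (hq i).hasMFDerivAt
  have h' : (fun y => ∑ i ∈ s, p i y * q i y) = ∑ i ∈ s, p i * q i := by
    ext y
    simp
  rw [h']
  refine (DFunLike.congr_fun h.mfderiv v).trans ?_
  refine (sum_apply _ _ _).trans (Finset.sum_congr rfl fun i _ => ?_)
  show p i x * covector E (q i) x v + q i x * covector E (p i) x v = _
  ring

end Matrices

/-! ### The leaf form is symplectic -/

section LeafForms
variable {F : Type*} [NormedAddCommGroup F] [NormedSpace ℝ F]
  {M : Type*} [TopologicalSpace M] [ChartedSpace F M]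
  {F' : Type*} [NormedAddCommGroup F'] [NormedSpace ℝ F']
  {L : Type*} [TopologicalSpace L] [ChartedSpace F' L]
  {π : PoissonStructure F M} {j : L → M} {σ : TwoTensor F' L}

/-- Lift Tj linearly through π_# to a map S into covectors and set σ(u, v) = S(v)(Tj u); skewness of
π gives the required values. S may be chosen pointwise, since the values of σ do not depend on it.
-/
theorem exists_isLeafForm
    (hj : ∀ l, LinearMap.range (mfderiv 𝓘(ℝ, F') 𝓘(ℝ, F) j l).toLinearMap ≤ π.charDist (j l)) :
    ∃ σ : TwoTensor F' L, IsLeafForm π j σ := by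
  have h : ∀ l, ∃ S : TangentSpace 𝓘(ℝ, F') l →ₗ[ℝ] Module.Dual ℝ (TangentSpace 𝓘(ℝ, F) (j l)),
      π.sharp (j l) ∘ₗ S = (mfderiv 𝓘(ℝ, F') 𝓘(ℝ, F) j l).toLinearMap := by
    intro l
    obtain ⟨S, hS⟩ := Module.projective_lifting_property (π.sharp (j l)).rangeRestrict
      ((mfderiv 𝓘(ℝ, F') 𝓘(ℝ, F) j l).toLinearMap.codRestrict (π.charDist (j l))
        fun v => hj l ⟨v, rfl⟩) (LinearMap.surjective_rangeRestrict _)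
    refine ⟨S, LinearMap.ext fun v => ?_⟩
    exact congrArg Subtype.val (DFunLike.congr_fun hS v)
  choose S hS using h
  refine ⟨fun l => ((mfderiv 𝓘(ℝ, F') 𝓘(ℝ, F) j l).toLinearMap.dualMap ∘ₗ S l).flip, ?_⟩
  intro l u v α β hu hv
  have h1 : π.sharp (j l) (S l v) = π.sharp (j l) β := (DFunLike.congr_fun (hS l) v).trans hv
  show S l v (mfderiv 𝓘(ℝ, F') 𝓘(ℝ, F) j l u) = _
  rw [hu, π.skew, h1, π.skew, neg_neg]

/-- Coordinates of smooth vector fields along a leaf in local Hamiltonian frames. -/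
theorem exists_hamiltonian_coordinates [FiniteDimensional ℝ F] [IsManifold 𝓘(ℝ, F) ∞ M]
    [T2Space M] [IsManifold 𝓘(ℝ, F') ∞ L] {k : ℕ}
    (hk : ∀ x, Module.finrank ℝ (π.charDist x) = k)
    (hj : ContMDiff 𝓘(ℝ, F') 𝓘(ℝ, F) ∞ j)
    (hint : ∀ l, LinearMap.range (mfderiv 𝓘(ℝ, F') 𝓘(ℝ, F) j l).toLinearMap ≤ π.charDist (j l))
    (l₀ : L) : ∃ f : Fin k → M → ℝ, (∀ i, ContMDiff 𝓘(ℝ, F) 𝓘(ℝ, ℝ) ∞ (f i)) ∧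
      ∀ X : ∀ l : L, TangentSpace 𝓘(ℝ, F') l, SmoothFieldOn X Set.univ →
        ∃ x : Fin k → L → ℝ, (∀ i, ContMDiffAt 𝓘(ℝ, F') 𝓘(ℝ, ℝ) ∞ (x i) l₀) ∧
          ∀ᶠ l in 𝓝 l₀, mfderiv 𝓘(ℝ, F') 𝓘(ℝ, F) j l (X l) =
            π.sharp (j l) (∑ i, x i l • covector F (f i) (j l)) := by
  obtain ⟨f, hf, hev⟩ := exists_hamiltonian_frame π hk (j l₀)
  refine ⟨f, hf, fun X hX => ?_⟩
  let B : L → Matrix (Fin k) (Fin k) ℝ := fun l => .of fun a b => bracketOf π.sharp (f a) (f b) (j l)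
  have hB : ∀ a b, ContMDiff 𝓘(ℝ, F') 𝓘(ℝ, ℝ) ∞ (fun l => B l a b) := fun a b =>
    (π.smooth _ _ (hf a) (hf b)).comp hj
  have hbr : ∀ (c : Fin k → ℝ) y b, covector F (f b) y (π.sharp y (∑ i, c i • covector F (f i) y)) =
      ∑ a, c a * bracketOf π.sharp (f a) (f b) y := by
    intro c y b
    simp [map_sum, bracketOf]
  have hev' := hj.continuous.continuousAt.eventually hev
  have hspan : ∀ {y}, Submodule.span ℝ (Set.range fun i => π.sharp y (covector F (f i) y)) =
      π.charDist y → ∀ w ∈ π.charDist y, ∃ c : Fin k → ℝ,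
        w = π.sharp y (∑ i, c i • covector F (f i) y) := by
    intro y hy w hw
    rw [← hy] at hw
    obtain ⟨c, hc⟩ := (Submodule.mem_span_range_iff_exists_fun ℝ).1 hw
    exact ⟨c, by simp [map_sum, ← hc]⟩
  -- A null vector c of the matrix {f_a, f_b} gives w = π_#(∑ c_i df_i) with df_b(w) = 0 for all b.
  -- By skewness and the frame property every covector then kills w, so w = 0, and independence of
  -- the frame forces c = 0.
  have hdet : ∀ᶠ l in 𝓝 l₀, (B l).det ≠ 0 := by
    filter_upwards [hev'] with l hl h0
    obtain ⟨c, hc, hcB⟩ := Matrix.exists_vecMul_eq_zero_iff.2 h0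
    have h1 : ∀ b, covector F (f b) (j l)
        (π.sharp (j l) (∑ i, c i • covector F (f i) (j l))) = 0 := fun b => by
      rw [hbr]
      exact congrFun hcB b
    have h2 : π.sharp (j l) (∑ i, c i • covector F (f i) (j l)) = 0 := by
      refine (Module.forall_dual_apply_eq_zero_iff ℝ _).1 fun β => ?_
      obtain ⟨d, hd⟩ := hspan hl.2 _ ⟨β, rfl⟩
      rw [π.skew, hd, π.skew, neg_neg]
      simp only [LinearMap.sum_apply, LinearMap.smul_apply, h1, smul_zero, Finset.sum_const_zero]
    refine hc (funext fun i => Fintype.linearIndependent_iff.1 hl.1 c ?_ i)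
    simpa [map_sum] using h2
  -- The coordinates x of X satisfy X(f_b ∘ j) = ∑ x_a {f_a, f_b}; inverting this system makes them
  -- smooth.
  let XF : L → Fin k → ℝ := fun l b => covector F' (f b ∘ j) l (X l)
  refine ⟨fun i l => Matrix.vecMul (XF l) (B l)⁻¹ i, fun i => ?_, ?_⟩
  · show ContMDiffAt 𝓘(ℝ, F') 𝓘(ℝ, ℝ) ∞ (fun l => ∑ b, XF l b * (B l)⁻¹ b i) l₀
    refine contMDiffAt_finsetSum fun b _ => ContMDiffAt.mul ?_ ?_
    · exact (contMDiff_covector_apply hX ((hf b).comp hj)).contMDiffAt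
    · exact contMDiffAt_inv_apply (fun a b => (hB a b).contMDiffAt) hdet.self_of_nhds _ _
  · filter_upwards [hev', hdet] with l hl hd
    obtain ⟨c, hc⟩ := hspan hl.2 _ (hint l ⟨X l, rfl⟩)
    have h1 : XF l = Matrix.vecMul c (B l) := by
      ext b
      have h2 := mfderiv_comp (I' := 𝓘(ℝ, F)) l
        ((hf b).contMDiffAt.mdifferentiableAt (x := j l) (by simp))
        (hj.contMDiffAt.mdifferentiableAt (by simp))
      refine (DFunLike.congr_fun h2 (X l)).trans ?_
      exact (congrArg (covector F (f b) (j l)) hc).trans (hbr c _ b)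
    refine hc.trans ?_
    rw [h1, Matrix.vecMul_vecMul, Matrix.mul_nonsing_inv _ (isUnit_iff_ne_zero.2 hd),
      Matrix.vecMul_one]

theorem covector_comp_apply {h : M → ℝ} {l : L}
    (hh : MDifferentiableAt 𝓘(ℝ, F) 𝓘(ℝ, ℝ) h (j l))
    (hj : MDifferentiableAt 𝓘(ℝ, F') 𝓘(ℝ, F) j l) (v : TangentSpace 𝓘(ℝ, F') l) :
    covector F' (fun l => h (j l)) l v =
      covector F h (j l) (mfderiv 𝓘(ℝ, F') 𝓘(ℝ, F) j l v) :=
  DFunLike.congr_fun (mfderiv_comp (I' := 𝓘(ℝ, F)) l hh hj) v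

/-- The leaf form evaluated in Hamiltonian coordinates of its second argument. -/
theorem IsLeafForm.apply_eq_sum (hσ : IsLeafForm π j σ) {k : ℕ} {f : Fin k → M → ℝ}
    (hf : ∀ i, ContMDiff 𝓘(ℝ, F) 𝓘(ℝ, ℝ) ∞ (f i)) (hj : ContMDiff 𝓘(ℝ, F') 𝓘(ℝ, F) ∞ j)
    {l : L} {v : TangentSpace 𝓘(ℝ, F') l}
    (hint : LinearMap.range (mfderiv 𝓘(ℝ, F') 𝓘(ℝ, F) j l).toLinearMap ≤ π.charDist (j l))
    {c : Fin k → ℝ} (hv : mfderiv 𝓘(ℝ, F') 𝓘(ℝ, F) j l v =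
      π.sharp (j l) (∑ i, c i • covector F (f i) (j l))) (u : TangentSpace 𝓘(ℝ, F') l) :
    σ l u v = ∑ i, c i * covector F' (fun l => f i (j l)) l u := by
  obtain ⟨α, hα⟩ := hint ⟨u, rfl⟩
  rw [hσ l u v α _ hα.symm hv, hα]
  simp only [LinearMap.sum_apply, LinearMap.smul_apply, smul_eq_mul]
  refine Finset.sum_congr rfl fun i _ => ?_
  rw [covector_comp_apply ((hf i).contMDiffAt.mdifferentiableAt (by simp))
    (hj.contMDiffAt.mdifferentiableAt (by simp))]
  rfl

theorem covector_comp_eq_sum {k : ℕ} {f : Fin k → M → ℝ} {h : M → ℝ}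
    (hh : ContMDiff 𝓘(ℝ, F) 𝓘(ℝ, ℝ) ∞ h) (hj : ContMDiff 𝓘(ℝ, F') 𝓘(ℝ, F) ∞ j)
    {l : L} {v : TangentSpace 𝓘(ℝ, F') l}
    {c : Fin k → ℝ} (hv : mfderiv 𝓘(ℝ, F') 𝓘(ℝ, F) j l v =
      π.sharp (j l) (∑ i, c i • covector F (f i) (j l))) :
    covector F' (fun l => h (j l)) l v = ∑ i, c i * bracketOf π.sharp (f i) h (j l) := by
  rw [covector_comp_apply (hh.contMDiffAt.mdifferentiableAt (by simp))
    (hj.contMDiffAt.mdifferentiableAt (by simp)), hv]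
  simp [map_sum, bracketOf]

/-- The term `X(σ(Y, Z)) - σ([X, Y], Z)` of the leaf form in Hamiltonian coordinates. -/
theorem IsLeafForm.dTerm_eq [FiniteDimensional ℝ F']
    [IsManifold 𝓘(ℝ, F') ∞ L] (hσ : IsLeafForm π j σ) {k : ℕ} {f : Fin k → M → ℝ}
    (hf : ∀ i, ContMDiff 𝓘(ℝ, F) 𝓘(ℝ, ℝ) ∞ (f i)) (hj : ContMDiff 𝓘(ℝ, F') 𝓘(ℝ, F) ∞ j)
    (hint : ∀ l, LinearMap.range (mfderiv 𝓘(ℝ, F') 𝓘(ℝ, F) j l).toLinearMap ≤ π.charDist (j l))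
    {l₀ : L} {X Y Z : ∀ l : L, TangentSpace 𝓘(ℝ, F') l}
    (hX : SmoothFieldOn X Set.univ) (hY : SmoothFieldOn Y Set.univ)
    {x y z : Fin k → L → ℝ} (hx : ∀ i, ContMDiffAt 𝓘(ℝ, F') 𝓘(ℝ, ℝ) ∞ (x i) l₀)
    (hz : ∀ i, ContMDiffAt 𝓘(ℝ, F') 𝓘(ℝ, ℝ) ∞ (z i) l₀)
    (hXx : ∀ᶠ l in 𝓝 l₀, mfderiv 𝓘(ℝ, F') 𝓘(ℝ, F) j l (X l) =
            π.sharp (j l) (∑ i, x i l • covector F (f i) (j l)))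
    (hYy : ∀ᶠ l in 𝓝 l₀, mfderiv 𝓘(ℝ, F') 𝓘(ℝ, F) j l (Y l) =
            π.sharp (j l) (∑ i, y i l • covector F (f i) (j l)))
    (hZz : ∀ᶠ l in 𝓝 l₀, mfderiv 𝓘(ℝ, F') 𝓘(ℝ, F) j l (Z l) =
            π.sharp (j l) (∑ i, z i l • covector F (f i) (j l))) :
    dTerm σ X Y Z l₀ =
      ∑ b, covector F' (z b) l₀ (X l₀) * covector F' (fun l => f b (j l)) l₀ (Y l₀) -
      ∑ b, covector F' (x b) l₀ (Y l₀) * covector F' (fun l => f b (j l)) l₀ (Z l₀) +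
      ∑ a, ∑ m, ∑ b, x a l₀ * y m l₀ * z b l₀ *
        bracketOf π.sharp (f m) (bracketOf π.sharp (f a) (f b)) (j l₀) := by
  have hF : ∀ b, ContMDiff 𝓘(ℝ, F') 𝓘(ℝ, ℝ) ∞ (fun l => f b (j l)) := fun b => (hf b).comp hj
  have : CompleteSpace F' := FiniteDimensional.complete ℝ F'
  have hbf : ∀ a b, ContMDiff 𝓘(ℝ, F) 𝓘(ℝ, ℝ) ∞ (bracketOf π.sharp (f a) (f b)) := fun a b =>
    π.smooth _ _ (hf a) (hf b)
  -- With F_b = f_b ∘ j, the function σ(Y, Z) is ∑ z_b Y(F_b). Differentiating it along X produces ∑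
  -- z_b X(Y F_b), which cancels against the same term of σ([X, Y], Z).
  have e1 : (fun l => σ l (Y l) (Z l)) =ᶠ[𝓝 l₀]
      fun l => ∑ b, z b l * covector F' (fun l => f b (j l)) l (Y l) := by
    filter_upwards [hZz] with l hl
    exact hσ.apply_eq_sum hf hj (hint l) hl _
  have e2 : ∀ b, (fun l => covector F' (fun l => f b (j l)) l (X l)) =ᶠ[𝓝 l₀]
      fun l => ∑ a, x a l * bracketOf π.sharp (f a) (f b) (j l) := by
    intro b
    filter_upwards [hXx] with l hl
    exact covector_comp_eq_sum (hf b) hj hl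
  have e3 := hσ.apply_eq_sum hf hj (hint l₀) hZz.self_of_nhds
    (VectorField.mlieBracket 𝓘(ℝ, F') X Y l₀)
  -- This absorbs the sum ∑ z_b {f_a, f_b} as -Z(F_a), which gives the first-derivative terms a
  -- shape that telescopes under cyclic permutation of X, Y, Z.
  have e4 : ∀ b, covector F' (fun l => f b (j l)) l₀ (Z l₀) =
      -∑ c, z c l₀ * bracketOf π.sharp (f b) (f c) (j l₀) := by
    intro b
    rw [covector_comp_eq_sum (hf b) hj hZz.self_of_nhds, ← Finset.sum_neg_distrib]
    refine Finset.sum_congr rfl fun c _ => ?_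
    rw [bracketOf, π.skew, bracketOf]
    ring
  unfold dTerm
  rw [e3, covector_congr e1, covector_sum_mul _
    (fun i => (hz i).mdifferentiableAt (by simp))
    (fun i => (contMDiff_covector_apply hY (hF i)).contMDiffAt.mdifferentiableAt (by simp))]
  have e5 : ∀ b, covector F' (fun l => f b (j l)) l₀ (VectorField.mlieBracket 𝓘(ℝ, F') X Y l₀) =
      covector F' (fun l => covector F' (fun l => f b (j l)) l (Y l)) l₀ (X l₀) -
      ∑ a, (covector F' (x a) l₀ (Y l₀) * bracketOf π.sharp (f a) (f b) (j l₀) +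
        x a l₀ * ∑ m, y m l₀ * bracketOf π.sharp (f m) (bracketOf π.sharp (f a) (f b)) (j l₀)) := by
    intro b
    rw [covector_mlieBracket hX hY (hF b), covector_congr (e2 b), covector_sum_mul _
      (q := fun a l => bracketOf π.sharp (f a) (f b) (j l))
      (fun i => (hx i).mdifferentiableAt (by simp))
      (fun i => ((hbf i b).comp hj).contMDiffAt.mdifferentiableAt (by simp))]
    refine congrArg _ (Finset.sum_congr rfl fun a _ => ?_)
    rw [covector_comp_eq_sum (hbf a b) hj hYy.self_of_nhds]
  simp only [e5, e4, mul_neg, Finset.sum_neg_distrib, sub_neg_eq_add, mul_sub, Finset.mul_sum,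
    mul_add, Finset.sum_add_distrib, Finset.sum_sub_distrib]
  have e6 : ∑ b, ∑ a, z b l₀ * (covector F' (x a) l₀ (Y l₀) *
        bracketOf π.sharp (f a) (f b) (j l₀)) =
      ∑ a, ∑ b, covector F' (x a) l₀ (Y l₀) * (z b l₀ *
        bracketOf π.sharp (f a) (f b) (j l₀)) := by
    rw [Finset.sum_comm]
    exact Finset.sum_congr rfl fun a _ => Finset.sum_congr rfl fun b _ => by ring
  have e7 : ∑ b, ∑ a, ∑ m, z b l₀ * (x a l₀ * (y m l₀ *
        bracketOf π.sharp (f m) (bracketOf π.sharp (f a) (f b)) (j l₀))) =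
      ∑ a, ∑ m, ∑ b, x a l₀ * y m l₀ * z b l₀ *
        bracketOf π.sharp (f m) (bracketOf π.sharp (f a) (f b)) (j l₀) := by
    rw [Finset.sum_comm]
    refine Finset.sum_congr rfl fun a _ => ?_
    rw [Finset.sum_comm]
    exact Finset.sum_congr rfl fun m _ => Finset.sum_congr rfl fun b _ => by ring
  rw [e6, e7]
  ring

theorem IsLeafForm.isSymplecticForm [FiniteDimensional ℝ F] [IsManifold 𝓘(ℝ, F) ∞ M]
    [T2Space M] [FiniteDimensional ℝ F'] [IsManifold 𝓘(ℝ, F') ∞ L] {k : ℕ}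
    (hσ : IsLeafForm π j σ) (hk : ∀ x, Module.finrank ℝ (π.charDist x) = k)
    (hj : ContMDiff 𝓘(ℝ, F') 𝓘(ℝ, F) ∞ j)
    (himm : ∀ l, Function.Injective (mfderiv 𝓘(ℝ, F') 𝓘(ℝ, F) j l))
    (hint : ∀ l, LinearMap.range (mfderiv 𝓘(ℝ, F') 𝓘(ℝ, F) j l).toLinearMap = π.charDist (j l)) :
    IsSymplecticForm σ where
  alternating l u := by
    obtain ⟨α, hα⟩ := (hint l).le ⟨u, rfl⟩
    rw [hσ l u u α α hα.symm hα.symm]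
    linarith [π.skew (j l) α α]
  nondegenerate l u h := by
    obtain ⟨α, hα⟩ := (hint l).le ⟨u, rfl⟩
    have h0 : π.sharp (j l) α = 0 := by
      refine (Module.forall_dual_apply_eq_zero_iff ℝ _).1 fun β => ?_
      obtain ⟨v, hv⟩ := (hint l).ge ⟨β, rfl⟩
      rw [← hσ l u v α β hα.symm hv, h]
    refine himm l ?_
    exact (hα.symm.trans h0).trans (map_zero (mfderiv 𝓘(ℝ, F') 𝓘(ℝ, F) j l)).symm
  smooth X Y hX hY l₀ := by
    obtain ⟨f, hf, hc⟩ := exists_hamiltonian_coordinates hk hj (fun l => (hint l).le) l₀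
    obtain ⟨y, hy, hYy⟩ := hc Y hY
    have h1 : ContMDiffAt 𝓘(ℝ, F') 𝓘(ℝ, ℝ) ∞
        (fun l => ∑ b, y b l * covector F' (fun l => f b (j l)) l (X l)) l₀ :=
      contMDiffAt_finsetSum fun b _ => (hy b).mul
        (contMDiff_covector_apply hX ((hf b).comp hj)).contMDiffAt
    refine h1.congr_of_eventuallyEq ?_
    filter_upwards [hYy] with l hl
    exact hσ.apply_eq_sum hf hj (hint l).le hl _
  closed X Y Z hX hY hZ l₀ := by
    obtain ⟨f, hf, hc⟩ := exists_hamiltonian_coordinates hk hj (fun l => (hint l).le) l₀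
    obtain ⟨x, hx, hXx⟩ := hc X hX
    obtain ⟨y, hy, hYy⟩ := hc Y hY
    obtain ⟨z, hz, hZz⟩ := hc Z hZ
    have hint' := fun l => (hint l).le
    rw [hσ.dTerm_eq hf hj hint' hX hY hx hz hXx hYy hZz,
      hσ.dTerm_eq hf hj hint' hY hZ hy hx hYy hZz hXx,
      hσ.dTerm_eq hf hj hint' hZ hX hz hy hZz hXx hYy]
    -- In the cyclic sum only the iterated brackets survive. After aligning the three orders of
    -- summation, each coefficient x_a y_m z_b multiplies a Jacobi sum.
    have hJ : (∑ a, ∑ m, ∑ b, x a l₀ * y m l₀ * z b l₀ *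
        bracketOf π.sharp (f m) (bracketOf π.sharp (f a) (f b)) (j l₀)) +
      (∑ m, ∑ b, ∑ a, y m l₀ * z b l₀ * x a l₀ *
        bracketOf π.sharp (f b) (bracketOf π.sharp (f m) (f a)) (j l₀)) +
      (∑ b, ∑ a, ∑ m, z b l₀ * x a l₀ * y m l₀ *
        bracketOf π.sharp (f a) (bracketOf π.sharp (f b) (f m)) (j l₀)) = 0 := by
      rw [Finset.sum_comm_cycle (s := Finset.univ (α := Fin k)) (t := Finset.univ)
        (u := Finset.univ) (f := fun m b a => y m l₀ * z b l₀ * x a l₀ *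
        bracketOf π.sharp (f b) (bracketOf π.sharp (f m) (f a)) (j l₀)),
        ← Finset.sum_comm_cycle (s := Finset.univ (α := Fin k)) (t := Finset.univ)
        (u := Finset.univ) (f := fun a m b => z b l₀ * x a l₀ * y m l₀ *
        bracketOf π.sharp (f a) (bracketOf π.sharp (f b) (f m)) (j l₀)),
        ← Finset.sum_add_distrib, ← Finset.sum_add_distrib]
      refine Finset.sum_eq_zero fun a _ => ?_
      rw [← Finset.sum_add_distrib, ← Finset.sum_add_distrib]
      refine Finset.sum_eq_zero fun m _ => ?_
      rw [← Finset.sum_add_distrib, ← Finset.sum_add_distrib]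
      refine Finset.sum_eq_zero fun b _ => ?_
      linear_combination x a l₀ * y m l₀ * z b l₀ *
        π.jacobi (f m) (f a) (f b) (hf m) (hf a) (hf b) (j l₀)
    linear_combination hJ

end LeafForms

/-! ### Uniqueness and pullback of leaf forms -/

section Leaves
variable {F : Type*} [NormedAddCommGroup F] [NormedSpace ℝ F]
  {M : Type*} [TopologicalSpace M] [ChartedSpace F M]
  {F' : Type*} [NormedAddCommGroup F'] [NormedSpace ℝ F']
  {L : Type*} [TopologicalSpace L] [ChartedSpace F' L]
  {π : PoissonStructure F M} {j : L → M} {σ τ : TwoTensor F' L}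

theorem IsLeafForm.unique (hσ : IsLeafForm π j σ) (hτ : IsLeafForm π j τ)
    (hint : ∀ l, LinearMap.range (mfderiv 𝓘(ℝ, F') 𝓘(ℝ, F) j l).toLinearMap ≤ π.charDist (j l)) :
    σ = τ := by
  ext l u v
  obtain ⟨α, hα⟩ := hint l ⟨u, rfl⟩
  obtain ⟨β, hβ⟩ := hint l ⟨v, rfl⟩
  rw [hσ l u v α β hα.symm hβ.symm, hτ l u v α β hα.symm hβ.symm]

theorem IsLeafForm.comp {φ : L → L} (hσ : IsLeafForm π j σ)
    (hj : MDifferentiable 𝓘(ℝ, F') 𝓘(ℝ, F) j) (hφ : MDifferentiable 𝓘(ℝ, F') 𝓘(ℝ, F') φ) :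
    IsLeafForm π (fun l => j (φ l)) (fun l =>
      (σ (φ l)).compl₁₂ (mfderiv 𝓘(ℝ, F') 𝓘(ℝ, F') φ l).toLinearMap
        (mfderiv 𝓘(ℝ, F') 𝓘(ℝ, F') φ l).toLinearMap) := by
  intro l u v α β hu hv
  have h := mfderiv_comp (I' := 𝓘(ℝ, F')) l (hj (φ l)) (hφ l)
  exact hσ (φ l) _ _ α β ((DFunLike.congr_fun h u).symm.trans hu)
    ((DFunLike.congr_fun h v).symm.trans hv)

theorem IsLeafForm.apply_of_eq (hσ : IsLeafForm π j σ) {l : L} {x : M} (hx : j l = x)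
    {u v : TangentSpace 𝓘(ℝ, F') l} {α β : Module.Dual ℝ (TangentSpace 𝓘(ℝ, F) x)}
    (hu : (mfderiv 𝓘(ℝ, F') 𝓘(ℝ, F) j l u : F) = π.sharp x α)
    (hv : (mfderiv 𝓘(ℝ, F') 𝓘(ℝ, F) j l v : F) = π.sharp x β) :
    σ l u v = β (π.sharp x α) := by
  subst hx
  exact hσ l u v α β hu hv

end Leaves

/-! ### The leaves as homogeneous symplectic manifolds -/

section Homogeneous
variable {E : Type*} [NormedAddCommGroup E] [NormedSpace ℝ E]
  {G : Type*} [TopologicalSpace G] [ChartedSpace E G] [Group G] [LieGroup 𝓘(ℝ, E) ∞ G]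
  {F : Type*} [NormedAddCommGroup F] [NormedSpace ℝ F]
  {H : Subgroup G} [ChartedSpace F (G ⧸ H)] {π : PoissonStructure F (G ⧸ H)}
  {E' : Type*} [NormedAddCommGroup E'] [NormedSpace ℝ E']
  {A : Type*} [TopologicalSpace A] [ChartedSpace E' A] [Group A] [LieGroup 𝓘(ℝ, E') ∞ A]
  {ι : A →* G}
  {F' : Type*} [NormedAddCommGroup F'] [NormedSpace ℝ F']

/-- If T(λ_g ∘ j)w = π_# γ, then invariance and injectivity of Tλ_g give Tj w = π_#(γ ∘ Tλ_g), so
both leaf conditions prescribe the same value. -/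
theorem IsLeafForm.smul {L : Type*} [TopologicalSpace L] [ChartedSpace F' L]
    {j : L → G ⧸ H} {σ : TwoTensor F' L} (hσ : IsLeafForm π j σ)
    (hp : IsSubmersion 𝓘(ℝ, E) 𝓘(ℝ, F) ∞ (proj H)) (hπ : IsInvariant π)
    (hj : MDifferentiable 𝓘(ℝ, F') 𝓘(ℝ, F) j) (g : G) :
    IsLeafForm π (fun l => g • j l) σ := by
  intro l u v α β hu hv
  let T := (mfderiv 𝓘(ℝ, F) 𝓘(ℝ, F) (fun y : G ⧸ H => g • y) (j l)).toLinearMap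
  have h := mfderiv_comp (I' := 𝓘(ℝ, F)) l (mdifferentiableAt_smul hp g (j l)) (hj l)
  have key : ∀ (w : TangentSpace 𝓘(ℝ, F') l) (γ : Module.Dual ℝ (TangentSpace 𝓘(ℝ, F) (g • j l))),
      mfderiv 𝓘(ℝ, F') 𝓘(ℝ, F) (fun l => g • j l) l w = π.sharp (g • j l) γ →
      mfderiv 𝓘(ℝ, F') 𝓘(ℝ, F) j l w = π.sharp (j l) (γ ∘ₗ T) := by
    intro w γ hw
    refine mfderiv_smul_injective hp g (j l) ?_
    exact (DFunLike.congr_fun h w).symm.trans (hw.trans (hπ g (j l) γ))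
  rw [hσ l u v _ _ (key u α hu) (key v β hv), hπ g (j l) α]
  rfl

omit [TopologicalSpace G] [TopologicalSpace A] in
theorem leafMap_proj (g : G) (a : A) :
    leafMap H ι g (proj (H.comap ι) a) = proj H (g * ι a) := rfl

omit [TopologicalSpace G] [TopologicalSpace A] in
theorem leafMap_eq_smul (g : G) (x : A ⧸ H.comap ι) :
    leafMap H ι g x = g • leafMap H ι 1 x := by
  obtain ⟨a, rfl⟩ := proj_surjective x
  rw [leafMap_proj, leafMap_proj, one_mul]
  rfl

omit [TopologicalSpace G] [TopologicalSpace A] in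
theorem leafMap_smul (g : G) (a : A) (x : A ⧸ H.comap ι) :
    leafMap H ι g (a • x) = (g * ι a * g⁻¹) • leafMap H ι g x := by
  obtain ⟨b, rfl⟩ := proj_surjective x
  show proj H (g * ι (a * b)) = proj H (g * ι a * g⁻¹ * (g * ι b))
  rw [map_mul]
  congr 1
  group

omit [TopologicalSpace G] [TopologicalSpace A] in
theorem leafMap_injective (g : G) : Function.Injective (leafMap H ι g) := by
  intro x y hxy
  obtain ⟨a, rfl⟩ := proj_surjective x
  obtain ⟨b, rfl⟩ := proj_surjective y
  have h := QuotientGroup.eq.1 hxy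
  refine QuotientGroup.eq.2 (Subgroup.mem_comap.2 ?_)
  simpa [mul_assoc] using h

variable [ChartedSpace F' (A ⧸ H.comap ι)]

omit [LieGroup 𝓘(ℝ, E') ∞ A] in
theorem contMDiff_leafMap (hp : IsSubmersion 𝓘(ℝ, E) 𝓘(ℝ, F) ∞ (proj H))
    (hpA : IsSubmersion 𝓘(ℝ, E') 𝓘(ℝ, F') ∞ (proj (H.comap ι)))
    (hι : ContMDiff 𝓘(ℝ, E') 𝓘(ℝ, E) ∞ ι) (g : G) :
    ContMDiff 𝓘(ℝ, F') 𝓘(ℝ, F) ∞ (leafMap H ι g) :=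
  contMDiff_of_comp_submersion hpA proj_surjective (contMDiff_orbit hp hι g)

theorem mfderiv_leafMap (hp : IsSubmersion 𝓘(ℝ, E) 𝓘(ℝ, F) ∞ (proj H))
    (hpA : IsSubmersion 𝓘(ℝ, E') 𝓘(ℝ, F') ∞ (proj (H.comap ι)))
    (hι : ContMDiff 𝓘(ℝ, E') 𝓘(ℝ, E) ∞ ι) (g : G) (a : A) (u : GroupLieAlgebra 𝓘(ℝ, E') A) :
    mfderiv 𝓘(ℝ, F') 𝓘(ℝ, F) (leafMap H ι g) (proj (H.comap ι) a) (dproj F' (H.comap ι) a u) =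
      dproj F H (g * ι a) (lieMap E' E ι u) := by
  have h := mfderiv_comp (I' := 𝓘(ℝ, F')) a
    ((contMDiff_leafMap hp hpA hι g).contMDiffAt.mdifferentiableAt
      (x := proj (H.comap ι) a) (by simp)) (mdifferentiableAt_proj hpA a)
  refine (DFunLike.congr_fun h (mulInvariantVectorField u a)).symm.trans ?_
  exact mfderiv_orbit hp hι g a u

/-- Follow an integral curve of the left-invariant field of u in A. Its image in G/H has zero
velocity, hence is locally constant; the leaf map being injective, the image in A/(A ∩ H) is
constant too, so u lies in the kernel of the projection. This is what makes the leaf map an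
immersion. -/
theorem mem_lieSub_comap [FiniteDimensional ℝ E'] [IsManifold 𝓘(ℝ, F) ∞ (G ⧸ H)]
    (hp : IsSubmersion 𝓘(ℝ, E) 𝓘(ℝ, F) ∞ (proj H))
    (hpA : IsSubmersion 𝓘(ℝ, E') 𝓘(ℝ, F') ∞ (proj (H.comap ι)))
    (hι : ContMDiff 𝓘(ℝ, E') 𝓘(ℝ, E) ∞ ι)
    {u : GroupLieAlgebra 𝓘(ℝ, E') A} (hu : lieMap E' E ι u ∈ lieSub E H) :
    u ∈ lieSub E' (H.comap ι) := by
  have : CompleteSpace E' := FiniteDimensional.complete ℝ E'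
  have : IsManifold 𝓘(ℝ, E') ∞ A := inferInstance
  have : IsManifold 𝓘(ℝ, E') 1 A :=
    IsManifold.of_le (n := ∞) (WithTop.coe_le_coe.2 (le_top : (1 : ℕ∞) ≤ ⊤))
  let u' : E' := u
  have hs : ContMDiff 𝓘(ℝ, E') 𝓘(ℝ, E').tangent ∞
      (fun a : A => (⟨a, mulInvariantVectorField u a⟩ : TangentBundle 𝓘(ℝ, E') A)) :=
    contMDiff_mulInvariantVectorField_uncurried.comp
      ((contMDiff_id (I := 𝓘(ℝ, E')) (M := A)).prodMk
        (contMDiff_const (c := u') (I' := 𝓘(ℝ, E'))))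
  obtain ⟨γ, -, hγ⟩ := exists_isMIntegralCurveAt_of_contMDiffAt_boundaryless 0
    ((hs.of_le (WithTop.coe_le_coe.2 (le_top : (1 : ℕ∞) ≤ ⊤))).contMDiffAt (x := (1 : A)))
  have h1 : ∀ᶠ t in 𝓝 (0 : ℝ), HasMFDerivAt 𝓘(ℝ, ℝ) 𝓘(ℝ, F)
      (fun t => proj H (1 * ι (γ t))) t 0 := by
    filter_upwards [hγ] with t ht
    have h2 := HasMFDerivAt.comp t
      (((contMDiff_orbit hp hι 1).contMDiffAt (x := γ t)).mdifferentiableAt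
      (by simp)).hasMFDerivAt ht
    refine HasMFDerivAt.congr_mfderiv h2 (ContinuousLinearMap.ext fun (r : ℝ) => ?_)
    have h3 := mfderiv_orbit hp hι 1 (γ t) u
    rw [(dproj_eq_zero_iff hp _ _).2 hu] at h3
    refine (map_smul (mfderiv 𝓘(ℝ, E') 𝓘(ℝ, F) (fun a => proj H (1 * ι a)) (γ t))
      r (mulInvariantVectorField u (γ t))).trans ?_
    exact (congrArg (fun w : F => r • w) h3).trans (smul_zero (A := F) r)
  have h2 : (fun t => proj (H.comap ι) (γ t)) =ᶠ[𝓝 0] fun _ => proj (H.comap ι) (γ 0) := by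
    filter_upwards [eventually_const_of_mfderiv_zero h1] with t ht
    exact leafMap_injective 1 ht
  have h3 := HasMFDerivAt.comp 0 (mdifferentiableAt_proj hpA (γ 0)).hasMFDerivAt
    hγ.self_of_nhds
  have h4 : HasMFDerivAt 𝓘(ℝ, ℝ) 𝓘(ℝ, F') (fun t => proj (H.comap ι) (γ t)) 0 0 :=
    (hasMFDerivAt_const (proj (H.comap ι) (γ 0)) (0 : ℝ)).congr_of_eventuallyEq h2
  rw [← dproj_eq_zero_iff hpA (γ 0)]
  have h5 := DFunLike.congr_fun (hasMFDerivAt_unique h3 h4) (1 : ℝ)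
  refine Eq.trans ?_ h5
  exact congrArg (mfderiv 𝓘(ℝ, E') 𝓘(ℝ, F') (proj (H.comap ι)) (γ 0))
    (one_smul ℝ (mulInvariantVectorField u (γ 0))).symm

theorem mfderiv_leafMap_injective [FiniteDimensional ℝ E']
    [IsManifold 𝓘(ℝ, F) ∞ (G ⧸ H)]
    (hp : IsSubmersion 𝓘(ℝ, E) 𝓘(ℝ, F) ∞ (proj H))
    (hpA : IsSubmersion 𝓘(ℝ, E') 𝓘(ℝ, F') ∞ (proj (H.comap ι)))
    (hι : ContMDiff 𝓘(ℝ, E') 𝓘(ℝ, E) ∞ ι) (g : G) (x : A ⧸ H.comap ι) :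
    Function.Injective (mfderiv 𝓘(ℝ, F') 𝓘(ℝ, F) (leafMap H ι g) x) := by
  refine (injective_iff_map_eq_zero _).2 fun w hw => ?_
  obtain ⟨a, rfl⟩ := proj_surjective x
  obtain ⟨u, rfl⟩ := dproj_surjective hpA a w
  refine (dproj_eq_zero_iff hpA a u).2 (mem_lieSub_comap hp hpA hι ?_)
  rw [← dproj_eq_zero_iff hp (g * ι a)]
  exact (mfderiv_leafMap hp hpA hι g a u).symm.trans hw

theorem range_mfderiv_leafMap (hp : IsSubmersion 𝓘(ℝ, E) 𝓘(ℝ, F) ∞ (proj H))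
    (hπ : IsInvariant π)
    (hpA : IsSubmersion 𝓘(ℝ, E') 𝓘(ℝ, F') ∞ (proj (H.comap ι)))
    (hι : IsIntegralSubgroup (E := E) (E' := E') ι (aLie hp π)) (g : G) (x : A ⧸ H.comap ι) :
    LinearMap.range (mfderiv 𝓘(ℝ, F') 𝓘(ℝ, F) (leafMap H ι g) x).toLinearMap =
      π.charDist (leafMap H ι g x) := by
  obtain ⟨a, rfl⟩ := proj_surjective x
  rw [leafMap_proj, ← map_dproj_aLie hp hπ, ← hι.range_eq]
  ext v
  constructor
  · rintro ⟨w, rfl⟩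
    obtain ⟨u, rfl⟩ := dproj_surjective hpA a w
    exact ⟨_, ⟨u, rfl⟩, (mfderiv_leafMap hp hpA hι.smooth g a u).symm⟩
  · rintro ⟨_, ⟨u, rfl⟩, rfl⟩
    exact ⟨dproj F' (H.comap ι) a u, mfderiv_leafMap hp hpA hι.smooth g a u⟩

theorem isLeafManifold_leafMap [FiniteDimensional ℝ E] [FiniteDimensional ℝ E']
    [IsManifold 𝓘(ℝ, F) ∞ (G ⧸ H)]
    (hp : IsSubmersion 𝓘(ℝ, E) 𝓘(ℝ, F) ∞ (proj H)) (hπ : IsInvariant π)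
    (hpA : IsSubmersion 𝓘(ℝ, E') 𝓘(ℝ, F') ∞ (proj (H.comap ι)))
    (hι : IsIntegralSubgroup (E := E) (E' := E') ι (aLie hp π)) (g : G) :
    IsLeafManifold (F' := F') π (proj H g) (leafMap H ι g) where
  connected := by
    have := hι.connected
    exact inferInstanceAs (ConnectedSpace (Quotient _))
  smooth := contMDiff_leafMap hp hpA hι.smooth g
  injective := leafMap_injective g
  immersion := mfderiv_leafMap_injective hp hpA hι.smooth g
  integral := range_mfderiv_leafMap hp hπ hpA hι g
  image := by
    ext y
    refine Iff.trans ?_ (leafSetoid_iff hp hπ hι g y).symm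
    constructor
    · rintro ⟨x, rfl⟩
      obtain ⟨a, rfl⟩ := proj_surjective x
      exact ⟨a, rfl⟩
    · rintro ⟨a, rfl⟩
      exact ⟨proj _ a, rfl⟩

omit [LieGroup 𝓘(ℝ, E') ∞ A] in
theorem IsLeafForm.leafMap {σ : TwoTensor F' (A ⧸ H.comap ι)}
    (hσ : IsLeafForm π (leafMap H ι 1) σ)
    (hp : IsSubmersion 𝓘(ℝ, E) 𝓘(ℝ, F) ∞ (proj H)) (hπ : IsInvariant π)
    (hpA : IsSubmersion 𝓘(ℝ, E') 𝓘(ℝ, F') ∞ (proj (H.comap ι)))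
    (hι : ContMDiff 𝓘(ℝ, E') 𝓘(ℝ, E) ∞ ι) (g : G) :
    IsLeafForm π (HomPoisson.leafMap H ι g) σ := by
  rw [show HomPoisson.leafMap H ι g = fun x => g • HomPoisson.leafMap H ι 1 x from
    funext (leafMap_eq_smul g)]
  exact hσ.smul hp hπ ((contMDiff_leafMap hp hpA hι 1).mdifferentiable (by simp)) g

/-- Acting by a and then including the leaf is the leaf map based at ι(a). The pullback of σ by a
and σ itself are both its leaf form, and there is only one. -/
theorem IsLeafForm.isInvariantForm {σ : TwoTensor F' (A ⧸ H.comap ι)}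
    (hσ : IsLeafForm π (HomPoisson.leafMap H ι 1) σ)
    (hp : IsSubmersion 𝓘(ℝ, E) 𝓘(ℝ, F) ∞ (proj H)) (hπ : IsInvariant π)
    (hpA : IsSubmersion 𝓘(ℝ, E') 𝓘(ℝ, F') ∞ (proj (H.comap ι)))
    (hι : IsIntegralSubgroup (E := E) (E' := E') ι (aLie hp π)) : IsInvariantForm A σ := by
  intro a l u v
  have hj := (contMDiff_leafMap hp hpA hι.smooth 1).mdifferentiable (by simp)
  have h1 := hσ.comp hj (fun x => mdifferentiableAt_smul hpA a x)
  have h2 : (fun x : A ⧸ H.comap ι => HomPoisson.leafMap H ι 1 (a • x)) =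
      HomPoisson.leafMap H ι (ι a) := by
    ext x
    rw [leafMap_smul, leafMap_eq_smul (ι a) x, one_mul, inv_one, mul_one]
  rw [h2] at h1
  have h3 := h1.unique (hσ.leafMap hp hπ hpA hι.smooth (ι a))
    fun x => (range_mfderiv_leafMap hp hπ hpA hι (ι a) x).le
  exact DFunLike.congr_fun (DFunLike.congr_fun (congrFun h3 l) u) v

/-- If r_# η = q(u), the image of u in T_ē(G/H) is π_# of the covector matching η under 𝔤/𝔥 ≅
T_ē(G/H), so the leaf condition at the base point is the definition of ω_r. -/
theorem IsLeafForm.isInducedByOmega {σ : TwoTensor F' (A ⧸ H.comap ι)}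
    (hσ : IsLeafForm π (HomPoisson.leafMap H ι 1) σ)
    (hp : IsSubmersion 𝓘(ℝ, E) 𝓘(ℝ, F) ∞ (proj H))
    (hpA : IsSubmersion 𝓘(ℝ, E') 𝓘(ℝ, F') ∞ (proj (H.comap ι)))
    (hι : ContMDiff 𝓘(ℝ, E') 𝓘(ℝ, E) ∞ ι) : IsInducedByOmega (E' := E') hp π ι σ := by
  intro u v η ξ hu hv
  have hx : HomPoisson.leafMap H ι 1 (proj (H.comap ι) 1) = proj H 1 := by
    rw [leafMap_proj, map_one, one_mul]
  have key : ∀ (u : GroupLieAlgebra 𝓘(ℝ, E') A)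
      (η : Module.Dual ℝ (GroupLieAlgebra 𝓘(ℝ, E) G ⧸ lieSub E H)),
      rSharp hp π η = (lieSub E H).mkQ (lieMap E' E ι u) →
      (mfderiv 𝓘(ℝ, F') 𝓘(ℝ, F) (HomPoisson.leafMap H ι 1) (proj (H.comap ι) 1)
        (Tp E' F' (H.comap ι) u) : F) =
        π.sharp (proj H 1) (η ∘ₗ (PhiEquiv hp).symm.toLinearMap) := by
    intro u η hu
    have h1 : (dproj F H (1 * ι 1) (lieMap E' E ι u) : F) = Tp E F H (lieMap E' E ι u) := by
      rw [map_one, one_mul]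
      exact (Tp_eq_dproj _).symm
    have h2 := mfderiv_leafMap hp hpA hι 1 1 u
    refine (congrArg _ (Tp_eq_dproj u)).trans (h2.trans (h1.trans ?_))
    rw [← PhiEquiv_mk hp, ← hu, Phi_rSharp]
  rw [hσ.apply_of_eq hx (key u η hu) (key v ξ hv), ← Phi_rSharp]
  show ξ ((PhiEquiv hp).symm _) = _
  rw [LinearEquiv.symm_apply_apply]

end Homogeneous

variable {E : Type*} [NormedAddCommGroup E] [NormedSpace ℝ E]
  {G : Type*} [TopologicalSpace G] [ChartedSpace E G] [Group G] [LieGroup 𝓘(ℝ, E) ∞ G]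
  {F : Type*} [NormedAddCommGroup F] [NormedSpace ℝ F]
  {H : Subgroup G} [ChartedSpace F (G ⧸ H)] {π : PoissonStructure F (G ⧸ H)}

/-! ### The leaf space -/

section LeafSpaces
variable {E' : Type*} [NormedAddCommGroup E'] [NormedSpace ℝ E']
  {A : Type*} [TopologicalSpace A] [ChartedSpace E' A] [Group A] [LieGroup 𝓘(ℝ, E') ∞ A]
  {ι : A →* G} [FiniteDimensional ℝ E] [FiniteDimensional ℝ E']

theorem leaf_eq_range (hp : IsSubmersion 𝓘(ℝ, E) 𝓘(ℝ, F) ∞ (proj H)) (hπ : IsInvariant π)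
    (hι : IsIntegralSubgroup (E := E) (E' := E') ι (aLie hp π)) (g : G) :
    leaf π (proj H g) = Set.range (fun a : A => proj H (g * ι a)) :=
  Set.ext fun y => leafSetoid_iff hp hπ hι g y

theorem leaf_eq_image (hp : IsSubmersion 𝓘(ℝ, E) 𝓘(ℝ, F) ∞ (proj H)) (hπ : IsInvariant π)
    (hι : IsIntegralSubgroup (E := E) (E' := E') ι (aLie hp π)) (g : G) :
    leaf π (proj H g) = (fun c : G => c • proj H g) ''
      (ι.range.map (MulAut.conj g).toMonoidHom : Subgroup G) := by
  have h : ∀ a : A, (g * ι a * g⁻¹) • proj H g = proj H (g * ι a) := fun a =>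
    congrArg (proj H) (inv_mul_cancel_right (g * ι a) g)
  rw [leaf_eq_range hp hπ hι]
  ext y
  constructor
  · rintro ⟨a, rfl⟩
    exact ⟨_, ⟨_, ⟨a, rfl⟩, rfl⟩, h a⟩
  · rintro ⟨_, ⟨_, ⟨a, rfl⟩, rfl⟩, rfl⟩
    exact ⟨a, (h a).symm⟩

/-- Since H ⊆ A, the leaf through gH pulls back to the coset gA in G, so both spaces are topological
quotients of G by the same relation. -/
theorem exists_homeomorph_leafSpace (hp : IsSubmersion 𝓘(ℝ, E) 𝓘(ℝ, F) ∞ (proj H))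
    (hπ : IsInvariant π) (hι : IsIntegralSubgroup (E := E) (E' := E') ι (aLie hp π))
    (hH : H ≤ ι.range) : ∃ Θ : (G ⧸ ι.range) ≃ₜ LeafSpace π,
      ∀ g : G, Θ (proj ι.range g) = Quotient.mk _ (proj H g) := by
  let q : G → LeafSpace π := fun g => Quotient.mk _ (proj H g)
  have hq : Topology.IsQuotientMap q :=
    isQuotientMap_quotient_mk'.comp (QuotientGroup.isQuotientMap_mk H)
  have hqi : ∀ g g' : G, q g = q g' ↔ (QuotientGroup.mk g : G ⧸ ι.range) = QuotientGroup.mk g' := by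
    intro g g'
    rw [QuotientGroup.eq]
    refine Quotient.eq.trans ((leafSetoid_iff hp hπ hι g _).trans ⟨?_, ?_⟩)
    · rintro ⟨a, ha⟩
      have h := ι.range.mul_mem ⟨a, rfl⟩ (hH (QuotientGroup.eq.1 ha))
      simpa [mul_assoc] using h
    · rintro ⟨a, ha⟩
      exact ⟨a, by rw [ha, mul_inv_cancel_left]⟩
  let θ : G ⧸ ι.range → LeafSpace π :=
    Quotient.lift q fun g g' h => (hqi g g').2 (Quotient.sound h)
  have hθ : Function.Bijective θ := by
    constructor
    · intro x y
      induction x using QuotientGroup.induction_on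
      induction y using QuotientGroup.induction_on
      exact (hqi _ _).1
    · intro y
      obtain ⟨g, rfl⟩ := hq.surjective y
      exact ⟨QuotientGroup.mk g, rfl⟩
  refine ⟨{ Equiv.ofBijective θ hθ with
    continuous_toFun := continuous_quot_lift _ hq.continuous
    continuous_invFun := hq.continuous_iff.2 ?_ }, fun g => rfl⟩
  refine QuotientGroup.continuous_mk.congr fun g => ?_
  exact ((Equiv.ofBijective θ hθ).symm_apply_apply (QuotientGroup.mk g)).symm

end LeafSpaces

/-! ### Reductive and symmetric pairs, and the main theorem -/

theorem isReductiveDecomp_imSharp (hp : IsSubmersion 𝓘(ℝ, E) 𝓘(ℝ, F) ∞ (proj H))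
    (hπ : IsInvariant π) {m : Submodule ℝ (GroupLieAlgebra 𝓘(ℝ, E) G)}
    (hm : IsReductiveDecomp H ⊤ m) : IsReductiveDecomp H (aLie hp π) (imSharp hp π m) where
  inf_eq := by
    rw [imSharp, ← inf_assoc, hm.inf_eq, bot_inf_eq]
  sup_eq := by
    show lieSub E H ⊔ m ⊓ aLie hp π = aLie hp π
    -- The modular law, available because 𝔥 ⊆ 𝔞_r.
    rw [← sup_inf_assoc_of_le m (lieSub_le_aLie hp), hm.sup_eq, top_inf_eq]
  ad_eq b hb := by
    show (m ⊓ aLie hp π).map (Ad E b) = m ⊓ aLie hp π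
    rw [Submodule.map_inf _ (Function.LeftInverse.injective (Ad_inv_Ad b)), hm.ad_eq b hb,
      map_Ad_aLie hp hπ hb]

theorem isSymmetricDecomp_imSharp (hp : IsSubmersion 𝓘(ℝ, E) 𝓘(ℝ, F) ∞ (proj H))
    (hπ : IsInvariant π) {m : Submodule ℝ (GroupLieAlgebra 𝓘(ℝ, E) G)}
    (hm : IsSymmetricDecomp H ⊤ m) : IsSymmetricDecomp H (aLie hp π) (imSharp hp π m) where
  toIsReductiveDecomp := isReductiveDecomp_imSharp hp hπ hm.toIsReductiveDecomp
  bracket_mem u hu v hv := hm.bracket_mem u hu.1 v hv.1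

end HomPoisson

theorem mainTheorem7
    {E : Type*} [NormedAddCommGroup E] [NormedSpace ℝ E] [FiniteDimensional ℝ E]
    {G : Type*} [TopologicalSpace G] [T2Space G] [ConnectedSpace G] [Group G]
    [ChartedSpace E G] [LieGroup 𝓘(ℝ, E) ∞ G]
    (H : Subgroup G) (hH : IsClosed (H : Set G))
    -- the smooth structure of the homogeneous manifold `G/H`
    {F : Type*} [NormedAddCommGroup F] [NormedSpace ℝ F] [FiniteDimensional ℝ F]
    [ChartedSpace F (G ⧸ H)] [IsManifold 𝓘(ℝ, F) ∞ (G ⧸ H)]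
    (hp : IsSubmersion 𝓘(ℝ, E) 𝓘(ℝ, F) ∞ (HomPoisson.proj H))
    -- an invariant Poisson structure on `G/H`
    (π : HomPoisson.PoissonStructure F (G ⧸ H)) (hπ : HomPoisson.IsInvariant π)
    -- the connected Lie subgroup `A_r`, and the smooth structure of `A_r/(A_r ∩ H)`
    {E' : Type*} [NormedAddCommGroup E'] [NormedSpace ℝ E'] [FiniteDimensional ℝ E']
    {A : Type*} [TopologicalSpace A] [Group A] [ChartedSpace E' A] [LieGroup 𝓘(ℝ, E') ∞ A]
    (ι : A →* G) (hι : HomPoisson.IsIntegralSubgroup (E := E) (E' := E') ι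
      (HomPoisson.aLie hp π))
    {F' : Type*} [NormedAddCommGroup F'] [NormedSpace ℝ F'] [FiniteDimensional ℝ F']
    [ChartedSpace F' (A ⧸ H.comap ι)] [IsManifold 𝓘(ℝ, F') ∞ (A ⧸ H.comap ι)]
    (hpA : IsSubmersion 𝓘(ℝ, E') 𝓘(ℝ, F') ∞ (HomPoisson.proj (H.comap ι))) :
    -- `E = Im π_#` is a subbundle, isomorphic to `G ×_H (𝔞_r/𝔥)`
    (HomPoisson.IsSmoothSubbundle π.charDist ∧
      ∃ Ψ : HomPoisson.AssocBundle H (HomPoisson.aLie hp π) →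
          TangentBundle 𝓘(ℝ, F) (G ⧸ H),
        (∀ (g : G) (u : HomPoisson.aLie hp π),
          Ψ (HomPoisson.AssocBundle.mk g (Submodule.Quotient.mk u)) =
            ⟨g • HomPoisson.proj H 1,
              mfderiv 𝓘(ℝ, F) 𝓘(ℝ, F) (fun x : G ⧸ H => g • x) (HomPoisson.proj H 1)
                (HomPoisson.Tp E F H u)⟩) ∧
        HomPoisson.IsHomogeneousBundleIso π.charDist Ψ) ∧
    -- the leaves as sets
    (∀ g : G,
      HomPoisson.leaf π (HomPoisson.proj H g) =
          Set.range (fun a : A => HomPoisson.proj H (g * ι a)) ∧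
      HomPoisson.leaf π (HomPoisson.proj H g) =
          (fun c : G => c • HomPoisson.proj H g) ''
            (ι.range.map (MulAut.conj g).toMonoidHom : Subgroup G)) ∧
    -- the leaves as homogeneous symplectic manifolds
    (ContMDiff (𝓘(ℝ, E').prod 𝓘(ℝ, F')) 𝓘(ℝ, F') ∞
        (fun z : A × (A ⧸ H.comap ι) => z.1 • z.2) ∧
      ∃ σ : HomPoisson.TwoTensor F' (A ⧸ H.comap ι),
        HomPoisson.IsSymplecticForm σ ∧ HomPoisson.IsInvariantForm A σ ∧
        HomPoisson.IsInducedByOmega (E' := E') hp π ι σ ∧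
        ∀ g : G,
          HomPoisson.IsLeafManifold (F' := F') π (HomPoisson.proj H g)
            (HomPoisson.leafMap H ι g) ∧
          HomPoisson.IsLeafForm π (HomPoisson.leafMap H ι g) σ ∧
          ∀ (a : A) (x : A ⧸ H.comap ι),
            HomPoisson.leafMap H ι g (a • x) =
              (g * ι a * g⁻¹) • HomPoisson.leafMap H ι g x) ∧
    -- the leaf space
    (H ≤ ι.range → ∃ Θ : (G ⧸ ι.range) ≃ₜ HomPoisson.LeafSpace π,
      ∀ g : G, Θ (HomPoisson.proj ι.range g) = Quotient.mk _ (HomPoisson.proj H g)) ∧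
    -- reductive and symmetric pairs
    (∀ m : Submodule ℝ (GroupLieAlgebra 𝓘(ℝ, E) G),
      HomPoisson.IsReductiveDecomp H ⊤ m →
        HomPoisson.IsReductiveDecomp H (HomPoisson.aLie hp π) (HomPoisson.imSharp hp π m)) ∧
    (∀ m : Submodule ℝ (GroupLieAlgebra 𝓘(ℝ, E) G),
      HomPoisson.IsSymmetricDecomp H ⊤ m →
        HomPoisson.IsSymmetricDecomp H (HomPoisson.aLie hp π)
          (HomPoisson.imSharp hp π m)) := by
  have : IsTopologicalGroup G := topologicalGroup_of_lieGroup 𝓘(ℝ, E) ∞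
  -- Closedness of H makes G/H Hausdorff, as the bump functions behind the test functions require.
  have : T2Space (G ⧸ H) := by
    have := hH
    infer_instance
  have hk := HomPoisson.finrank_charDist hp hπ
  refine ⟨⟨HomPoisson.isSmoothSubbundle_of_finrank_eq π hk, _, HomPoisson.bundleMap_eq hp _,
    HomPoisson.isHomogeneousBundleIso_bundleMap hp hπ⟩,
    fun g => ⟨HomPoisson.leaf_eq_range hp hπ hι g, HomPoisson.leaf_eq_image hp hπ hι g⟩,
    ⟨HomPoisson.contMDiff_homogeneous_smul hpA, ?_⟩,
    HomPoisson.exists_homeomorph_leafSpace hp hπ hι,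
    fun m hm => HomPoisson.isReductiveDecomp_imSharp hp hπ hm,
    fun m hm => HomPoisson.isSymmetricDecomp_imSharp hp hπ hm⟩
  have hint := HomPoisson.range_mfderiv_leafMap hp hπ hpA hι 1
  -- The form is built on the leaf through the base point; translation by g makes the same σ the
  -- form of every other leaf.
  obtain ⟨σ, hσ⟩ := HomPoisson.exists_isLeafForm fun x => (hint x).le
  exact ⟨σ, hσ.isSymplecticForm hk (HomPoisson.contMDiff_leafMap hp hpA hι.smooth 1)
      (HomPoisson.mfderiv_leafMap_injective hp hpA hι.smooth 1) hint,
    hσ.isInvariantForm hp hπ hpA hι, hσ.isInducedByOmega hp hpA hι.smooth,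
    fun g => ⟨HomPoisson.isLeafManifold_leafMap hp hπ hpA hι g,
      hσ.leafMap hp hπ hpA hι.smooth g, fun a x => HomPoisson.leafMap_smul g a x⟩⟩
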